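/- **Notation.** Let $0\le n\le p$, $1\le m\le q$ be integers, $a_1,\dots,a_p,b_1,\dots,b_q\in\mathbb C$, $A_1,\dots,A_p,B_1,\dots,B_q>0$, and assume that no pole of $\Gamma(1-a_i+A_i\xi)$ $(1\le i\le n)$ is a pole of $\Gamma(b_j-B_j\xi)$ $(1\le j\le m)$. Fox's $H$-function is $$H^{m,n}_{p,q}\!\left[z\,\middle|\,{(a_j,A_j)_{1,p}\atop (b_j,B_j)_{1,q}}\right]=\frac1{2\pi i}\int_L\frac{\prod_{j=1}^m\Gamma(b_j-B_j\xi)\prod_{j=1}^n\Gamma(1-a_j+A_j\xi)}{\prod_{j=m+1}^q\Gamma(1-b_j+B_j\xi)\prod_{j=n+1}^p\Gamma(a_j-A_j\xi)}\,z^{\xi}\,d\xi ,$$ where $L$ runs from $-i\infty$ to $+i\infty$, with the poles of the $\Gamma(1-a_j+A_j\xi)$, $j\le n$, to its left and the poles of the $\Gamma(b_j-B_j\xi)$, $j\le m$, to its right. Put $\Omega=\sum_{j\le n}A_j-\sum_{j>n}A_j+\sum_{j\le m}B_j-\sum_{j>m}B_j$. For real $a$, $w\in\mathbb C\setminus\{0\}$,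 $\alpha>0$ and $\beta\in\mathbb C$ let $$(\mathcal H^{w;m,n;\alpha}_{a+;p,q;\beta}\varphi)(x)=\int_a^x(x-t)^{\beta-1}H^{m,n}_{p,q}[w(x-t)^\alpha]\varphi(t)\,dt .$$ Let $(I^{\gamma}_{a+}f)(x)=\frac1{\Gamma(\gamma)}\int_a^x(x-t)^{\gamma-1}f(t)\,dt$ for $\gamma>0$, $I^0_{a+}f=f$, and let Hilfer's derivative be $D^{\mu,\nu}_{a+}f=I^{\nu(1-\mu)}_{a+}\frac{d}{dx}\bigl(I^{(1-\nu)(1-\mu)}_{a+}f\bigr)$. **Theorem 4.** Let $0<\mu<1$, $0\le\nu\le1$, $\Re(\beta)>0$, $w\in\mathbb C\setminus\{0\}$, $\alpha>0$, $\Omega>0$, $|\arg w|<\pi\Omega/2$ (principal argument), and $$\Re(\beta-\mu)+\min_{1\le j\le m}\Re\Bigl(\frac{\alpha b_j}{B_j}\Bigr)>0 .$$ Put $\kappa=(1-\nu)(1-\mu)$. Let $\varphi$ be integrable on a bounded interval $(a,b)$, $a<b$. Then the integral $\mathcal H^{w;m,n;\alpha}_{a+;p,q;\beta}\varphi$ converges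 absolutely almost everywhere on $(a,b)$ and is integrable on $(a,b)$. Consider the formula $$D^{\mu,\nu}_{a+}\bigl(\mathcal H^{w;m,n;\alpha}_{a+;p,q;\beta}\varphi\bigr)(x)=\bigl(\mathcal H^{w;m,n+3;\alpha}_{a+;p+3,q+3;\beta-\mu}\varphi\bigr)(x),\qquad(*)$$ where the $H$-function on the right has upper parameters $(1-\beta,\alpha),(1-\beta-\kappa,\alpha),(2-\beta-\kappa,\alpha),(a_j,A_j)_{1,p}$ and lower parameters $(b_j,B_j)_{1,q},(1-\beta-\kappa,\alpha),(2-\beta-\kappa,\alpha),(1-\beta+\mu,\alpha)$. (i) If the extended $H$-function on the right also has no coinciding poles of the two families, and if $I^{\kappa}_{a+}(\mathcal H^{w;m,n;\alpha}_{a+;p,q;\beta}\varphi)$ is absolutely continuous on $[a,b]$ (so that the Hilfer derivative exists), then $(*)$ holds for almost every $x\in(a,b)$, all the integrals and derivatives in it being well defined. (ii) If moreover $\Re(\beta-\mu-\nu+\mu\nu)+\min_{1\le j\le m}\Re(\alpha b_j/B_j)>0$, then both assumptions of (i) hold for every integrable $\varphi$, so that $(*)$ holds almost everywhere on $(a,b)$;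 and if in addition $\varphi$ is continuous on $(a,b)$, then $(*)$ holds, with both sides well defined, for every $x\in(a,b)$. -/

import Mathlib

open MeasureTheory Set Filter Topology

noncomputable section

/-! ### Contours of Mellin-Barnes type -/

/-- An oriented polygonal contour running from `-i∞` to `+i∞`: it comes up the vertical ray ending
at `vert 0`, passes through the vertices `vert 0, …, vert N` along segments, and leaves along the
vertical ray going up from `vert N`. -/
structure MBContour where
  /-- number of segments -/
  N : ℕ
  /-- the vertices; only `vert 0, …, vert N` matter -/
  vert : ℕ → ℂ

namespace MBContour

/-- The point set of the contour. -/
def support (L : MBContour) : Set ℂ :=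
  {z | ∃ t : ℝ, t ≤ 0 ∧ z = L.vert 0 + t * Complex.I} ∪
  (⋃ k ∈ Finset.range L.N, segment ℝ (L.vert k) (L.vert (k + 1))) ∪
  {z | ∃ t : ℝ, 0 ≤ t ∧ z = L.vert L.N + t * Complex.I}

/-- The integral of `f` along the bounded (polygonal) part of the contour. -/
def polyIntegral (L : MBContour) (f : ℂ → ℂ) : ℂ :=
  ∑ k ∈ Finset.range L.N,
    ∫ s in (0 : ℝ)..1,
      f (L.vert k + s * (L.vert (k + 1) - L.vert k)) * (L.vert (k + 1) - L.vert k)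

/-- The integral `∫_L f(ξ) dξ` along the whole contour. -/
def integral (L : MBContour) (f : ℂ → ℂ) : ℂ :=
  (∫ t in Iic (0 : ℝ), f (L.vert 0 + t * Complex.I) * Complex.I) +
  L.polyIntegral f +
  (∫ t in Ioi (0 : ℝ), f (L.vert L.N + t * Complex.I) * Complex.I)

/-- The integral of `f` along the contour with both vertical rays cut off at length `R`. -/
def truncIntegral (L : MBContour) (f : ℂ → ℂ) (R : ℝ) : ℂ :=
  (∫ t in (-R)..0, f (L.vert 0 + t * Complex.I) * Complex.I) +
  L.polyIntegral f +
  (∫ t in (0 : ℝ)..R, f (L.vert L.N + t * Complex.I) * Complex.I)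

/-- `s` lies to the left of the (upward oriented) contour: it is not on the contour, and the
index `(1/2πi) p.v.∫_L dξ/(ξ-s)` of the contour about `s` is `+1/2`. -/
def IsLeft (L : MBContour) (s : ℂ) : Prop :=
  s ∉ L.support ∧
    Tendsto (fun R : ℝ => (2 * Real.pi * Complex.I)⁻¹ * L.truncIntegral (fun ξ => (ξ - s)⁻¹) R)
      atTop (𝓝 (1 / 2))

/-- `s` lies to the right of the (upward oriented) contour: it is not on the contour, and the
index of the contour about `s` is `-1/2`. -/
def IsRight (L : MBContour) (s : ℂ) : Prop :=
  s ∉ L.support ∧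
    Tendsto (fun R : ℝ => (2 * Real.pi * Complex.I)⁻¹ * L.truncIntegral (fun ξ => (ξ - s)⁻¹) R)
      atTop (𝓝 (-1 / 2))

end MBContour

/-! ### Fox's H-function -/

/-- The parameter lists `(a_j, A_j)_{1,p}` (upper row) and `(b_j, B_j)_{1,q}` (lower row) of an
`H`-function. The index `j = 1, …, p` is `j - 1 : Fin p` here. -/
structure FoxParams (p q : ℕ) where
  a : Fin p → ℂ
  A : Fin p → ℝ
  b : Fin q → ℂ
  B : Fin q → ℝ

namespace FoxParams

variable {p q : ℕ}

/-- The poles of `Γ(1 - a_j + A_j ξ)`, `1 ≤ j ≤ n`. -/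
def leftPoles (P : FoxParams p q) (n : ℕ) : Set ℂ :=
  {s | ∃ j : Fin p, (j : ℕ) < n ∧ ∃ k : ℕ, s = (P.a j - 1 - k) / P.A j}

/-- The poles of `Γ(b_j - B_j ξ)`, `1 ≤ j ≤ m`. -/
def rightPoles (P : FoxParams p q) (m : ℕ) : Set ℂ :=
  {s | ∃ j : Fin q, (j : ℕ) < m ∧ ∃ k : ℕ, s = (P.b j + k) / P.B j}

/-- The standing assumptions on the parameters of `H^{m,n}_{p,q}`. -/
structure IsAdmissible (P : FoxParams p q) (m n : ℕ) : Prop where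
  one_le : 1 ≤ m
  m_le : m ≤ q
  n_le : n ≤ p
  A_pos : ∀ j, 0 < P.A j
  B_pos : ∀ j, 0 < P.B j
  disjoint_poles : Disjoint (P.leftPoles n) (P.rightPoles m)

/-- `Ω = ∑_{j≤n} A_j - ∑_{j>n} A_j + ∑_{j≤m} B_j - ∑_{j>m} B_j`. -/
def omega (P : FoxParams p q) (m n : ℕ) : ℝ :=
  (∑ j : Fin p, if (j : ℕ) < n then P.A j else -P.A j) +
  (∑ j : Fin q, if (j : ℕ) < m then P.B j else -P.B j)

/-- The Mellin-Barnes kernel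
`∏_{j≤m} Γ(b_j - B_j ξ) ∏_{j≤n} Γ(1 - a_j + A_j ξ) /
  (∏_{j>m} Γ(1 - b_j + B_j ξ) ∏_{j>n} Γ(a_j - A_j ξ))`. -/
def kernel (P : FoxParams p q) (m n : ℕ) (ξ : ℂ) : ℂ :=
  ((∏ j : Fin q, if (j : ℕ) < m then Complex.Gamma (P.b j - P.B j * ξ) else 1) *
   (∏ j : Fin p, if (j : ℕ) < n then Complex.Gamma (1 - P.a j + P.A j * ξ) else 1)) /
  ((∏ j : Fin q, if (j : ℕ) < m then 1 else Complex.Gamma (1 - P.b j + P.B j * ξ)) *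
   (∏ j : Fin p, if (j : ℕ) < n then 1 else Complex.Gamma (P.a j - P.A j * ξ)))

/-- The contour `L` separates the two families of poles. -/
def Separates (P : FoxParams p q) (m n : ℕ) (L : MBContour) : Prop :=
  (∀ s ∈ P.leftPoles n, L.IsLeft s) ∧ (∀ s ∈ P.rightPoles m, L.IsRight s)

open Classical in
/-- Fox's `H`-function `H^{m,n}_{p,q}[z] = (1/2πi) ∫_L kernel(ξ) z^ξ dξ`, where `L` is a contour
from `-i∞` to `+i∞` separating the poles of the `Γ(1 - a_j + A_j ξ)` (left) from the poles of
the `Γ(b_j - B_j ξ)` (right). -/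
def foxH (P : FoxParams p q) (m n : ℕ) (z : ℂ) : ℂ :=
  if h : ∃ L : MBContour, P.Separates m n L then
    (2 * Real.pi * Complex.I)⁻¹ * h.choose.integral (fun ξ => P.kernel m n ξ * z ^ ξ)
  else 0

/-- The integrand `(x-t)^{β-1} H^{m,n}_{p,q}[w (x-t)^α] φ(t)`. -/
def opIntegrand (P : FoxParams p q) (m n : ℕ) (w : ℂ) (α : ℝ) (β : ℂ) (φ : ℝ → ℂ)
    (x t : ℝ) : ℂ :=
  ((x - t : ℝ) : ℂ) ^ (β - 1) * P.foxH m n (w * (((x - t) ^ α : ℝ) : ℂ)) * φ t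

/-- The integral operator `(H^{w;m,n;α}_{a+;p,q;β} φ)(x)`. -/
def op (P : FoxParams p q) (m n : ℕ) (w : ℂ) (α : ℝ) (β : ℂ) (a : ℝ) (φ : ℝ → ℂ) (x : ℝ) : ℂ :=
  ∫ t in a..x, P.opIntegrand m n w α β φ x t

/-- The integral defining `(H^{w;m,n;α}_{a+;p,q;β} φ)(x)` converges absolutely. -/
def OpConverges (P : FoxParams p q) (m n : ℕ) (w : ℂ) (α : ℝ) (β : ℂ) (a : ℝ) (φ : ℝ → ℂ)
    (x : ℝ) : Prop :=
  IntervalIntegrable (P.opIntegrand m n w α β φ x) volume a x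

/-- The parameter lists of the `H^{m,n+3}_{p+3,q+3}`-function in the composition with `D^{μ,ν}`:
with `κ = (1-ν)(1-μ)`, the three steps `I^κ`, `d/dx`, `I^{ν(1-μ)}` put
`(1-β, α), (1-β-κ, α), (2-β-κ, α)` in front of the upper row and
`(1-β-κ, α), (2-β-κ, α), (1-β+μ, α)` at the end of the lower row. -/
def hilferExt (P : FoxParams p q) (α : ℝ) (β : ℂ) (μ ν : ℝ) : FoxParams (p + 3) (q + 3) where
  a := Matrix.vecCons (1 - β) (Matrix.vecCons (1 - β - ((1 - ν) * (1 - μ) : ℝ))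
    (Matrix.vecCons (2 - β - ((1 - ν) * (1 - μ) : ℝ)) P.a))
  A := Matrix.vecCons α (Matrix.vecCons α (Matrix.vecCons α P.A))
  b := Fin.append P.b ![1 - β - ((1 - ν) * (1 - μ) : ℝ), 2 - β - ((1 - ν) * (1 - μ) : ℝ),
    1 - β + μ]
  B := Fin.append P.B ![α, α, α]

end FoxParams

/-! ### Fractional calculus -/

/-- The Riemann-Liouville fractional integral `I^γ_{a+}` of order `γ ≥ 0`; `I^0` is the
identity. -/
def rlIntegral (γ a : ℝ) (f : ℝ → ℂ) (x : ℝ) : ℂ :=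
  if γ = 0 then f x
  else ((Real.Gamma γ : ℝ) : ℂ)⁻¹ * ∫ t in a..x, (((x - t) ^ (γ - 1) : ℝ) : ℂ) * f t

/-- The integral defining `(I^γ_{a+} f)(x)` converges absolutely (no condition if `γ = 0`). -/
def RLConverges (γ a : ℝ) (f : ℝ → ℂ) (x : ℝ) : Prop :=
  γ ≠ 0 → IntervalIntegrable (fun t => (((x - t) ^ (γ - 1) : ℝ) : ℂ) * f t) volume a x

/-- Hilfer's fractional derivative
`D^{μ,ν}_{a+} f = I^{ν(1-μ)}_{a+} (d/dx) (I^{(1-ν)(1-μ)}_{a+} f)`. -/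
def hilferDeriv (μ ν a : ℝ) (f : ℝ → ℂ) (x : ℝ) : ℂ :=
  rlIntegral (ν * (1 - μ)) a (deriv (rlIntegral ((1 - ν) * (1 - μ)) a f)) x

/-- All operations in the definition of `(D^{μ,ν}_{a+} f)(x)` make sense: the inner integral
converges and is differentiable almost everywhere on `(a, x)`, and the outer integral converges
at `x` (if it is `I^0`, the inner integral is differentiable at `x` itself). -/
def HilferExists (μ ν a : ℝ) (f : ℝ → ℂ) (x : ℝ) : Prop :=
  (∀ᵐ t ∂(volume.restrict (Ioo a x)), RLConverges ((1 - ν) * (1 - μ)) a f t ∧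
    DifferentiableAt ℝ (rlIntegral ((1 - ν) * (1 - μ)) a f) t) ∧
  (ν * (1 - μ) = 0 → DifferentiableAt ℝ (rlIntegral ((1 - ν) * (1 - μ)) a f) x) ∧
  RLConverges (ν * (1 - μ)) a (deriv (rlIntegral ((1 - ν) * (1 - μ)) a f)) x

end

/-!
The kernel `y ^ (β - 1) H[w y ^ α]` of the integral operator is a superposition of powers
`y ^ (β + αξ - 1)` over the points `ξ` of a Mellin-Barnes contour. Riemann-Liouville integration of
order `γ` multiplies `y ^ (s - 1)` by `Γ(s) / Γ(s + γ) y ^ γ`, so the kernels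
`K_σ(y) = (2πi)⁻¹ ∫_L kernel(ξ) w ^ ξ (Γ(β + αξ) / Γ(β + σ + αξ)) y ^ (β + σ + αξ - 1) dξ`
(`FoxParams.fracKernel`) satisfy `I^γ K_σ = K_(σ + γ)` (`FoxParams.intervalConv_fracKernel`).
The kernel of the operator is `K_0`, and the one with the extended parameter lists is `K_(-μ)`:
four of the six additional Gamma factors cancel and the other two are `Γ(β + αξ) / Γ(β - μ + αξ)`
(`FoxParams.kernel_hilferExt`). The theorem is thus the statement that the Hilfer derivative, whose
orders of integration add up to `1 - μ`, takes `K_0 * φ` to `K_(-μ) * φ`.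

For this to be meaningful the kernels have to be integrable near `0`. If `Re ξ ≥ c` on the contour,
`K_σ(y)` is of size `y ^ (Re β + αc + σ - 1)`. The minimum condition says that such a `c` exists to
the left of all the right poles with exponent `> -1` for `σ = -μ` (for `σ = κ - 1` in the second
part, where `κ = (1 - ν)(1 - μ)`). A separating contour in `Re ξ ≥ c` is a vertical line `Re ξ = x`
with `x` slightly larger than `c`, together with small loops round the finitely many left poles to
the right of it (`FoxParams.exists_separates`). It gives the same `H`-function as any other
separating contour (`MBContour.integral_eq_of_same_sides`), by Cauchy's theorem for closed polygons
in the form that uses only the vanishing of the indices: on a large disc the integrand is a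
holomorphic function times a finite product of factors `1 / (ξ - s)`, and partial fractions reduce
its integral to the index integrals. The ends of the contour contribute nothing because the integrand
decays exponentially in vertical strips; this follows from the decay of `Γ` and of `1 / Γ`
(`hasDecay_Gamma`, `hasDecay_inv_Gamma`), with rate `πΩ/2 - |arg w| > 0`.

Convolution on an interval with weakly singular kernels is associative wherever the iterated
convolution of absolute values is finite: almost everywhere in general, everywhere if the two
singularities are together weak enough (`IteratedConvExists.of_one_le`), and at all points of the
open interval if `φ` is continuous there (`IteratedConvExists.of_continuousOn`). If
`F = I^κ (K_0 * φ)` is absolutely continuous, it is the primitive of its derivative and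
`I^1 I^(ν(1-μ)) F' = I^(ν(1-μ)) F = K_(1-μ) * φ = I^1 (K_(-μ) * φ)`; differentiation gives the formula
almost everywhere (`hilferDeriv_ae_eq`). Under the stronger minimum condition `K_(κ-1)` is integrable
too and `F` is the primitive of `K_(κ-1) * φ`, hence absolutely continuous, and for continuous `φ`
everything holds pointwise (`hilferDeriv_eq`).
-/

noncomputable section

/-! ### Exponential decay of the Gamma function in vertical strips -/

/-- `f` decays like `exp (-(ω - ε) |Im z|)` for each `ε > 0` as `|Im z| → ∞`, uniformly in the
strip `x₁ ≤ Re z ≤ x₂`. The loss of `ε` absorbs all polynomial factors; `ω` may be negative. -/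
def StripDecay (ω x₁ x₂ : ℝ) (f : ℂ → ℂ) : Prop :=
  ∀ ω' < ω, ∃ C Y : ℝ, ∀ z : ℂ, x₁ ≤ z.re → z.re ≤ x₂ → Y ≤ |z.im| →
    ‖f z‖ ≤ C * Real.exp (-ω' * |z.im|)

/-- `f` decays like `exp (-(ω - ε) |Im z|)` for each `ε > 0`, uniformly in each vertical strip. -/
def HasDecay (ω : ℝ) (f : ℂ → ℂ) : Prop := ∀ x₁ x₂ : ℝ, StripDecay ω x₁ x₂ f

lemma StripDecay.mul {ω₁ ω₂ x₁ x₂ : ℝ} {f g : ℂ → ℂ} (hf : StripDecay ω₁ x₁ x₂ f)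
    (hg : StripDecay ω₂ x₁ x₂ g) : StripDecay (ω₁ + ω₂) x₁ x₂ (fun z => f z * g z) := by
  intro ω' hω'
  set ε := (ω₁ + ω₂ - ω') / 2 with hε
  obtain ⟨C, Y, h⟩ := hf (ω₁ - ε) (by linarith)
  obtain ⟨D, Z, k⟩ := hg (ω₂ - ε) (by linarith)
  refine ⟨C * D, max Y Z, fun z h1 h2 h3 => ?_⟩
  have A := h z h1 h2 (le_trans (le_max_left _ _) h3)
  have B := k z h1 h2 (le_trans (le_max_right _ _) h3)
  have e : -ω' * |z.im| = -(ω₁ - ε) * |z.im| + -(ω₂ - ε) * |z.im| := by rw [hε]; ring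
  rw [norm_mul, e, Real.exp_add]
  calc _ ≤ _ := mul_le_mul A B (norm_nonneg _) ((norm_nonneg _).trans A)
    _ = _ := by ring

lemma StripDecay.congr {ω x₁ x₂ Y : ℝ} {f g : ℂ → ℂ} (hf : StripDecay ω x₁ x₂ f)
    (h : ∀ z : ℂ, Y ≤ |z.im| → g z = f z) : StripDecay ω x₁ x₂ g := by
  intro ω' hω'
  obtain ⟨C, Z, k⟩ := hf ω' hω'
  refine ⟨C, max Y Z, fun z h1 h2 h3 => ?_⟩
  rw [h z (le_trans (le_max_left _ _) h3)]
  exact k z h1 h2 (le_trans (le_max_right _ _) h3)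

/-- The strip may move under a real translation, as the height `|Im z|` does not. -/
lemma StripDecay.comp_add {ω x₁ x₂ : ℝ} {f : ℂ → ℂ} (r : ℝ)
    (hf : StripDecay ω (x₁ + r) (x₂ + r) f) : StripDecay ω x₁ x₂ (fun z => f (z + r)) := by
  intro ω' hω'
  obtain ⟨C, Z, k⟩ := hf ω' hω'
  refine ⟨C, Z, fun z h1 h2 h3 => ?_⟩
  have := k (z + r) (by simpa using h1) (by simpa using h2) (by simpa using h3)
  simpa using this

lemma StripDecay.of_bound {ω x₁ x₂ C Y : ℝ} {f : ℂ → ℂ}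
    (h : ∀ z : ℂ, x₁ ≤ z.re → z.re ≤ x₂ → Y ≤ |z.im| → ‖f z‖ ≤ C * Real.exp (-ω * |z.im|)) :
    StripDecay ω x₁ x₂ f := by
  intro ω' hω'
  refine ⟨C, Y, fun z h1 h2 h3 => (h z h1 h2 h3).trans ?_⟩
  have hC : 0 ≤ C := by
    by_contra hC
    have := (norm_nonneg _).trans (h z h1 h2 h3)
    nlinarith [Real.exp_pos (-ω * |z.im|)]
  gcongr

lemma StripDecay.id (x₁ x₂ : ℝ) : StripDecay 0 x₁ x₂ (fun z => z) := by
  intro ω' hω'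
  set M := max |x₁| |x₂|
  refine ⟨M + (-ω')⁻¹, 0, fun z h1 h2 h3 => ?_⟩
  have hre : |z.re| ≤ M := abs_le_max_abs_abs h1 h2
  have hM : 0 ≤ M := (abs_nonneg _).trans hre
  have h4 : (-ω' * |z.im|) + 1 ≤ Real.exp (-ω' * |z.im|) := Real.add_one_le_exp _
  have h5 : 1 ≤ Real.exp (-ω' * |z.im|) := by
    apply Real.one_le_exp; nlinarith [abs_nonneg z.im]
  have h6 : |z.im| ≤ (-ω')⁻¹ * Real.exp (-ω' * |z.im|) := by
    rw [inv_mul_eq_div, le_div_iff₀ (by linarith)]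
    linarith
  have := Complex.norm_le_abs_re_add_abs_im z
  nlinarith

lemma StripDecay.inv (x₁ x₂ : ℝ) : StripDecay 0 x₁ x₂ (fun z => z⁻¹) := by
  refine StripDecay.of_bound (C := 1) (Y := 1) fun z _ _ h => ?_
  have h1 : 1 ≤ ‖z‖ := h.trans (Complex.abs_im_le_norm z)
  simpa using inv_le_one_of_one_le₀ h1

/-- The ratio `|Γ(x + iy)| / Γ(x)` increases with `x > 0`; this is read off from Euler's product. -/
lemma norm_Gamma_mul_Gamma_le {x X : ℝ} (hx : 0 < x) (hX : x ≤ X) (y : ℝ) :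
    ‖Complex.Gamma (x + y * Complex.I)‖ * Real.Gamma X ≤
      Real.Gamma x * ‖Complex.Gamma (X + y * Complex.I)‖ := by
  refine le_of_tendsto_of_tendsto
    (((Complex.GammaSeq_tendsto_Gamma (x + y * Complex.I)).norm).mul
      (Real.GammaSeq_tendsto_Gamma X))
    ((Real.GammaSeq_tendsto_Gamma x).mul
      ((Complex.GammaSeq_tendsto_Gamma (X + y * Complex.I)).norm)) ?_
  filter_upwards [eventually_gt_atTop 0] with n hn
  have hn' : (0 : ℝ) < n := by exact_mod_cast hn
  have key : ∀ u : ℝ, ‖Complex.GammaSeq (u + y * Complex.I) n‖ =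
      (n : ℝ) ^ u * n.factorial / ∏ j ∈ Finset.range (n + 1), ‖(u + j : ℝ) + y * Complex.I‖ := by
    intro u
    rw [Complex.GammaSeq, norm_div, norm_mul, norm_prod]
    congr 2
    · rw [← Complex.ofReal_natCast, Complex.norm_cpow_eq_rpow_re_of_pos hn']
      simp
    · simp
    · funext j; congr 1; push_cast; ring
  rw [key, key, Real.GammaSeq, Real.GammaSeq]
  have hpos : ∀ u : ℝ, 0 < u → 0 < ∏ j ∈ Finset.range (n + 1), (u + j) := fun u hu =>
    Finset.prod_pos fun j _ => by positivity
  have hpos' : ∀ u : ℝ, 0 < u →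
      0 < ∏ j ∈ Finset.range (n + 1), ‖((u + j : ℝ) : ℂ) + y * Complex.I‖ := fun u hu =>
    Finset.prod_pos fun j _ => by
      rw [norm_pos_iff]; intro h
      have := congrArg Complex.re h
      simp at this
      have : 0 < u + j := by positivity
      linarith
  have hmain : (∏ j ∈ Finset.range (n + 1), (x + j)) *
        ∏ j ∈ Finset.range (n + 1), ‖((X + j : ℝ) : ℂ) + y * Complex.I‖ ≤
      (∏ j ∈ Finset.range (n + 1), (X + j)) *
        ∏ j ∈ Finset.range (n + 1), ‖((x + j : ℝ) : ℂ) + y * Complex.I‖ := by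
    rw [← Finset.prod_mul_distrib, ← Finset.prod_mul_distrib]
    have hX0 : 0 < X := hx.trans_le hX
    refine Finset.prod_le_prod (fun j _ => by positivity) fun j _ => ?_
    have h1 : 0 < x + j := by positivity
    have h2 : x + j ≤ X + j := by linarith
    rw [Complex.norm_add_mul_I, Complex.norm_add_mul_I]
    apply le_of_sq_le_sq _ (by positivity)
    rw [mul_pow, mul_pow, Real.sq_sqrt (by positivity), Real.sq_sqrt (by positivity)]
    nlinarith [mul_le_mul h2 h2 h1.le (by linarith), sq_nonneg y]
  rw [div_mul_div_comm, div_mul_div_comm, div_le_div_iff₀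
    (mul_pos (hpos' x hx) (hpos X (hx.trans_le hX)))
    (mul_pos (hpos x hx) (hpos' X (hx.trans_le hX)))]
  have := mul_le_mul_of_nonneg_left hmain
    (show 0 ≤ (n : ℝ) ^ x * n.factorial * ((n : ℝ) ^ X * n.factorial) by positivity)
  nlinarith [this]

lemma norm_Gamma_half_sq (y : ℝ) :
    ‖Complex.Gamma ((1 / 2 : ℝ) + y * Complex.I)‖ ^ 2 = Real.pi / Real.cosh (Real.pi * y) := by
  have h := Complex.Gamma_mul_Gamma_one_sub ((1 / 2 : ℝ) + y * Complex.I)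
  have e1 : (1 : ℂ) - ((1 / 2 : ℝ) + y * Complex.I) =
      (starRingEnd ℂ) ((1 / 2 : ℝ) + y * Complex.I) := by
    apply Complex.ext <;> simp; norm_num
  rw [e1, Complex.Gamma_conj, Complex.mul_conj, Complex.normSq_eq_norm_sq] at h
  have e2 : Complex.sin (Real.pi * ((1 / 2 : ℝ) + y * Complex.I)) =
      (Real.cosh (Real.pi * y) : ℝ) := by
    have : (Real.pi : ℂ) * ((1 / 2 : ℝ) + y * Complex.I) =
        (Real.pi * y : ℝ) * Complex.I + Real.pi / 2 := by push_cast; ring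
    rw [this, Complex.sin_add_pi_div_two, Complex.cos_mul_I, Complex.ofReal_cosh]
  rw [e2] at h
  exact_mod_cast h

/-- The decay in a strip of width one: on the line `Re z = 1/2` it comes from the reflection formula,
hence on `Re z = 3/2`, and monotonicity of `|Γ(x + iy)| / Γ(x)` bounds `Γ` in the strip by its values
on the latter line. -/
lemma stripDecay_Gamma_half : StripDecay (Real.pi / 2) (1 / 2) (3 / 2) Complex.Gamma := by
  have hG : 0 < Real.Gamma (3 / 2) := Real.Gamma_pos_of_pos (by norm_num)
  -- on the line `Re z = 1/2` the modulus is known in closed form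
  have half : ∀ y : ℝ, ‖Complex.Gamma ((1 / 2 : ℝ) + y * Complex.I)‖ ≤
      Real.sqrt (2 * Real.pi) * Real.exp (-(Real.pi / 2) * |y|) := by
    intro y
    apply le_of_sq_le_sq _ (by positivity)
    rw [norm_Gamma_half_sq, mul_pow, Real.sq_sqrt (by positivity), ← Real.exp_nat_mul]
    rw [div_le_iff₀ (Real.cosh_pos _)]
    have h1 : Real.exp (Real.pi * |y|) ≤ 2 * Real.cosh (Real.pi * y) := by
      rw [Real.cosh_eq]
      rcases abs_cases y with ⟨h, _⟩ | ⟨h, _⟩ <;> rw [h]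
      · have := Real.exp_pos (-(Real.pi * y)); linarith
      · have := Real.exp_pos (Real.pi * y)
        have e : Real.pi * -y = -(Real.pi * y) := by ring
        rw [e]; linarith
    have h2 : Real.exp ((2 : ℕ) * (-(Real.pi / 2) * |y|)) * Real.exp (Real.pi * |y|) = 1 := by
      rw [← Real.exp_add, Real.exp_eq_one_iff]; push_cast; ring
    have h3 := Real.exp_pos ((2 : ℕ) * (-(Real.pi / 2) * |y|))
    nlinarith [Real.pi_pos, mul_le_mul_of_nonneg_left h1 (mul_pos Real.pi_pos h3).le]
  obtain ⟨D, hD⟩ : ∃ D, ∀ x ∈ Icc (1 / 2 : ℝ) (3 / 2), ‖Real.Gamma x‖ ≤ D := by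
    refine isCompact_Icc.exists_bound_of_continuousOn fun x hx => ?_
    refine (Real.differentiableAt_Gamma fun m => ?_).continuousAt.continuousWithinAt
    have := hx.1
    have : (0 : ℝ) ≤ m := by positivity
    linarith
  have hhalf : StripDecay (Real.pi / 2) (1 / 2) (3 / 2)
      (fun z => Complex.Gamma ((1 / 2 : ℝ) + z.im * Complex.I)) :=
    StripDecay.of_bound (Y := 0) fun z _ _ _ => half z.im
  -- the factor `Γ(3/2 + iy) / Γ(1/2 + iy) = 1/2 + iy`
  have hlin : StripDecay 0 (1 / 2) (3 / 2) (fun z => (1 / 2 : ℝ) + z.im * Complex.I) := by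
    intro ω' hω'
    obtain ⟨C, Y, h⟩ := StripDecay.id (1 / 2) (3 / 2) ω' hω'
    exact ⟨C, Y, fun z h1 h2 h3 => by
      simpa using h ((1 / 2 : ℝ) + z.im * Complex.I) (by simp) (by simp; norm_num) (by simpa)⟩
  have hprod := (hlin.mul hhalf)
  rw [zero_add] at hprod
  intro ω' hω'
  obtain ⟨C, Y, h⟩ := hprod ω' hω'
  refine ⟨D / Real.Gamma (3 / 2) * C, Y, fun z h1 h2 h3 => ?_⟩
  have k := h z h1 h2 h3
  have hne : ((1 / 2 : ℝ) : ℂ) + z.im * Complex.I ≠ 0 := by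
    intro h0; have := congrArg Complex.re h0; simp at this
  have k2 := norm_Gamma_mul_Gamma_le (x := z.re) (X := 3 / 2) (by linarith) h2 z.im
  rw [Complex.re_add_im] at k2
  have e : ((3 / 2 : ℝ) : ℂ) + z.im * Complex.I =
      ((1 / 2 : ℝ) : ℂ) + z.im * Complex.I + 1 := by push_cast; ring
  rw [e, Complex.Gamma_add_one _ hne] at k2
  have hDz := (le_abs_self _).trans (hD z.re ⟨h1, h2⟩)
  have : ‖Complex.Gamma z‖ * Real.Gamma (3 / 2) ≤ D * (C * Real.exp (-ω' * |z.im|)) :=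
    k2.trans (mul_le_mul hDz k (norm_nonneg _) ((abs_nonneg _).trans (hD z.re ⟨h1, h2⟩)))
  rw [div_mul_eq_mul_div, div_mul_eq_mul_div, le_div_iff₀ hG]
  linarith

lemma StripDecay.mono {ω x₁ x₂ y₁ y₂ : ℝ} {f : ℂ → ℂ} (hf : StripDecay ω x₁ x₂ f) (h₁ : x₁ ≤ y₁)
    (h₂ : y₂ ≤ x₂) : StripDecay ω y₁ y₂ f := by
  intro ω' hω'
  obtain ⟨C, Y, h⟩ := hf ω' hω'
  exact ⟨C, Y, fun z h1 h2 h3 => h z (h₁.trans h1) (h2.trans h₂) h3⟩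

lemma StripDecay.union {ω x₁ x₂ x₃ : ℝ} {f : ℂ → ℂ} (hf : StripDecay ω x₁ x₂ f)
    (hg : StripDecay ω x₂ x₃ f) : StripDecay ω x₁ x₃ f := by
  intro ω' hω'
  obtain ⟨C, Y, h⟩ := hf ω' hω'
  obtain ⟨D, Z, k⟩ := hg ω' hω'
  refine ⟨max C D, max Y Z, fun z h1 h2 h3 => ?_⟩
  rcases le_total z.re x₂ with h4 | h4
  · exact (h z h1 h4 (le_trans (le_max_left _ _) h3)).trans (by gcongr; exact le_max_left _ _)
  · exact (k z h4 h2 (le_trans (le_max_right _ _) h3)).trans (by gcongr; exact le_max_right _ _)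

lemma ne_zero_of_one_le_abs_im {z : ℂ} (h : 1 ≤ |z.im|) : z ≠ 0 := by
  rintro rfl; simp at h; linarith

/-- The functional equation moves the strip of width one to either side; the linear factors do not
change the rate. -/
theorem hasDecay_Gamma : HasDecay (Real.pi / 2) Complex.Gamma := by
  have key : ∀ n : ℕ, StripDecay (Real.pi / 2) (1 / 2 - n) (3 / 2 + n) Complex.Gamma := by
    intro n
    induction n with
    | zero => simpa using stripDecay_Gamma_half
    | succ n ih =>
      have hn : (0 : ℝ) ≤ n := n.cast_nonneg
      have down : StripDecay (Real.pi / 2) (1 / 2 - (n + 1 : ℕ)) (3 / 2 + n - 1) Complex.Gamma := by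
        have h1 := (StripDecay.inv (1 / 2 - (n + 1 : ℕ)) (3 / 2 + n - 1)).mul
          (StripDecay.comp_add (x₁ := 1 / 2 - (n + 1 : ℕ)) (x₂ := 3 / 2 + n - 1) 1
          (ih.mono (by push_cast; linarith) (by linarith)))
        rw [zero_add] at h1
        refine h1.congr (Y := 1) fun z hz => ?_
        have hz0 := ne_zero_of_one_le_abs_im hz
        rw [Complex.ofReal_one, Complex.Gamma_add_one _ hz0, inv_mul_cancel_left₀ hz0]
      have up : StripDecay (Real.pi / 2) (3 / 2 + n) (3 / 2 + (n + 1 : ℕ)) Complex.Gamma := by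
        have h1 := (StripDecay.comp_add (x₁ := 3 / 2 + n) (x₂ := 3 / 2 + (n + 1 : ℕ)) (-1)
            (StripDecay.id _ _)).mul
          (StripDecay.comp_add (x₁ := 3 / 2 + n) (x₂ := 3 / 2 + (n + 1 : ℕ)) (-1)
          (ih.mono (by linarith) (by push_cast; linarith)))
        rw [zero_add] at h1
        refine h1.congr (Y := 1) fun z hz => ?_
        have hz0 : z + ((-1 : ℝ) : ℂ) ≠ 0 := ne_zero_of_one_le_abs_im (by simpa using hz)
        rw [← Complex.Gamma_add_one _ hz0]
        congr 1; push_cast; ring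
      exact (down.union (ih.mono (by linarith) le_rfl)).union up
  intro x₁ x₂
  obtain ⟨n, hn⟩ := exists_nat_ge (max |x₁| |x₂|)
  refine (key (n + 1)).mono ?_ ?_
  · have := neg_abs_le x₁; have := le_max_left |x₁| |x₂|; push_cast; linarith
  · have := le_abs_self x₂; have := le_max_right |x₁| |x₂|; push_cast; linarith

lemma HasDecay.mul {ω₁ ω₂ : ℝ} {f g : ℂ → ℂ} (hf : HasDecay ω₁ f) (hg : HasDecay ω₂ g) :
    HasDecay (ω₁ + ω₂) (fun z => f z * g z) := fun x₁ x₂ => (hf x₁ x₂).mul (hg x₁ x₂)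

lemma HasDecay.const (c : ℂ) : HasDecay 0 (fun _ => c) := fun x₁ x₂ =>
  StripDecay.of_bound (C := ‖c‖) (Y := 0) fun z _ _ _ => by simp

lemma HasDecay.prod {ι : Type*} (s : Finset ι) {ω : ι → ℝ} {f : ι → ℂ → ℂ}
    (h : ∀ i ∈ s, HasDecay (ω i) (f i)) : HasDecay (∑ i ∈ s, ω i) (fun z => ∏ i ∈ s, f i z) := by
  classical
  induction s using Finset.induction_on with
  | empty => simpa using HasDecay.const 1
  | insert a s ha ih =>
    simp only [Finset.sum_insert ha, Finset.prod_insert ha]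
    exact (h a (by simp)).mul (ih fun i hi => h i (by simp [hi]))

lemma HasDecay.comp_affine {ω : ℝ} {f : ℂ → ℂ} (hf : HasDecay ω f) (u : ℂ) {v : ℝ} (hv : v ≠ 0) :
    HasDecay (ω * |v|) (fun z => f (u + v * z)) := by
  intro x₁ x₂ ω' hω'
  have hv' : 0 < |v| := abs_pos.mpr hv
  set M := max |x₁| |x₂|
  obtain ⟨C, Y, h⟩ := hf (u.re - |v| * M) (u.re + |v| * M) (ω' / |v|) (by rwa [div_lt_iff₀ hv'])
  refine ⟨C * Real.exp (abs (ω' / |v|) * |u.im|), (Y + |u.im|) / |v|, fun z h1 h2 h3 => ?_⟩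
  have hre : |v * z.re| ≤ |v| * M := by
    rw [abs_mul]; exact mul_le_mul_of_nonneg_left (abs_le_max_abs_abs h1 h2) hv'.le
  have hre' := abs_le.mp hre
  have him : |v| * |z.im| = |v * z.im| := (abs_mul _ _).symm
  have t1 : |v * z.im| ≤ |u.im + v * z.im| + |u.im| := by
    have := abs_sub (u.im + v * z.im) u.im; simpa using this
  have t2 : |u.im + v * z.im| ≤ |u.im| + |v * z.im| := abs_add_le _ _
  rw [div_le_iff₀ hv'] at h3
  have k := h (u + v * z) (by simp; linarith) (by simp; linarith)
    (by simp; nlinarith)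
  have hC : 0 ≤ C := by
    by_contra hC
    have := (norm_nonneg _).trans k
    nlinarith [Real.exp_pos (-(ω' / |v|) * |(u + v * z).im|)]
  refine k.trans ?_
  rw [mul_assoc, ← Real.exp_add]
  gcongr
  simp only [Complex.add_im, Complex.mul_im, Complex.ofReal_re, Complex.ofReal_im, zero_mul,
    add_zero]
  have e : ω' * |z.im| = ω' / |v| * |v * z.im| := by rw [abs_mul]; field_simp
  have : ω' / |v| * (|v * z.im| - |u.im + v * z.im|) ≤ abs (ω' / |v|) * |u.im| := by
    refine (le_abs_self _).trans ?_
    rw [abs_mul]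
    refine mul_le_mul_of_nonneg_left ?_ (abs_nonneg _)
    rw [abs_le]; constructor <;> linarith
  linarith

lemma hasDecay_sin : HasDecay (-1) Complex.sin := fun x₁ x₂ => by
  refine StripDecay.of_bound (C := 1) (Y := 0) fun z _ _ _ => ?_
  rw [Complex.sin, norm_div, norm_mul, Complex.norm_I, mul_one]
  have h1 : ‖Complex.exp (-z * Complex.I)‖ ≤ Real.exp |z.im| := by
    rw [Complex.norm_exp]; simp [le_abs_self]
  have h2 : ‖Complex.exp (z * Complex.I)‖ ≤ Real.exp |z.im| := by
    rw [Complex.norm_exp]; simp [neg_le_abs]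
  have := norm_sub_le (Complex.exp (-z * Complex.I)) (Complex.exp (z * Complex.I))
  simp only [Complex.norm_ofNat, neg_neg, one_mul]
  linarith

lemma HasDecay.congr {ω : ℝ} {f g : ℂ → ℂ} (hf : HasDecay ω f) (h : ∀ z, 1 ≤ |z.im| → g z = f z) :
    HasDecay ω g := fun x₁ x₂ => (hf x₁ x₂).congr h

/-- The lower bound for `Γ` comes from the upper one through the reflection formula. -/
theorem hasDecay_inv_Gamma : HasDecay (-(Real.pi / 2)) (fun z => (Complex.Gamma z)⁻¹) := by
  have h1 := (hasDecay_Gamma.comp_affine 1 (v := -1) (by norm_num)).mul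
    ((hasDecay_sin.comp_affine 0 (v := Real.pi) Real.pi_ne_zero).mul
      (HasDecay.const (Real.pi : ℂ)⁻¹))
  have e : Real.pi / 2 * |(-1 : ℝ)| + (-1 * |Real.pi| + 0) = -(Real.pi / 2) := by
    rw [abs_of_pos Real.pi_pos]; simp; ring
  rw [e] at h1
  refine h1.congr fun z hz => ?_
  have hne : ∀ w : ℂ, 1 ≤ |w.im| → Complex.Gamma w ≠ 0 := fun w hw =>
    Complex.Gamma_ne_zero fun m hm => by
      rw [hm] at hw; simp at hw; linarith
  have h2 := hne z hz
  have h3 := hne (1 - z) (by simpa using hz)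
  have hr := Complex.Gamma_mul_Gamma_one_sub z
  have hs : Complex.sin (Real.pi * z) ≠ 0 := by
    intro h0; rw [h0, div_zero] at hr; exact (mul_ne_zero h2 h3) hr
  have hpi : (Real.pi : ℂ) ≠ 0 := by exact_mod_cast Real.pi_ne_zero
  rw [eq_div_iff hs] at hr
  have e1 : (1 : ℂ) + ((-1 : ℝ) : ℂ) * z = 1 - z := by push_cast; ring
  rw [e1, zero_add]
  set S := Complex.sin (Real.pi * z)
  refine inv_eq_of_mul_eq_one_right ?_
  rw [← mul_assoc, ← mul_assoc, hr, mul_inv_cancel₀ hpi]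

lemma hasDecay_Gamma_affine (u : ℂ) {v : ℝ} (hv : 0 < v) :
    HasDecay (Real.pi / 2 * v) (fun z => Complex.Gamma (u + v * z)) := by
  simpa [abs_of_pos hv] using hasDecay_Gamma.comp_affine u hv.ne'

lemma hasDecay_Gamma_sub (u : ℂ) {v : ℝ} (hv : 0 < v) :
    HasDecay (Real.pi / 2 * v) (fun z => Complex.Gamma (u - v * z)) := by
  simpa [abs_of_pos hv, sub_eq_add_neg] using hasDecay_Gamma.comp_affine u (v := -v) (by simp [hv.ne'])

lemma hasDecay_inv_Gamma_affine (u : ℂ) {v : ℝ} (hv : 0 < v) :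
    HasDecay (-(Real.pi / 2 * v)) (fun z => (Complex.Gamma (u + v * z))⁻¹) := by
  have := hasDecay_inv_Gamma.comp_affine u hv.ne'
  simpa [abs_of_pos hv] using this

lemma hasDecay_inv_Gamma_sub (u : ℂ) {v : ℝ} (hv : 0 < v) :
    HasDecay (-(Real.pi / 2 * v)) (fun z => (Complex.Gamma (u - v * z))⁻¹) := by
  have := hasDecay_inv_Gamma.comp_affine u (v := -v) (by simp [hv.ne'])
  simpa [abs_of_pos hv, sub_eq_add_neg] using this

/-- Here `|w ^ z| = |w| ^ (Re z) exp (-arg w Im z)`, with the principal argument. -/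
lemma hasDecay_const_cpow (w : ℂ) (hw : w ≠ 0) : HasDecay (-|w.arg|) (fun z => w ^ z) := by
  intro x₁ x₂
  have hpos : 0 < ‖w‖ := norm_pos_iff.mpr hw
  refine StripDecay.of_bound (C := ‖w‖ ^ x₁ + ‖w‖ ^ x₂) (Y := 0) fun z h1 h2 _ => ?_
  rw [Complex.norm_cpow_of_ne_zero hw, div_eq_mul_inv, ← Real.exp_neg]
  have hA : ‖w‖ ^ z.re ≤ ‖w‖ ^ x₁ + ‖w‖ ^ x₂ := by
    have p1 := Real.rpow_pos_of_pos hpos x₁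
    have p2 := Real.rpow_pos_of_pos hpos x₂
    rcases le_total 1 ‖w‖ with h | h
    · linarith [Real.rpow_le_rpow_of_exponent_le h h2]
    · linarith [Real.rpow_le_rpow_of_exponent_ge hpos h h1]
  have hB : -(w.arg * z.im) ≤ - -|w.arg| * |z.im| := by
    rw [neg_neg, ← abs_mul]; exact neg_le_abs _
  gcongr

namespace FoxParams

variable {p q m n : ℕ} (P : FoxParams p q)

lemma kernel_eq_prod (ξ : ℂ) : P.kernel m n ξ =
    (∏ j : Fin q, if (j : ℕ) < m then Complex.Gamma (P.b j - P.B j * ξ)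
      else (Complex.Gamma (1 - P.b j + P.B j * ξ))⁻¹) *
    (∏ j : Fin p, if (j : ℕ) < n then Complex.Gamma (1 - P.a j + P.A j * ξ)
      else (Complex.Gamma (P.a j - P.A j * ξ))⁻¹) := by
  rw [kernel, mul_div_mul_comm, ← Finset.prod_div_distrib, ← Finset.prod_div_distrib]
  congr 1 <;> refine Finset.prod_congr rfl fun j _ => ?_ <;> split_ifs <;> simp

/-- The rate `πΩ/2` is the balance of the Gamma factors above and below the fraction bar. -/
lemma kernel_hasDecay (hA : ∀ j, 0 < P.A j) (hB : ∀ j, 0 < P.B j) :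
    HasDecay (Real.pi / 2 * P.omega m n) (P.kernel m n) := by
  have h1 := HasDecay.prod (Finset.univ : Finset (Fin q))
    (ω := fun j => Real.pi / 2 * if (j : ℕ) < m then P.B j else -P.B j)
    (f := fun j ξ => if (j : ℕ) < m then Complex.Gamma (P.b j - P.B j * ξ)
      else (Complex.Gamma (1 - P.b j + P.B j * ξ))⁻¹) fun j _ => by
        split_ifs
        · exact hasDecay_Gamma_sub _ (hB j)
        · simpa using hasDecay_inv_Gamma_affine (1 - P.b j) (hB j)
  have h2 := HasDecay.prod (Finset.univ : Finset (Fin p))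
    (ω := fun j => Real.pi / 2 * if (j : ℕ) < n then P.A j else -P.A j)
    (f := fun j ξ => if (j : ℕ) < n then Complex.Gamma (1 - P.a j + P.A j * ξ)
      else (Complex.Gamma (P.a j - P.A j * ξ))⁻¹) fun j _ => by
        split_ifs
        · exact hasDecay_Gamma_affine _ (hA j)
        · simpa using hasDecay_inv_Gamma_sub (P.a j) (hA j)
  have h3 := h1.mul h2
  rw [← Finset.mul_sum, ← Finset.mul_sum, ← mul_add, add_comm] at h3
  exact h3.congr fun z _ => P.kernel_eq_prod z

end FoxParams

/-! ### Cauchy's theorem for closed chains with vanishing indices -/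

/-- `J` behaves like integration along a path in `K` from `x` to `y`: it is linear, depends only on
the values on `K`, and satisfies the fundamental theorem of calculus. -/
structure IsPathFunctional (J : (ℂ → ℂ) → ℂ) (K : Set ℂ) (x y : ℂ) : Prop where
  add : ∀ f g, ContinuousOn f K → ContinuousOn g K → J (fun z => f z + g z) = J f + J g
  smul : ∀ (c : ℂ) (f : ℂ → ℂ), J (fun z => c * f z) = c * J f
  congr : ∀ f g, EqOn f g K → J f = J g
  ftc : ∀ F f : ℂ → ℂ, ContinuousOn f K → (∀ z ∈ K, HasDerivAt F (f z) z) → J f = F y - F x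

/-- The integral of `f` along the segment from `u` to `v`. -/
def segIntegral (f : ℂ → ℂ) (u v : ℂ) : ℂ := ∫ s in (0 : ℝ)..1, f (u + s * (v - u)) * (v - u)

lemma isPathFunctional_affine {K : Set ℂ} (a b : ℝ) (u d : ℂ)
    (h : ∀ t ∈ uIcc a b, u + t * d ∈ K) :
    IsPathFunctional (fun f => ∫ t in a..b, f (u + t * d) * d) K (u + a * d) (u + b * d) := by
  have hc : ∀ f, ContinuousOn f K →
      ContinuousOn (fun t : ℝ => f (u + t * d) * d) (uIcc a b) := fun f hf =>
    (hf.comp (by fun_prop) h).mul continuousOn_const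
  refine ⟨fun f g hf hg => ?_, fun c f => ?_, fun f g hfg => ?_, fun F f hf hF => ?_⟩
  · rw [← intervalIntegral.integral_add (hc f hf).intervalIntegrable (hc g hg).intervalIntegrable]
    simp only [add_mul]
  · rw [← intervalIntegral.integral_const_mul]
    simp only [mul_assoc]
  · exact intervalIntegral.integral_congr fun t ht => by simp only [hfg (h t ht)]
  · refine intervalIntegral.integral_eq_sub_of_hasDerivAt (f := fun t : ℝ => F (u + t * d))
      (fun t ht => ?_) (hc f hf).intervalIntegrable
    have h1 : HasDerivAt (fun z : ℂ => u + z * d) d (t : ℂ) := by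
      simpa using ((hasDerivAt_id (t : ℂ)).mul_const d).const_add u
    exact (HasDerivAt.comp (t : ℂ) (hF _ (h t ht)) h1).comp_ofReal

lemma isPathFunctional_segIntegral {K : Set ℂ} {u v : ℂ} (h : segment ℝ u v ⊆ K) :
    IsPathFunctional (fun f => segIntegral f u v) K u v := by
  have := isPathFunctional_affine (K := K) 0 1 u (v - u) fun t ht => h ?_
  · simpa [segIntegral] using this
  · rw [segment_eq_image']
    rw [uIcc_of_le zero_le_one] at ht
    exact ⟨t, ht, by simp⟩

namespace IsPathFunctional

variable {J J' : (ℂ → ℂ) → ℂ} {K : Set ℂ} {x y z : ℂ}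

lemma trans (h : IsPathFunctional J K x y) (h' : IsPathFunctional J' K y z) :
    IsPathFunctional (fun f => J f + J' f) K x z where
  add f g hf hg := by rw [h.add f g hf hg, h'.add f g hf hg]; ring
  smul c f := by rw [h.smul, h'.smul]; ring
  congr f g hfg := by rw [h.congr f g hfg, h'.congr f g hfg]
  ftc F f hf hF := by rw [h.ftc F f hf hF, h'.ftc F f hf hF]; ring

lemma symm (h : IsPathFunctional J K x y) : IsPathFunctional (fun f => -J f) K y x where
  add f g hf hg := by rw [h.add f g hf hg]; ring
  smul c f := by rw [h.smul]; ring
  congr f g hfg := by rw [h.congr f g hfg]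
  ftc F f hf hF := by rw [h.ftc F f hf hF]; ring

lemma mono {K' : Set ℂ} (h : IsPathFunctional J K x y) (hK : K ⊆ K') :
    IsPathFunctional J K' x y where
  add f g hf hg := h.add f g (hf.mono hK) (hg.mono hK)
  smul := h.smul
  congr f g hfg := h.congr f g (hfg.mono hK)
  ftc F f hf hF := h.ftc F f (hf.mono hK) fun z hz => hF z (hK hz)

lemma refl (K : Set ℂ) (x : ℂ) : IsPathFunctional (fun _ => 0) K x x :=
  ⟨by simp, by simp, by simp, by simp⟩

lemma sum_segIntegral {v : ℕ → ℂ} (n : ℕ) (h : ∀ k < n, segment ℝ (v k) (v (k + 1)) ⊆ K) :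
    IsPathFunctional (fun f => ∑ k ∈ Finset.range n, segIntegral f (v k) (v (k + 1))) K
      (v 0) (v n) := by
  induction n with
  | zero => simpa using refl K (v 0)
  | succ n ih =>
    simp only [Finset.sum_range_succ]
    exact (ih fun k hk => h k (by omega)).trans (isPathFunctional_segIntegral (h n (by omega)))

end IsPathFunctional

/-- The product `∏ 1 / (z - s)` over a multiset of points `s`. -/
def polarProd (M : Multiset ℂ) (z : ℂ) : ℂ := (M.map fun s => (z - s)⁻¹).prod

@[simp] lemma polarProd_zero (z : ℂ) : polarProd 0 z = 1 := by simp [polarProd]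

@[simp] lemma polarProd_cons (s : ℂ) (M : Multiset ℂ) (z : ℂ) :
    polarProd (s ::ₘ M) z = (z - s)⁻¹ * polarProd M z := by simp [polarProd]

lemma continuousOn_polarProd {M : Multiset ℂ} {K : Set ℂ} (h : ∀ s ∈ M, s ∉ K) :
    ContinuousOn (polarProd M) K := by
  induction M using Multiset.induction_on with
  | empty => exact (continuousOn_const (c := (1 : ℂ))).congr fun z _ => polarProd_zero z
  | cons s M ih =>
    refine ContinuousOn.congr (f := fun z => (z - s)⁻¹ * polarProd M z) ?_
      fun z _ => polarProd_cons s M z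
    refine ContinuousOn.mul (ContinuousOn.inv₀ (by fun_prop) fun z hz h0 => ?_)
      (ih fun t ht => h t (by simp [ht]))
    exact h s (by simp) (sub_eq_zero.mp h0 ▸ hz)

/-- A product of inverse linear factors integrates to zero over a closed path with vanishing index
about each of the points: partial fractions reduce to a single point, where only the simple pole
lacks a primitive. -/
lemma IsPathFunctional.polarProd_eq_zero {J : (ℂ → ℂ) → ℂ} {K : Set ℂ} {x : ℂ}
    (hJ : IsPathFunctional J K x x) : ∀ (n : ℕ) (M : Multiset ℂ), M.card = n →
    (∀ s ∈ M, s ∉ K ∧ J (fun z => (z - s)⁻¹) = 0) → J (polarProd M) = 0 := by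
  intro n
  induction n using Nat.strong_induction_on with
  | _ n ih =>
  intro M hn hM
  have hcM := continuousOn_polarProd fun s hs => (hM s hs).1
  rcases M.empty_or_exists_mem with rfl | ⟨s, hs⟩
  · rw [hJ.ftc id _ hcM fun z _ => by simpa using hasDerivAt_id z]; simp
  obtain ⟨M₁, rfl⟩ := Multiset.exists_cons_of_mem hs
  by_cases h1 : ∀ t ∈ M₁, t = s
  · have hrep := Multiset.eq_replicate.mpr ⟨rfl, h1⟩
    have hpow : ∀ z, polarProd (s ::ₘ M₁) z = ((z - s) ^ (M₁.card + 1))⁻¹ := by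
      intro z
      rw [polarProd_cons, hrep, polarProd, Multiset.map_replicate, Multiset.prod_replicate]
      simp [pow_succ, mul_comm]
    rcases Nat.eq_zero_or_pos M₁.card with h0 | h0
    · rw [← (hM s hs).2]
      refine hJ.congr _ _ fun z _ => ?_
      rw [hpow, h0]; simp
    · have hne : ∀ z ∈ K, z - s ≠ 0 := fun z hz h => (hM s hs).1 (sub_eq_zero.mp h ▸ hz)
      have hcard : (M₁.card : ℂ) ≠ 0 := by exact_mod_cast h0.ne'
      rw [hJ.ftc (fun z => -(M₁.card : ℂ)⁻¹ * ((z - s) ^ M₁.card)⁻¹) _ hcM fun z hz => ?_, sub_self]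
      have hd := ((((hasDerivAt_id z).sub_const s).pow M₁.card).inv
        (pow_ne_zero _ (hne z hz))).const_mul (-(M₁.card : ℂ)⁻¹)
      refine hd.congr_deriv ?_
      rw [hpow]
      obtain ⟨k, hk⟩ : ∃ k, M₁.card = k + 1 := ⟨M₁.card - 1, by omega⟩
      have := hne z hz
      rw [hk] at hcard ⊢
      simp only [id, Nat.add_sub_cancel, Pi.pow_apply]
      field_simp
      ring
  · push Not at h1
    obtain ⟨t, ht, hts⟩ := h1
    obtain ⟨M₂, rfl⟩ := Multiset.exists_cons_of_mem ht
    have hs2 := ih (M₂.card + 1) (by simp at hn; omega) (s ::ₘ M₂) (by simp) fun r hr =>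
      hM r (by simp at hr ⊢; tauto)
    have ht2 := ih (M₂.card + 1) (by simp at hn; omega) (t ::ₘ M₂) (by simp) fun r hr =>
      hM r (by simp at hr ⊢; tauto)
    have hcs := continuousOn_polarProd (M := s ::ₘ M₂) (K := K) fun r hr =>
      (hM r (by simp at hr ⊢; tauto)).1
    have hct := continuousOn_polarProd (M := t ::ₘ M₂) (K := K) fun r hr =>
      (hM r (by simp at hr ⊢; tauto)).1
    have hst : s - t ≠ 0 := sub_ne_zero.mpr hts.symm
    have e : EqOn (polarProd (s ::ₘ t ::ₘ M₂)) (fun z => (s - t)⁻¹ * polarProd (s ::ₘ M₂) z +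
        (-(s - t)⁻¹) * polarProd (t ::ₘ M₂) z) K := by
      intro z hz
      have hzs : z - s ≠ 0 := fun h => (hM s hs).1 (sub_eq_zero.mp h ▸ hz)
      have hzt : z - t ≠ 0 := fun h => (hM t (by simp)).1 (sub_eq_zero.mp h ▸ hz)
      simp only [polarProd_cons]
      field_simp
      ring
    rw [hJ.congr _ _ e, hJ.add (fun z => (s - t)⁻¹ * polarProd (s ::ₘ M₂) z)
      (fun z => (-(s - t)⁻¹) * polarProd (t ::ₘ M₂) z) (continuousOn_const.mul hcs)
      (continuousOn_const.mul hct),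
      hJ.smul, hJ.smul, hs2, ht2]
    simp

/-- Cauchy's theorem for a function `F ∏ 1 / (z - s)` with `F` holomorphic on a disc containing the
closed path, when the index of the path about each of the points vanishes. -/
lemma IsPathFunctional.mul_polarProd_eq_zero {J : (ℂ → ℂ) → ℂ} {K : Set ℂ} {x : ℂ}
    (hJ : IsPathFunctional J K x x) {r : ℝ} (hK : K ⊆ Metric.ball 0 r) (M : Multiset ℂ)
    (hM : ∀ s ∈ M, s ∉ K ∧ J (fun z => (z - s)⁻¹) = 0) :
    ∀ F : ℂ → ℂ, DifferentiableOn ℂ F (Metric.ball 0 r) →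
      J (fun z => F z * polarProd M z) = 0 := by
  induction M using Multiset.induction_on with
  | empty =>
    intro F hF
    obtain ⟨G, hG⟩ := hF.isExactOn_ball
    simp only [polarProd_zero, mul_one]
    rw [hJ.ftc G F (hF.continuousOn.mono hK) fun z hz => hG z (hK hz), sub_self]
  | cons s M ih =>
    intro F hF
    have ih' := ih fun t ht => hM t (by simp [ht])
    have hsK := (hM s (by simp)).1
    by_cases hs : s ∈ Metric.ball (0 : ℂ) r
    · have hd : DifferentiableOn ℂ (dslope F s) (Metric.ball 0 r) :=
        (Complex.differentiableOn_dslope (Metric.isOpen_ball.mem_nhds hs)).mpr hF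
      have hcM := continuousOn_polarProd (M := M) (K := K) fun t ht => (hM t (by simp [ht])).1
      have e : EqOn (fun z => F z * polarProd (s ::ₘ M) z)
          (fun z => F s * polarProd (s ::ₘ M) z + dslope F s z * polarProd M z) K := by
        intro z hz
        have hzs : z - s ≠ 0 := fun h => hsK (sub_eq_zero.mp h ▸ hz)
        simp only [polarProd_cons]
        rw [dslope_of_ne _ (sub_ne_zero.mp hzs), slope_def_field]
        field_simp
        ring
      rw [hJ.congr _ _ e, hJ.add (fun z => F s * polarProd (s ::ₘ M) z)
        (fun z => dslope F s z * polarProd M z) (continuousOn_const.mul (continuousOn_polarProd fun t ht =>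
        (hM t ht).1)) ((hd.continuousOn.mono hK).mul hcM), hJ.smul, ih' _ hd,
        hJ.polarProd_eq_zero _ _ rfl hM]
      simp
    · have e : EqOn (fun z => F z * polarProd (s ::ₘ M) z)
          (fun z => (F z * (z - s)⁻¹) * polarProd M z) K := fun z _ => by
        simp only [polarProd_cons, mul_assoc]
      rw [hJ.congr _ _ e]
      refine ih' _ (hF.mul (DifferentiableOn.inv (by fun_prop) fun z hz h => ?_))
      exact hs (sub_eq_zero.mp h ▸ hz)

/-- On `U`, off the set `Z`, the function `f` is a holomorphic function times finitely many factors
`1 / (z - s)` with `s ∈ Z`. -/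
def PolarOn (Z U : Set ℂ) (f : ℂ → ℂ) : Prop :=
  ∃ (F : ℂ → ℂ) (M : Multiset ℂ), DifferentiableOn ℂ F U ∧ (∀ s ∈ M, s ∈ Z) ∧
    ∀ z ∈ U, z ∉ Z → f z = F z * polarProd M z

namespace PolarOn

variable {Z U : Set ℂ} {f g : ℂ → ℂ}

lemma of_differentiable (hf : Differentiable ℂ f) : PolarOn Z U f :=
  ⟨f, 0, hf.differentiableOn, by simp, by simp⟩

lemma mul (hf : PolarOn Z U f) (hg : PolarOn Z U g) : PolarOn Z U (fun z => f z * g z) := by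
  obtain ⟨F, M, hF, hM, h⟩ := hf
  obtain ⟨G, N, hG, hN, k⟩ := hg
  refine ⟨fun z => F z * G z, M + N, hF.mul hG, fun s hs => ?_, fun z hz hzZ => ?_⟩
  · rcases Multiset.mem_add.mp hs with h | h
    exacts [hM s h, hN s h]
  · simp only [h z hz hzZ, k z hz hzZ, polarProd, Multiset.map_add, Multiset.prod_add]
    ring

lemma prod {ι : Type*} (s : Finset ι) {f : ι → ℂ → ℂ} (h : ∀ i ∈ s, PolarOn Z U (f i)) :
    PolarOn Z U (fun z => ∏ i ∈ s, f i z) := by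
  classical
  induction s using Finset.induction_on with
  | empty => simpa using of_differentiable (differentiable_const (1 : ℂ))
  | insert a s ha ih =>
    simp only [Finset.prod_insert ha]
    exact (h a (by simp)).mul (ih fun i hi => h i (by simp [hi]))

lemma congr (hf : PolarOn Z U f) (h : ∀ z, g z = f z) : PolarOn Z U g := by
  rwa [show g = f from funext h]

lemma continuousOn (hf : PolarOn Z U f) {K : Set ℂ} (hK : K ⊆ U) (hKZ : ∀ z ∈ K, z ∉ Z) :
    ContinuousOn f K := by
  obtain ⟨F, M, hF, hM, h⟩ := hf
  exact ((hF.continuousOn.mono hK).mul (continuousOn_polarProd fun s hs hs' =>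
    hKZ s hs' (hM s hs))).congr fun z hz => h z (hK hz) (hKZ z hz)

/-- `Γ(u + v z)` is polar on discs: shift the argument into the right half-plane by the functional
equation. -/
lemma Gamma_affine (u : ℂ) {v : ℝ} (hv : v ≠ 0) (hZ : ∀ k : ℕ, (-u - k) / v ∈ Z) (r : ℝ) :
    PolarOn Z (Metric.ball 0 r) (fun z => Complex.Gamma (u + v * z)) := by
  have hv' : (v : ℂ) ≠ 0 := by exact_mod_cast hv
  obtain ⟨n, hn⟩ := exists_nat_gt (‖u‖ + |v| * r)
  refine ⟨fun z => Complex.Gamma (u + v * z + n) * ((v : ℂ)⁻¹) ^ n,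
    (Multiset.range n).map fun k : ℕ => (-u - k) / v, ?_, ?_, ?_⟩
  · refine DifferentiableOn.mul (fun z hz => DifferentiableAt.differentiableWithinAt ?_)
      (differentiableOn_const _)
    refine DifferentiableAt.comp z (Complex.differentiableAt_Gamma _ fun m hm => ?_) (by fun_prop)
    have h1 : ‖z‖ < r := by simpa using hz
    have h2 : ‖u + v * z‖ ≤ ‖u‖ + |v| * r := by
      refine (norm_add_le _ _).trans ?_
      rw [norm_mul, Complex.norm_real, Real.norm_eq_abs]
      gcongr
    have h3 : u + v * z = -((m + n : ℕ) : ℂ) := by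
      push_cast; linear_combination hm
    rw [h3, norm_neg, Complex.norm_natCast] at h2
    push_cast at h2
    have : (0 : ℝ) ≤ m := m.cast_nonneg
    linarith
  · intro s hs
    obtain ⟨k, -, rfl⟩ := Multiset.mem_map.mp hs
    exact hZ k
  · intro z _ hz
    clear hn
    induction n with
    | zero => simp
    | succ n ih =>
      have hne : z - (-u - n) / v ≠ 0 := fun h => hz (sub_eq_zero.mp h ▸ hZ n)
      have e : u + v * z + n = v * (z - (-u - n) / v) := by field_simp; ring
      have h1 : Complex.Gamma (u + v * z + (n + 1 : ℕ)) =
          v * (z - (-u - n) / v) * Complex.Gamma (u + v * z + n) := by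
        rw [← e, ← Complex.Gamma_add_one]
        · congr 1; push_cast; ring
        · rw [e]; exact mul_ne_zero hv' hne
      rw [ih, Multiset.range_succ, Multiset.map_cons, polarProd_cons]
      dsimp only
      rw [h1, pow_succ]
      generalize z - (-u - (n : ℂ)) / v = D at hne
      field_simp

end PolarOn

namespace FoxParams

variable {p q m n : ℕ} (P : FoxParams p q)

lemma kernel_polarOn (hA : ∀ j, 0 < P.A j) (hB : ∀ j, 0 < P.B j) (r : ℝ) :
    PolarOn (P.leftPoles n ∪ P.rightPoles m) (Metric.ball 0 r) (P.kernel m n) := by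
  have hinv : ∀ (u : ℂ) (v : ℝ), Differentiable ℂ fun z => (Complex.Gamma (u + v * z))⁻¹ :=
    fun u v => Complex.differentiable_one_div_Gamma.comp (by fun_prop)
  refine ((PolarOn.prod Finset.univ fun j _ => ?_).mul
    (PolarOn.prod Finset.univ fun j _ => ?_)).congr P.kernel_eq_prod
  · split_ifs with hj
    · refine (PolarOn.Gamma_affine (P.b j) (v := -P.B j) (by simpa using (hB j).ne')
        (fun k => Or.inr ⟨j, hj, k, ?_⟩) r).congr fun z => by push_cast; congr 1; ring
      have : (P.B j : ℂ) ≠ 0 := by exact_mod_cast (hB j).ne'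
      push_cast; field_simp; ring
    · exact PolarOn.of_differentiable (hinv _ _)
  · split_ifs with hj
    · refine PolarOn.Gamma_affine (1 - P.a j) (v := P.A j) (hA j).ne'
        (fun k => Or.inl ⟨j, hj, k, ?_⟩) r
      congr 1; ring
    · exact PolarOn.of_differentiable (by simpa [sub_eq_add_neg] using hinv (P.a j) (-P.A j))

end FoxParams

/-! ### Independence of the contour -/

lemma integrableOn_Ioi_of_exp_bound {g : ℝ → ℂ} (hg : ContinuousOn g (Ici 0)) {C Y ω : ℝ}
    (hω : 0 < ω) (h : ∀ t, Y ≤ t → ‖g t‖ ≤ C * Real.exp (-ω * t)) : IntegrableOn g (Ioi 0) := by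
  refine (integrable_norm_iff ((hg.mono Ioi_subset_Ici_self).aestronglyMeasurable
    measurableSet_Ioi)).mp ?_
  refine integrable_of_isBigO_exp_neg hω hg.norm ?_
  refine Asymptotics.IsBigO.of_bound C ?_
  filter_upwards [eventually_ge_atTop Y] with t ht
  simpa [abs_of_pos (Real.exp_pos _)] using h t ht

namespace MBContour

variable (L : MBContour)

lemma lowerRay_mem_support {t : ℝ} (ht : t ≤ 0) : L.vert 0 + t * Complex.I ∈ L.support :=
  Or.inl (Or.inl ⟨t, ht, rfl⟩)

lemma upperRay_mem_support {t : ℝ} (ht : 0 ≤ t) : L.vert L.N + t * Complex.I ∈ L.support :=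
  Or.inr ⟨t, ht, rfl⟩

lemma segment_subset_support {k : ℕ} (hk : k < L.N) :
    segment ℝ (L.vert k) (L.vert (k + 1)) ⊆ L.support := fun z hz =>
  Or.inl (Or.inr (mem_iUnion₂.mpr ⟨k, by simpa using hk, hz⟩))

/-- The point set of the contour with both rays cut off at length `R`. -/
def truncSupport (R : ℝ) : Set ℂ :=
  (fun t : ℝ => L.vert 0 + t * Complex.I) '' Icc (-R) 0 ∪
  (⋃ k ∈ Finset.range L.N, segment ℝ (L.vert k) (L.vert (k + 1))) ∪
  (fun t : ℝ => L.vert L.N + t * Complex.I) '' Icc 0 R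

lemma truncSupport_subset (R : ℝ) : L.truncSupport R ⊆ L.support := by
  refine union_subset_union (union_subset_union ?_ le_rfl) ?_
  · rintro _ ⟨t, ht, rfl⟩; exact ⟨t, ht.2, rfl⟩
  · rintro _ ⟨t, ht, rfl⟩; exact ⟨t, ht.1, rfl⟩

lemma isCompact_truncSupport (R : ℝ) : IsCompact (L.truncSupport R) := by
  refine ((isCompact_Icc.image (by fun_prop)).union ?_).union (isCompact_Icc.image (by fun_prop))
  refine (Finset.range L.N).isCompact_biUnion fun k _ => ?_
  rw [segment_eq_image]
  exact isCompact_Icc.image (by fun_prop)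

lemma isPathFunctional_lower {R : ℝ} (hR : 0 ≤ R) {K : Set ℂ}
    (hK : ∀ t ∈ Icc (-R) 0, L.vert 0 + (t : ℝ) * Complex.I ∈ K) :
    IsPathFunctional (fun f => ∫ t in (-R)..0, f (L.vert 0 + t * Complex.I) * Complex.I) K
      (L.vert 0 + (-R : ℝ) * Complex.I) (L.vert 0) := by
  have := isPathFunctional_affine (K := K) (-R) 0 (L.vert 0) Complex.I fun t ht => hK t ?_
  · simpa using this
  · rwa [uIcc_of_le (by linarith)] at ht

lemma isPathFunctional_upper {R : ℝ} (hR : 0 ≤ R) {K : Set ℂ}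
    (hK : ∀ t ∈ Icc 0 R, L.vert L.N + (t : ℝ) * Complex.I ∈ K) :
    IsPathFunctional (fun f => ∫ t in (0 : ℝ)..R, f (L.vert L.N + t * Complex.I) * Complex.I) K
      (L.vert L.N) (L.vert L.N + (R : ℝ) * Complex.I) := by
  have := isPathFunctional_affine (K := K) 0 R (L.vert L.N) Complex.I fun t ht => hK t ?_
  · simpa using this
  · rwa [uIcc_of_le (by linarith)] at ht

lemma isPathFunctional_truncIntegral {R : ℝ} (hR : 0 ≤ R) :
    IsPathFunctional (fun f => L.truncIntegral f R) (L.truncSupport R)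
      (L.vert 0 + (-R : ℝ) * Complex.I) (L.vert L.N + (R : ℝ) * Complex.I) := by
  refine ((L.isPathFunctional_lower hR fun t ht => Or.inl (Or.inl ⟨t, ht, rfl⟩)).trans
    (IsPathFunctional.sum_segIntegral L.N fun k hk z hz =>
      Or.inl (Or.inr (mem_iUnion₂.mpr ⟨k, by simpa using hk, hz⟩)))).trans
    (L.isPathFunctional_upper hR fun t ht => Or.inr ⟨t, ht, rfl⟩)

lemma integrableOn_upperRay {f : ℂ → ℂ} {ω : ℝ} (hω : 0 < ω) (hf : HasDecay ω f)
    (hc : ContinuousOn f L.support) :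
    IntegrableOn (fun t : ℝ => f (L.vert L.N + t * Complex.I) * Complex.I) (Ioi 0) := by
  obtain ⟨C, Y, h⟩ := hf (L.vert L.N).re (L.vert L.N).re (ω / 2) (by linarith)
  set i := (L.vert L.N).im
  refine integrableOn_Ioi_of_exp_bound (ω := ω / 2) (C := C * Real.exp (ω / 2 * |i|))
    (Y := Y + |i|) ?_ (by linarith) fun t ht => ?_
  · exact (hc.comp (by fun_prop) fun t ht => L.upperRay_mem_support ht).mul continuousOn_const
  · have h1 := neg_abs_le i
    have h2 := le_abs_self (i + t)
    have k := h (L.vert L.N + t * Complex.I) (by simp) (by simp) (by simp; linarith)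
    rw [norm_mul, Complex.norm_I, mul_one]
    have hC : 0 ≤ C := by
      by_contra hC
      have := (norm_nonneg _).trans k
      nlinarith [Real.exp_pos (-(ω / 2) * |(L.vert L.N + t * Complex.I).im|)]
    refine k.trans ?_
    rw [mul_assoc, ← Real.exp_add]
    gcongr
    simp only [Complex.add_im, Complex.mul_im, Complex.ofReal_re, Complex.I_im, Complex.ofReal_im,
      Complex.I_re, mul_one, mul_zero, add_zero]
    nlinarith

lemma integrableOn_lowerRay {f : ℂ → ℂ} {ω : ℝ} (hω : 0 < ω) (hf : HasDecay ω f)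
    (hc : ContinuousOn f L.support) :
    IntegrableOn (fun t : ℝ => f (L.vert 0 + t * Complex.I) * Complex.I) (Iic 0) := by
  obtain ⟨C, Y, h⟩ := hf (L.vert 0).re (L.vert 0).re (ω / 2) (by linarith)
  set i := (L.vert 0).im
  have key : IntegrableOn (fun t : ℝ => f (L.vert 0 + (-t : ℝ) * Complex.I) * Complex.I)
      (Ioi 0) := by
    refine integrableOn_Ioi_of_exp_bound (ω := ω / 2) (C := C * Real.exp (ω / 2 * |i|))
      (Y := Y + |i|) ?_ (by linarith) fun t ht => ?_
    · exact (hc.comp (by fun_prop) fun t ht => L.lowerRay_mem_support (by simpa using ht)).mul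
        continuousOn_const
    · have h1 := le_abs_self i
      have h2 := neg_le_abs (i - t)
      have k := h (L.vert 0 + (-t : ℝ) * Complex.I) (by simp) (by simp)
        (by simp [← sub_eq_add_neg]; linarith)
      rw [norm_mul, Complex.norm_I, mul_one]
      have hC : 0 ≤ C := by
        by_contra hC
        have := (norm_nonneg _).trans k
        nlinarith [Real.exp_pos (-(ω / 2) * |(L.vert 0 + (-t : ℝ) * Complex.I).im|)]
      refine k.trans ?_
      rw [mul_assoc, ← Real.exp_add]
      gcongr
      simp only [Complex.add_im, Complex.mul_im, Complex.ofReal_re, Complex.I_im,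
        Complex.ofReal_im, Complex.I_re, mul_one, mul_zero, add_zero]
      rw [← sub_eq_add_neg]
      nlinarith
  have h2 := (integrableOn_Ici_iff_integrableOn_Ioi).mpr key
  have h3 := IntegrableOn.comp_neg_Iic (c := (0 : ℝ)) (by simpa using h2)
  simpa using h3

lemma tendsto_truncIntegral {f : ℂ → ℂ} {ω : ℝ} (hω : 0 < ω) (hf : HasDecay ω f)
    (hc : ContinuousOn f L.support) :
    Tendsto (fun R => L.truncIntegral f R) atTop (𝓝 (L.integral f)) :=
  ((intervalIntegral_tendsto_integral_Iic 0 (L.integrableOn_lowerRay hω hf hc)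
    tendsto_neg_atTop_atBot).add_const _).add
    (intervalIntegral_tendsto_integral_Ioi 0 (L.integrableOn_upperRay hω hf hc) tendsto_id)

end MBContour

/-- `f` tends to zero at `±i∞`, uniformly in vertical strips. -/
def VanishesVertically (f : ℂ → ℂ) : Prop :=
  ∀ X : ℝ, ∀ ε > 0, ∃ Y : ℝ, ∀ z : ℂ, |z.re| ≤ X → Y ≤ |z.im| → ‖f z‖ ≤ ε

lemma HasDecay.vanishesVertically {ω : ℝ} {f : ℂ → ℂ} (hf : HasDecay ω f) (hω : 0 < ω) :
    VanishesVertically f := by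
  intro X ε hε
  obtain ⟨C, Y, h⟩ := hf (-X) X (ω / 2) (by linarith)
  have ht : Tendsto (fun y : ℝ => C * Real.exp (-(ω / 2) * y)) atTop (𝓝 (C * 0)) := by
    refine Tendsto.const_mul C (Real.tendsto_exp_atBot.comp ?_)
    exact tendsto_id.const_mul_atTop_of_neg (by linarith)
  rw [mul_zero] at ht
  obtain ⟨Z, hZ⟩ := eventually_atTop.mp (ht.eventually (gt_mem_nhds hε))
  exact ⟨max Y Z, fun z h1 h2 => (h z (abs_le.mp h1).1 (abs_le.mp h1).2
    ((le_max_left _ _).trans h2)).trans (hZ _ ((le_max_right _ _).trans h2)).le⟩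

lemma vanishesVertically_inv_sub (s : ℂ) : VanishesVertically (fun z => (z - s)⁻¹) := by
  intro X ε hε
  refine ⟨|s.im| + ε⁻¹, fun z _ hz => ?_⟩
  have h1 : ε⁻¹ ≤ ‖z - s‖ := by
    refine le_trans ?_ (Complex.abs_im_le_norm _)
    have := abs_sub_abs_le_abs_sub z.im s.im
    simp only [Complex.sub_im]
    linarith
  rw [norm_inv]
  exact inv_le_of_inv_le₀ hε h1

/-- Integrals along segments of fixed direction and length, moved up or down to `±i∞`. -/
lemma VanishesVertically.tendsto_segIntegral {f : ℂ → ℂ} (hf : VanishesVertically f) (u v : ℂ)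
    {g : ℝ → ℝ} (hg : Tendsto (fun R => |g R|) atTop atTop) :
    Tendsto (fun R : ℝ => segIntegral f (u + g R * Complex.I) (v + g R * Complex.I))
      atTop (𝓝 0) := by
  rw [Metric.tendsto_nhds]
  intro ε hε
  obtain ⟨Y, hY⟩ := hf (max |u.re| |v.re|) (ε / (2 * (‖v - u‖ + 1))) (by positivity)
  filter_upwards [hg.eventually_ge_atTop (Y + (|u.im| + |v.im|))] with R hR
  rw [dist_zero_right]
  have hb : ‖segIntegral f (u + g R * Complex.I) (v + g R * Complex.I)‖ ≤
      (ε / (2 * (‖v - u‖ + 1)) * ‖v - u‖) * |(1 : ℝ) - 0| := by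
    refine intervalIntegral.norm_integral_le_of_norm_le_const fun s hs => ?_
    rw [uIoc_of_le zero_le_one] at hs
    have e : (v + g R * Complex.I) - (u + g R * Complex.I) = v - u := by ring
    rw [e, norm_mul]
    refine mul_le_mul_of_nonneg_right (hY _ ?_ ?_) (norm_nonneg _)
    · have : (u + g R * Complex.I + s * (v - u)).re = (1 - s) * u.re + s * v.re := by
        simp; ring
      rw [this, abs_le]
      have a1 := abs_le.mp (le_max_left |u.re| |v.re|)
      have a2 := abs_le.mp (le_max_right |u.re| |v.re|)
      constructor <;> nlinarith [hs.1, hs.2]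
    · have e1 : (u + g R * Complex.I + s * (v - u)).im =
          g R - (-((1 - s) * u.im + s * v.im)) := by
        simp; ring
      have e2 : |(1 - s) * u.im + s * v.im| ≤ |u.im| + |v.im| := by
        refine (abs_add_le _ _).trans ?_
        rw [abs_mul, abs_mul, abs_of_nonneg (by linarith [hs.2] : (0 : ℝ) ≤ 1 - s),
          abs_of_pos hs.1]
        nlinarith [abs_nonneg u.im, abs_nonneg v.im, hs.1, hs.2]
      rw [e1]
      have := abs_sub_abs_le_abs_sub (g R) (-((1 - s) * u.im + s * v.im))
      rw [abs_neg] at this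
      linarith
  refine hb.trans_lt ?_
  have h0 : 0 ≤ ‖v - u‖ := norm_nonneg _
  rw [sub_zero, abs_one, mul_one, div_mul_eq_mul_div, div_lt_iff₀ (by positivity)]
  nlinarith

/-- A primitive of `1 / (z - s)` in the half-plane above `s`. -/
lemma hasDerivAt_log_above {s z : ℂ} (h : s.im < z.im) :
    HasDerivAt (fun z => Complex.log (-Complex.I * (z - s))) (z - s)⁻¹ z := by
  have hne : z - s ≠ 0 := fun h0 => by
    have := congrArg Complex.im h0; simp at this; linarith
  have h1 : HasDerivAt (fun z => -Complex.I * (z - s)) (-Complex.I * 1) z :=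
    ((hasDerivAt_id z).sub_const s).const_mul _
  refine (h1.clog (Or.inl (by simpa using h))).congr_deriv ?_
  have := Complex.I_ne_zero
  field_simp

/-- A primitive of `1 / (z - s)` in the half-plane below `s`. -/
lemma hasDerivAt_log_below {s z : ℂ} (h : z.im < s.im) :
    HasDerivAt (fun z => Complex.log (Complex.I * (z - s))) (z - s)⁻¹ z := by
  have hne : z - s ≠ 0 := fun h0 => by
    have := congrArg Complex.im h0; simp at this; linarith
  have h1 : HasDerivAt (fun z => Complex.I * (z - s)) (Complex.I * 1) z :=
    ((hasDerivAt_id z).sub_const s).const_mul _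
  refine (h1.clog (Or.inl (by simpa using h))).congr_deriv ?_
  have := Complex.I_ne_zero
  field_simp

lemma im_lt_of_mem_segment {u v z : ℂ} {y : ℝ} (hu : y < u.im) (hv : y < v.im)
    (hz : z ∈ segment ℝ u v) : y < z.im :=
  (convex_halfSpace_im_gt y).segment_subset hu hv hz

lemma im_gt_of_mem_segment {u v z : ℂ} {y : ℝ} (hu : u.im < y) (hv : v.im < y)
    (hz : z ∈ segment ℝ u v) : z.im < y :=
  (convex_halfSpace_im_lt y).segment_subset hu hv hz

namespace MBContour

/-- The closed path made of the contour `L`, cut off at `R`, and `L'` backwards, joined by segments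
at both ends. -/
def loopIntegral (L L' : MBContour) (R : ℝ) (f : ℂ → ℂ) : ℂ :=
  L.truncIntegral f R +
    segIntegral f (L.vert L.N + (R : ℝ) * Complex.I) (L'.vert L'.N + (R : ℝ) * Complex.I) +
    -L'.truncIntegral f R +
    -segIntegral f (L.vert 0 + (-R : ℝ) * Complex.I) (L'.vert 0 + (-R : ℝ) * Complex.I)

variable (L L' : MBContour)

/-- The point set of the closed path of `loopIntegral`. -/
def loopSupport (R : ℝ) : Set ℂ :=
  L.truncSupport R ∪ L'.truncSupport R ∪
    segment ℝ (L.vert L.N + (R : ℝ) * Complex.I) (L'.vert L'.N + (R : ℝ) * Complex.I) ∪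
    segment ℝ (L.vert 0 + (-R : ℝ) * Complex.I) (L'.vert 0 + (-R : ℝ) * Complex.I)

lemma isPathFunctional_loopIntegral {R : ℝ} (hR : 0 ≤ R) :
    IsPathFunctional (L.loopIntegral L' R) (L.loopSupport L' R)
      (L.vert 0 + (-R : ℝ) * Complex.I) (L.vert 0 + (-R : ℝ) * Complex.I) := by
  refine ((((L.isPathFunctional_truncIntegral hR).mono ?_).trans
    (isPathFunctional_segIntegral ?_)).trans
    ((L'.isPathFunctional_truncIntegral hR).mono ?_).symm).trans
    (isPathFunctional_segIntegral ?_).symm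
  · exact fun z hz => Or.inl (Or.inl (Or.inl hz))
  · exact fun z hz => Or.inl (Or.inr hz)
  · exact fun z hz => Or.inl (Or.inl (Or.inr hz))
  · exact fun z hz => Or.inr hz

lemma tendsto_loopIntegral {f : ℂ → ℂ} (hf : VanishesVertically f) {I I' : ℂ}
    (hI : Tendsto (fun R => L.truncIntegral f R) atTop (𝓝 I))
    (hI' : Tendsto (fun R => L'.truncIntegral f R) atTop (𝓝 I')) :
    Tendsto (fun R => L.loopIntegral L' R f) atTop (𝓝 (I - I')) := by
  have h1 := hf.tendsto_segIntegral (L.vert L.N) (L'.vert L'.N) (g := fun R => R)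
    tendsto_abs_atTop_atTop
  have h2 := hf.tendsto_segIntegral (L.vert 0) (L'.vert 0) (g := fun R => -R)
    (by simpa using tendsto_abs_atTop_atTop)
  have := ((hI.add h1).add hI'.neg).add h2.neg
  simpa [loopIntegral, sub_eq_add_neg] using this

/-- Enlarging `R` does not change the index of the closed path about a point of small height, since
there are branches of the logarithm in the upper and the lower half-plane. -/
lemma loopIntegral_inv_sub_eq {s : ℂ} (hs : s ∉ L.support) (hs' : s ∉ L'.support) {R₀ R : ℝ}
    (h0 : 0 ≤ R₀) (hR : R₀ ≤ R)
    (h1 : s.im < (L.vert L.N).im + R₀) (h2 : s.im < (L'.vert L'.N).im + R₀)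
    (h3 : (L.vert 0).im - R₀ < s.im) (h4 : (L'.vert 0).im - R₀ < s.im) :
    L.loopIntegral L' R (fun z => (z - s)⁻¹) = L.loopIntegral L' R₀ (fun z => (z - s)⁻¹) := by
  have hcont : ∀ K : Set ℂ, s ∉ K → ContinuousOn (fun z => (z - s)⁻¹) K := fun K hK =>
    ContinuousOn.inv₀ (by fun_prop) fun z hz h => hK (sub_eq_zero.mp h ▸ hz)
  have above : ∀ (J : (ℂ → ℂ) → ℂ) (x y : ℂ), IsPathFunctional J {z | s.im < z.im} x y →
      J (fun z => (z - s)⁻¹) =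
        Complex.log (-Complex.I * (y - s)) - Complex.log (-Complex.I * (x - s)) :=
    fun J x y h => h.ftc (fun z => Complex.log (-Complex.I * (z - s))) _
      (hcont _ (by simp)) fun z hz => hasDerivAt_log_above hz
  have below : ∀ (J : (ℂ → ℂ) → ℂ) (x y : ℂ), IsPathFunctional J {z | z.im < s.im} x y →
      J (fun z => (z - s)⁻¹) =
        Complex.log (Complex.I * (y - s)) - Complex.log (Complex.I * (x - s)) :=
    fun J x y h => h.ftc (fun z => Complex.log (Complex.I * (z - s))) _
      (hcont _ (by simp)) fun z hz => hasDerivAt_log_below hz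
  have trunc : ∀ L : MBContour, s ∉ L.support → s.im < (L.vert L.N).im + R₀ →
      (L.vert 0).im - R₀ < s.im → L.truncIntegral (fun z => (z - s)⁻¹) R =
      L.truncIntegral (fun z => (z - s)⁻¹) R₀ +
        (Complex.log (-Complex.I * (L.vert L.N + R * Complex.I - s)) -
          Complex.log (-Complex.I * (L.vert L.N + R₀ * Complex.I - s))) +
        (Complex.log (Complex.I * (L.vert 0 + (-R₀ : ℝ) * Complex.I - s)) -
          Complex.log (Complex.I * (L.vert 0 + (-R : ℝ) * Complex.I - s))) := by
    intro L hL hu hl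
    have cu : ∀ a b : ℝ, 0 ≤ a → a ≤ b → IntervalIntegrable
        (fun t : ℝ => (L.vert L.N + t * Complex.I - s)⁻¹ * Complex.I) volume a b :=
      fun a b ha hab => ContinuousOn.intervalIntegrable <| by
        rw [uIcc_of_le hab]
        exact ((hcont _ hL).comp (s := Icc a b) (by fun_prop) fun t ht =>
          L.upperRay_mem_support (ha.trans ht.1)).mul continuousOn_const
    have cl : ∀ a b : ℝ, b ≤ 0 → a ≤ b → IntervalIntegrable
        (fun t : ℝ => (L.vert 0 + t * Complex.I - s)⁻¹ * Complex.I) volume a b :=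
      fun a b hb hab => ContinuousOn.intervalIntegrable <| by
        rw [uIcc_of_le hab]
        exact ((hcont _ hL).comp (s := Icc a b) (by fun_prop) fun t ht =>
          L.lowerRay_mem_support (ht.2.trans hb)).mul continuousOn_const
    have e1 := above _ _ _ (isPathFunctional_affine R₀ R (L.vert L.N) Complex.I fun t ht => by
      rw [uIcc_of_le hR] at ht
      simp only [mem_ofPred_eq, Complex.add_im, Complex.mul_im, Complex.ofReal_re, Complex.I_im,
        Complex.ofReal_im, Complex.I_re, mul_one, mul_zero, add_zero]
      linarith [ht.1])
    have e2 := below _ _ _ (isPathFunctional_affine (-R) (-R₀) (L.vert 0) Complex.I fun t ht => by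
      rw [uIcc_of_le (by linarith)] at ht
      simp only [mem_ofPred_eq, Complex.add_im, Complex.mul_im, Complex.ofReal_re, Complex.I_im,
        Complex.ofReal_im, Complex.I_re, mul_one, mul_zero, add_zero]
      linarith [ht.2])
    rw [truncIntegral, truncIntegral, ← intervalIntegral.integral_add_adjacent_intervals
      (cl (-R) (-R₀) (by linarith) (by linarith)) (cl (-R₀) 0 le_rfl (by linarith)),
      ← intervalIntegral.integral_add_adjacent_intervals (cu 0 R₀ le_rfl h0) (cu R₀ R h0 hR),
      e1, e2]
    ring
  have seg_up : ∀ ρ, R₀ ≤ ρ → segIntegral (fun z => (z - s)⁻¹) (L.vert L.N + (ρ : ℝ) * Complex.I)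
      (L'.vert L'.N + (ρ : ℝ) * Complex.I) =
      Complex.log (-Complex.I * (L'.vert L'.N + (ρ : ℝ) * Complex.I - s)) -
      Complex.log (-Complex.I * (L.vert L.N + (ρ : ℝ) * Complex.I - s)) := fun ρ hρ =>
    above _ _ _ (isPathFunctional_segIntegral fun z hz =>
      im_lt_of_mem_segment (by simp; linarith) (by simp; linarith) hz)
  have seg_down : ∀ ρ, R₀ ≤ ρ → segIntegral (fun z => (z - s)⁻¹)
      (L.vert 0 + (-ρ : ℝ) * Complex.I) (L'.vert 0 + (-ρ : ℝ) * Complex.I) =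
      Complex.log (Complex.I * (L'.vert 0 + (-ρ : ℝ) * Complex.I - s)) -
      Complex.log (Complex.I * (L.vert 0 + (-ρ : ℝ) * Complex.I - s)) := fun ρ hρ =>
    below _ _ _ (isPathFunctional_segIntegral fun z hz =>
      im_gt_of_mem_segment (by simp; linarith) (by simp; linarith) hz)
  rw [loopIntegral, loopIntegral, trunc L hs h1 h3, trunc L' hs' h2 h4, seg_up R hR,
    seg_up R₀ le_rfl, seg_down R hR, seg_down R₀ le_rfl]
  ring

lemma tendsto_of_tendsto_index {s c : ℂ}
    (h : Tendsto (fun R : ℝ => (2 * Real.pi * Complex.I)⁻¹ *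
      L.truncIntegral (fun ξ => (ξ - s)⁻¹) R) atTop (𝓝 c)) :
    Tendsto (fun R : ℝ => L.truncIntegral (fun ξ => (ξ - s)⁻¹) R) atTop
      (𝓝 (2 * Real.pi * Complex.I * c)) := by
  have hne : (2 * Real.pi * Complex.I : ℂ) ≠ 0 := by
    simp [Real.pi_ne_zero, Complex.I_ne_zero]
  refine (h.const_mul (2 * Real.pi * Complex.I)).congr fun R => ?_
  rw [mul_inv_cancel_left₀ hne]

/-- The integral of a meromorphic function, decaying at `±i∞`, is the same along any two contours
that have all poles on the same sides. -/
theorem integral_eq_of_same_sides {f : ℂ → ℂ} {Z : Set ℂ} {Y ω : ℝ}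
    (hpol : ∀ r, PolarOn Z (Metric.ball 0 r) f) (hZ : ∀ s ∈ Z, |s.im| ≤ Y) (hω : 0 < ω)
    (hf : HasDecay ω f)
    (hL : ∀ s ∈ Z, (L.IsLeft s ∧ L'.IsLeft s) ∨ (L.IsRight s ∧ L'.IsRight s)) :
    L.integral f = L'.integral f := by
  have hsL : ∀ s ∈ Z, s ∉ L.support := fun s hs => by
    rcases hL s hs with h | h <;> exact h.1.1
  have hsL' : ∀ s ∈ Z, s ∉ L'.support := fun s hs => by
    rcases hL s hs with h | h <;> exact h.2.1
  have hcont : ∀ M : MBContour, (∀ s ∈ Z, s ∉ M.support) → ContinuousOn f M.support := by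
    intro M hM
    refine continuousOn_of_locally_continuousOn fun x hx => ⟨Metric.ball 0 (‖x‖ + 1),
      Metric.isOpen_ball, by simp, ?_⟩
    exact (hpol (‖x‖ + 1)).continuousOn inter_subset_right fun z hz hzZ => hM z hzZ hz.1
  have hlim := L.tendsto_loopIntegral L' (hf.vanishesVertically hω)
    (L.tendsto_truncIntegral hω hf (hcont L hsL)) (L'.tendsto_truncIntegral hω hf (hcont L' hsL'))
  set R₀ : ℝ := Y + 1 + |(L.vert L.N).im| + |(L'.vert L'.N).im| + |(L.vert 0).im| +
    |(L'.vert 0).im| with hR₀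
  have b1 := neg_abs_le (L.vert L.N).im
  have b2 := neg_abs_le (L'.vert L'.N).im
  have b3 := le_abs_self (L.vert 0).im
  have b4 := le_abs_self (L'.vert 0).im
  have c1 := abs_nonneg (L.vert L.N).im
  have c2 := abs_nonneg (L'.vert L'.N).im
  have c3 := abs_nonneg (L.vert 0).im
  have c4 := abs_nonneg (L'.vert 0).im
  have index : ∀ R, max R₀ 0 ≤ R → ∀ s ∈ Z, L.loopIntegral L' R (fun z => (z - s)⁻¹) = 0 := by
    intro R hR s hs
    have hsY := abs_le.mp (hZ s hs)
    have hR0 : R₀ ≤ R := (le_max_left _ _).trans hR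
    -- the index of the closed path is eventually constant and tends to the difference of the two
    -- indices, which is zero
    have hlim0 : Tendsto (fun R => L.loopIntegral L' R (fun z => (z - s)⁻¹)) atTop (𝓝 0) := by
      rcases hL s hs with h | h
      · simpa using L.tendsto_loopIntegral L' (vanishesVertically_inv_sub s)
          (L.tendsto_of_tendsto_index h.1.2) (L'.tendsto_of_tendsto_index h.2.2)
      · simpa using L.tendsto_loopIntegral L' (vanishesVertically_inv_sub s)
          (L.tendsto_of_tendsto_index h.1.2) (L'.tendsto_of_tendsto_index h.2.2)
    have hconst : Tendsto (fun R => L.loopIntegral L' R (fun z => (z - s)⁻¹)) atTop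
        (𝓝 (L.loopIntegral L' R (fun z => (z - s)⁻¹))) := by
      refine tendsto_const_nhds.congr' ?_
      filter_upwards [eventually_ge_atTop R] with ρ hρ
      exact (L.loopIntegral_inv_sub_eq L' (hsL s hs) (hsL' s hs) ((le_max_right _ _).trans hR) hρ
        (by linarith) (by linarith) (by linarith) (by linarith)).symm
    exact tendsto_nhds_unique hconst hlim0
  have hzero : ∀ R, max R₀ 0 ≤ R → L.loopIntegral L' R f = 0 := by
    intro R hR
    have hR0 : R₀ ≤ R := (le_max_left _ _).trans hR
    have hcpt : IsCompact (L.loopSupport L' R) := by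
      have hseg : ∀ u v : ℂ, IsCompact (segment ℝ u v) := fun u v => by
        rw [segment_eq_image]
        exact isCompact_Icc.image (by fun_prop)
      exact (((L.isCompact_truncSupport R).union (L'.isCompact_truncSupport R)).union
        (hseg _ _)).union (hseg _ _)
    obtain ⟨r, hr⟩ := hcpt.isBounded.subset_ball (0 : ℂ)
    have hdisj : ∀ s ∈ Z, s ∉ L.loopSupport L' R := by
      intro s hs hmem
      have hsY := abs_le.mp (hZ s hs)
      rcases hmem with ((h | h) | h) | h
      · exact hsL s hs (L.truncSupport_subset R h)
      · exact hsL' s hs (L'.truncSupport_subset R h)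
      · exact (im_lt_of_mem_segment (y := s.im) (by simp; linarith) (by simp; linarith) h).ne rfl
      · exact (im_gt_of_mem_segment (y := s.im) (by simp; linarith) (by simp; linarith) h).ne rfl
    obtain ⟨F, M, hF, hM, h⟩ := hpol r
    have hJ := L.isPathFunctional_loopIntegral L' ((le_max_right _ _).trans hR)
    rw [hJ.congr f (fun z => F z * polarProd M z) fun z hz =>
      h z (hr hz) fun hzZ => hdisj z hzZ hz]
    exact hJ.mul_polarProd_eq_zero hr M (fun s hs => ⟨hdisj s (hM s hs), index R hR s (hM s hs)⟩)
      F hF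
  have h0 : Tendsto (fun R => L.loopIntegral L' R f) atTop (𝓝 0) := by
    refine tendsto_const_nhds.congr' ?_
    filter_upwards [eventually_ge_atTop (max R₀ 0)] with R hR
    exact (hzero R hR).symm
  exact sub_eq_zero.mp (tendsto_nhds_unique hlim h0)

end MBContour

/-! ### Existence of separating contours in a right half-plane -/

lemma segIntegral_symm (f : ℂ → ℂ) (u v : ℂ) : segIntegral f v u = -segIntegral f u v := by
  have h := intervalIntegral.integral_comp_sub_left (a := (0 : ℝ)) (b := 1)
    (fun s : ℝ => f (u + s * (v - u)) * (v - u)) 1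
  rw [segIntegral, segIntegral]
  simp only [sub_self, sub_zero] at h
  rw [← h, ← intervalIntegral.integral_neg]
  refine intervalIntegral.integral_congr fun s _ => ?_
  have e : u + ((1 - s : ℝ) : ℂ) * (v - u) = v + s * (u - v) := by push_cast; ring
  rw [e]; ring

/-- Only countably many points of a vertical line are hidden, as seen from `x`, behind the points
of a countable set. -/
lemma countable_setOf_segment_meets {Z : Set ℂ} (hZ : Z.Countable) {x : ℂ} (hx : x ∉ Z) {c : ℝ}
    (hc : x.re ≠ c) : {y : ℝ | ∃ u ∈ Z, u ∈ segment ℝ x (c + y * Complex.I)}.Countable := by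
  have : {y : ℝ | ∃ u ∈ Z, u ∈ segment ℝ x (c + y * Complex.I)} =
      ⋃ u ∈ Z, {y : ℝ | u ∈ segment ℝ x (c + y * Complex.I)} := by
    ext y; simp
  rw [this]
  refine hZ.biUnion fun u hu => Set.Subsingleton.countable ?_
  intro y hy y' hy'
  rw [mem_ofPred_eq, segment_eq_image'] at hy hy'
  obtain ⟨t, -, ht⟩ := hy
  obtain ⟨t', -, ht'⟩ := hy'
  have hcx : c - x.re ≠ 0 := sub_ne_zero.mpr hc.symm
  have r1 : u.re = x.re + t * (c - x.re) := by rw [← ht]; simp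
  have r2 : u.re = x.re + t' * (c - x.re) := by rw [← ht']; simp
  have i1 : u.im = x.im + t * (y - x.im) := by rw [← ht]; simp
  have i2 : u.im = x.im + t' * (y' - x.im) := by rw [← ht']; simp
  have htt : t = t' := mul_right_cancel₀ hcx (by linarith)
  have ht0 : t ≠ 0 := by
    rintro rfl
    refine hx ?_
    have : u = x := Complex.ext (by simpa using r1) (by simpa using i1)
    exact this ▸ hu
  rw [← htt] at i2
  have := mul_left_cancel₀ ht0 (show t * (y - x.im) = t * (y' - x.im) by linarith)
  linarith

/-- Two points off a countable set are joined by two segments that avoid it, through a point of a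
given vertical line. -/
lemma exists_vertical_point_avoiding {Z : Set ℂ} (hZ : Z.Countable) {x x' : ℂ} (hx : x ∉ Z)
    (hx' : x' ∉ Z) {c : ℝ} (hc : x.re ≠ c) (hc' : x'.re ≠ c) :
    ∃ z : ℂ, z.re = c ∧ (∀ u ∈ Z, u ∉ segment ℝ x z) ∧ ∀ u ∈ Z, u ∉ segment ℝ z x' := by
  obtain ⟨y, hy⟩ := (((countable_setOf_segment_meets hZ hx hc).union
    (countable_setOf_segment_meets hZ hx' hc')).dense_compl ℝ).nonempty
  simp only [mem_compl_iff, mem_union, mem_ofPred_eq, not_or, not_exists, not_and] at hy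
  refine ⟨c + y * Complex.I, by simp, hy.1, fun u hu => ?_⟩
  rw [segment_symm]
  exact hy.2 u hu

/-- One side of a diamond (a square on its corner) centred at `s` contributes a quarter of the index
about `s`. -/
lemma segIntegral_quarter_turn {s d : ℂ} (hd : d ≠ 0) :
    s ∉ segment ℝ (s + d) (s + d * Complex.I) ∧
      segIntegral (fun z => (z - s)⁻¹) (s + d) (s + d * Complex.I) =
        Real.pi / 2 * Complex.I := by
  have hslit : ∀ z ∈ segment ℝ (s + d) (s + d * Complex.I), (z - s) / d ∈ Complex.slitPlane := by
    intro z hz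
    rw [segment_eq_image'] at hz
    obtain ⟨t, ht, rfl⟩ := hz
    have e : ((s + d) + t • ((s + d * Complex.I) - (s + d)) - s) / d =
        ((1 - t : ℝ) : ℂ) + (t : ℝ) * Complex.I := by
      simp only [Complex.real_smul]; push_cast; field_simp; ring
    rw [e, Complex.mem_slitPlane_iff]
    rcases ht.2.lt_or_eq with h | h
    · left; simpa using h
    · right; simp [h]
  have hns : s ∉ segment ℝ (s + d) (s + d * Complex.I) := fun h => by
    simpa using Complex.slitPlane_ne_zero (hslit s h)
  refine ⟨hns, ?_⟩
  have hJ := isPathFunctional_segIntegral (subset_refl (segment ℝ (s + d) (s + d * Complex.I)))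
  have hcont : ContinuousOn (fun z => (z - s)⁻¹) (segment ℝ (s + d) (s + d * Complex.I)) :=
    ContinuousOn.inv₀ (by fun_prop) fun z hz h => hns (sub_eq_zero.mp h ▸ hz)
  rw [hJ.ftc (fun z => Complex.log ((z - s) / d)) _ hcont fun z hz => ?_]
  · simp [hd, Complex.log_I]
  · have h1 : HasDerivAt (fun z => (z - s) / d) (1 / d) z :=
      ((hasDerivAt_id z).sub_const s).div_const d
    refine (h1.clog (hslit z hz)).congr_deriv ?_
    have : z - s ≠ 0 := fun h => hns (sub_eq_zero.mp h ▸ hz)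
    field_simp

namespace MBContour

/-- Append a vertex to the contour. -/
def snoc (L : MBContour) (z : ℂ) : MBContour :=
  ⟨L.N + 1, fun k => if k ≤ L.N then L.vert k else z⟩

@[simp] lemma snoc_vert_zero (L : MBContour) (z : ℂ) : (L.snoc z).vert 0 = L.vert 0 := by
  simp [snoc]

@[simp] lemma snoc_vert_last (L : MBContour) (z : ℂ) : (L.snoc z).vert (L.snoc z).N = z := by
  simp [snoc]

lemma polyIntegral_snoc (L : MBContour) (z : ℂ) (f : ℂ → ℂ) :
    (L.snoc z).polyIntegral f = L.polyIntegral f + segIntegral f (L.vert L.N) z := by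
  simp only [polyIntegral, segIntegral, snoc, Finset.sum_range_succ]
  congr 1
  · refine Finset.sum_congr rfl fun k hk => ?_
    have hk := Finset.mem_range.mp hk
    simp [hk.le, Nat.succ_le_iff.mpr hk]
  · simp

/-- The bounded part of the contour lies in `A`. -/
def PolyIn (L : MBContour) (A : Set ℂ) : Prop :=
  ∀ k < L.N, segment ℝ (L.vert k) (L.vert (k + 1)) ⊆ A

lemma PolyIn.snoc {L : MBContour} {A : Set ℂ} {z : ℂ} (h : L.PolyIn A)
    (hz : segment ℝ (L.vert L.N) z ⊆ A) : (L.snoc z).PolyIn A := by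
  intro k hk
  simp only [MBContour.snoc] at hk ⊢
  rcases Nat.lt_succ_iff_lt_or_eq.mp hk with h1 | h1
  · simpa [h1.le, Nat.succ_le_iff.mpr h1] using h k h1
  · subst h1; simpa using hz

/-- A closed excursion can be added to the bounded part of a contour so as to change the index
about one point `s` only: walk to a small diamond round `s`, go round it once, and walk back the
same way. -/
lemma exists_excursion {Z : Set ℂ} (hZ : Z.Countable) {v s : ℂ} (hv : v ∉ Z) (hs : v.re < s.re)
    {ρ₀ : ℝ} (hρ₀ : 0 < ρ₀) (hiso : ∀ u ∈ Z, u ∈ Metric.ball s ρ₀ → u = s)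
    (L : MBContour) (hL0 : L.vert 0 = v) (hLN : L.vert L.N = v)
    (hL : L.PolyIn {z | v.re ≤ z.re ∧ z ∉ Z}) :
    ∃ L' : MBContour, L'.vert 0 = v ∧ L'.vert L'.N = v ∧
      L'.PolyIn {z | v.re ≤ z.re ∧ z ∉ Z} ∧ ∀ u ∈ Z,
        L'.polyIntegral (fun z => (z - u)⁻¹) = L.polyIntegral (fun z => (z - u)⁻¹) +
          if u = s then 2 * Real.pi * Complex.I else 0 := by
  set A : Set ℂ := {z | v.re ≤ z.re ∧ z ∉ Z} with hA
  obtain ⟨ρ, hρ, hρ1, hρ2⟩ : ∃ ρ, 0 < ρ ∧ ρ < ρ₀ ∧ ρ < s.re - v.re := by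
    obtain ⟨ρ, h1, h2⟩ := exists_between (lt_min hρ₀ (sub_pos.mpr hs))
    exact ⟨ρ, h1, h2.trans_le (min_le_left _ _), h2.trans_le (min_le_right _ _)⟩
  have hρc : (ρ : ℂ) ≠ 0 := by exact_mod_cast hρ.ne'
  -- the vertices of the diamond are `s + ρ i ^ k`
  set D : ℕ → ℂ := fun k => s + ρ * Complex.I ^ k with hD
  have hD4 : D 4 = D 0 := by simp [hD, Complex.I_pow_four]
  have hDs : ∀ k, D (k + 1) = s + ρ * Complex.I ^ k * Complex.I := fun k => by
    simp only [hD, pow_succ]; ring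
  have hdne : ∀ k, (ρ : ℂ) * Complex.I ^ k ≠ 0 := fun k =>
    mul_ne_zero hρc (pow_ne_zero _ Complex.I_ne_zero)
  have hDball : ∀ k, D k ∈ Metric.closedBall s ρ := fun k => by
    simp [hD, abs_of_pos hρ]
  have hDseg : ∀ k, segment ℝ (D k) (D (k + 1)) ⊆ Metric.closedBall s ρ := fun k =>
    (convex_closedBall s ρ).segment_subset (hDball k) (hDball (k + 1))
  have hDA : ∀ k, segment ℝ (D k) (D (k + 1)) ⊆ A := by
    intro k z hz
    have hb := hDseg k hz
    refine ⟨?_, fun hzZ => ?_⟩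
    · have h1 := Complex.abs_re_le_norm (z - s)
      rw [Metric.mem_closedBall, dist_eq_norm] at hb
      have h2 := neg_abs_le (z - s).re
      simp only [Complex.sub_re] at h1 h2
      linarith
    · have := hiso z hzZ (Metric.closedBall_subset_ball hρ1 hb)
      rw [this, hDs] at hz
      exact (segIntegral_quarter_turn (hdne k)).1 hz
  have hD0Z : D 0 ∉ Z := (hDA 0 (left_mem_segment ℝ _ _)).2
  have hD0re : (D 0).re = s.re + ρ := by simp [hD]
  obtain ⟨z, hzre, hz1, hz2⟩ := exists_vertical_point_avoiding hZ hv hD0Z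
    (c := (v.re + s.re) / 2) (by linarith) (by rw [hD0re]; linarith)
  have hre : ∀ x y : ℂ, v.re ≤ x.re → v.re ≤ y.re → ∀ w ∈ segment ℝ x y, v.re ≤ w.re :=
    fun x y hx hy w hw => (convex_halfSpace_re_ge v.re).segment_subset hx hy hw
  have s1 : segment ℝ v z ⊆ A := fun w hw =>
    ⟨hre v z le_rfl (by linarith) w hw, fun h => hz1 w h hw⟩
  have s2 : segment ℝ z (D 0) ⊆ A := fun w hw =>
    ⟨hre z (D 0) (by linarith) (by linarith) w hw, fun h => hz2 w h hw⟩
  refine ⟨((((((((L.snoc z).snoc (D 0)).snoc (D 1)).snoc (D 2)).snoc (D 3)).snoc (D 4)).snoc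
    z).snoc v), by simpa using hL0, by simp, ?_, fun u hu => ?_⟩
  · refine (((((((((hL.snoc ?_).snoc ?_).snoc ?_).snoc ?_).snoc ?_).snoc ?_).snoc ?_).snoc ?_))
    · rwa [hLN]
    · simpa using s2
    · simpa using hDA 0
    · simpa using hDA 1
    · simpa using hDA 2
    · simpa using hDA 3
    · rw [snoc_vert_last, hD4, segment_symm]; exact s2
    · rw [snoc_vert_last, segment_symm]; exact s1
  · simp only [polyIntegral_snoc, snoc_vert_last, hLN, hD4]
    rw [segIntegral_symm _ z (D 0), segIntegral_symm _ v z]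
    have hsum : segIntegral (fun z => (z - u)⁻¹) (D 0) (D 1) +
        segIntegral (fun z => (z - u)⁻¹) (D 1) (D 2) +
        segIntegral (fun z => (z - u)⁻¹) (D 2) (D 3) +
        segIntegral (fun z => (z - u)⁻¹) (D 3) (D 0) =
        if u = s then 2 * Real.pi * Complex.I else 0 := by
      split_ifs with hus
      · subst hus
        have q : ∀ k, segIntegral (fun z => (z - u)⁻¹) (D k) (D (k + 1)) =
            Real.pi / 2 * Complex.I := fun k => by
          rw [hDs]; exact (segIntegral_quarter_turn (hdne k)).2
        have q3 := q 3
        rw [hD4] at q3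
        rw [q 0, q 1, q 2, q3]
        ring
      · have hu' : u ∉ Metric.ball s ρ₀ := fun h => hus (hiso u hu h)
        have hdiff : DifferentiableOn ℂ (fun z => (z - u)⁻¹) (Metric.ball s ρ₀) :=
          DifferentiableOn.inv (by fun_prop) fun z hz h => hu' (sub_eq_zero.mp h ▸ hz)
        obtain ⟨G, hG⟩ := hdiff.isExactOn_ball
        have hin : ∀ k, segment ℝ (D k) (D (k + 1)) ⊆ Metric.ball s ρ₀ := fun k =>
          (hDseg k).trans (Metric.closedBall_subset_ball hρ1)
        have q : ∀ k, segIntegral (fun z => (z - u)⁻¹) (D k) (D (k + 1)) =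
            G (D (k + 1)) - G (D k) := fun k =>
          (isPathFunctional_segIntegral (hin k)).ftc G _ hdiff.continuousOn hG
        have q3 := q 3
        rw [hD4] at q3
        rw [q 0, q 1, q 2, q3]
        ring
    rw [← hsum]
    ring

/-- A closed polygon that winds once round each point of a finite set `S`, and round no other point
of the isolated set `Z`. -/
lemma exists_polygon_with_index {Z : Set ℂ} (hZ : Z.Countable) {v : ℂ} (hv : v ∉ Z)
    (hiso : ∀ s ∈ Z, ∃ ρ > 0, ∀ u ∈ Z, u ∈ Metric.ball s ρ → u = s) (S : Finset ℂ)
    (hS : ∀ s ∈ S, s ∈ Z ∧ v.re < s.re) :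
    ∃ L : MBContour, L.vert 0 = v ∧ L.vert L.N = v ∧ L.PolyIn {z | v.re ≤ z.re ∧ z ∉ Z} ∧
      ∀ u ∈ Z, L.polyIntegral (fun z => (z - u)⁻¹) =
        if u ∈ S then 2 * Real.pi * Complex.I else 0 := by
  induction S using Finset.induction_on with
  | empty => exact ⟨⟨0, fun _ => v⟩, rfl, rfl, fun k hk => absurd hk (by simp),
      fun u _ => by simp [polyIntegral]⟩
  | insert s S hsS ih =>
    obtain ⟨L, h0, hN, hp, hi⟩ := ih fun t ht => hS t (by simp [ht])
    obtain ⟨ρ, hρ, hiso'⟩ := hiso s (hS s (by simp)).1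
    obtain ⟨L', h0', hN', hp', hi'⟩ :=
      L.exists_excursion hZ hv (hS s (by simp)).2 hρ hiso' h0 hN hp
    refine ⟨L', h0', hN', hp', fun u hu => ?_⟩
    rw [hi' u hu, hi u hu]
    by_cases hus : u = s
    · subst hus; simp [hsS]
    · simp [hus]

end MBContour

/-- The principal logarithm changes by `πi` along a full vertical line in the right half-plane. -/
lemma tendsto_log_vertical (d : ℂ) :
    Tendsto (fun R : ℝ => Complex.log (d + R * Complex.I) - Complex.log (d - R * Complex.I))
      atTop (𝓝 (Real.pi * Complex.I)) := by
  have hd : Tendsto (fun R : ℝ => d * ((R⁻¹ : ℝ) : ℂ)) atTop (𝓝 0) := by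
    have h := (Complex.continuous_ofReal.tendsto 0).comp tendsto_inv_atTop_zero
    simpa using h.const_mul d
  have h1 : Tendsto (fun R : ℝ => d * ((R⁻¹ : ℝ) : ℂ) + Complex.I) atTop (𝓝 Complex.I) := by
    simpa using hd.add_const Complex.I
  have h2 : Tendsto (fun R : ℝ => d * ((R⁻¹ : ℝ) : ℂ) - Complex.I) atTop (𝓝 (-Complex.I)) := by
    simpa using hd.sub_const Complex.I
  have l1 := ((continuousAt_clog (x := Complex.I) (Or.inr (by simp))).tendsto).comp h1
  have l2 := ((continuousAt_clog (x := -Complex.I) (Or.inr (by simp))).tendsto).comp h2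
  have key := l1.sub l2
  have e : Complex.log Complex.I - Complex.log (-Complex.I) = Real.pi * Complex.I := by
    rw [Complex.log_I, Complex.log_neg_I]; ring
  rw [e] at key
  refine key.congr' ?_
  filter_upwards [eventually_gt_atTop 0, h1.eventually_ne Complex.I_ne_zero,
    h2.eventually_ne (neg_ne_zero.mpr Complex.I_ne_zero)] with R hR k1 k2
  have hRc : (R : ℂ) ≠ 0 := by exact_mod_cast hR.ne'
  have e1 : d + R * Complex.I = (R : ℝ) * (d * ((R⁻¹ : ℝ) : ℂ) + Complex.I) := by
    push_cast; field_simp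
  have e2 : d - R * Complex.I = (R : ℝ) * (d * ((R⁻¹ : ℝ) : ℂ) - Complex.I) := by
    push_cast; field_simp
  simp only [Function.comp]
  rw [e1, e2, Complex.log_ofReal_mul hR k1, Complex.log_ofReal_mul hR k2]
  ring

/-- The index of a vertical line about the points on either side. -/
lemma tendsto_vertical_index {v u : ℂ} (h : u.re ≠ v.re) :
    Tendsto (fun R : ℝ => ∫ t in (-R)..R, (v + t * Complex.I - u)⁻¹ * Complex.I) atTop
      (𝓝 (if u.re < v.re then Real.pi * Complex.I else -(Real.pi * Complex.I))) := by
  have hcont : ContinuousOn (fun z => (z - u)⁻¹) {z : ℂ | z.re = v.re} :=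
    ContinuousOn.inv₀ (by fun_prop) fun z hz h0 => h (by
      rw [sub_eq_zero.mp h0] at hz; exact hz)
  have hJ : ∀ R : ℝ, IsPathFunctional (fun f => ∫ t in (-R)..R, f (v + t * Complex.I) * Complex.I)
      {z : ℂ | z.re = v.re} (v + (-R : ℝ) * Complex.I) (v + (R : ℝ) * Complex.I) := fun R =>
    isPathFunctional_affine (-R) R v Complex.I fun t _ => by simp
  split_ifs with hlt
  · refine (tendsto_log_vertical (v - u)).congr fun R => ?_
    rw [(hJ R).ftc (fun z => Complex.log (z - u)) _ hcont fun z hz => ?_]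
    · push_cast; congr 2 <;> ring
    · refine (((hasDerivAt_id z).sub_const u).clog (Or.inl ?_)).congr_deriv (by simp)
      have : z.re = v.re := hz
      simp [this, hlt]
  · have hlt' : v.re < u.re := lt_of_le_of_ne (not_lt.mp hlt) h.symm
    refine (tendsto_log_vertical (u - v)).neg.congr fun R => ?_
    rw [(hJ R).ftc (fun z => Complex.log (u - z)) _ hcont fun z hz => ?_]
    · push_cast; rw [neg_sub]; congr 2 <;> ring
    · have hz' : z.re = v.re := hz
      refine (((hasDerivAt_id z).const_sub u).clog (Or.inl ?_)).congr_deriv ?_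
      · simp [hz', hlt']
      · rw [id, ← neg_sub z u, neg_div_neg_eq, one_div]

namespace MBContour

lemma truncIntegral_inv_sub {L : MBContour} {v u : ℂ} (h0 : L.vert 0 = v) (hN : L.vert L.N = v)
    (hu : u.re ≠ v.re) (R : ℝ) :
    L.truncIntegral (fun z => (z - u)⁻¹) R =
      (∫ t in (-R)..R, (v + t * Complex.I - u)⁻¹ * Complex.I) +
        L.polyIntegral (fun z => (z - u)⁻¹) := by
  have hc : Continuous fun t : ℝ => (v + t * Complex.I - u)⁻¹ * Complex.I := by
    refine Continuous.mul (Continuous.inv₀ (by fun_prop) fun t h => hu ?_) continuous_const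
    have := congrArg Complex.re h
    simp at this
    linarith
  rw [truncIntegral, h0, hN, ← intervalIntegral.integral_add_adjacent_intervals
    (hc.intervalIntegrable (-R) 0) (hc.intervalIntegrable 0 R)]
  ring

end MBContour

namespace FoxParams

variable {p q m n : ℕ} (P : FoxParams p q)

lemma finite_leftPoles (hA : ∀ j, 0 < P.A j) (x : ℝ) :
    {s ∈ P.leftPoles n | x < s.re}.Finite := by
  refine Set.Finite.subset (Set.finite_iUnion fun j : Fin p =>
    (Set.finite_lt_nat ⌈(P.a j).re - 1 - x * P.A j⌉₊).image fun k : ℕ =>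
      (P.a j - 1 - k) / (P.A j : ℂ)) ?_
  rintro _ ⟨⟨j, -, k, rfl⟩, h⟩
  refine mem_iUnion.mpr ⟨j, k, ?_, rfl⟩
  rw [Complex.div_ofReal_re, lt_div_iff₀ (hA j)] at h
  simp only [Complex.sub_re, Complex.one_re, Complex.natCast_re] at h
  exact Nat.lt_ceil.mpr (by linarith)

lemma finite_rightPoles (hB : ∀ j, 0 < P.B j) (x : ℝ) :
    {s ∈ P.rightPoles m | s.re < x}.Finite := by
  refine Set.Finite.subset (Set.finite_iUnion fun j : Fin q =>
    (Set.finite_lt_nat ⌈x * P.B j - (P.b j).re⌉₊).image fun k : ℕ =>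
      (P.b j + k) / (P.B j : ℂ)) ?_
  rintro _ ⟨⟨j, -, k, rfl⟩, h⟩
  refine mem_iUnion.mpr ⟨j, k, ?_, rfl⟩
  rw [Complex.div_ofReal_re, div_lt_iff₀ (hB j)] at h
  simp only [Complex.add_re, Complex.natCast_re] at h
  exact Nat.lt_ceil.mpr (by linarith)

lemma countable_poles : (P.leftPoles n ∪ P.rightPoles m).Countable := by
  refine Set.Countable.union ?_ ?_
  · refine (Set.countable_iUnion fun j : Fin p =>
      Set.countable_range fun k : ℕ => (P.a j - 1 - k) / (P.A j : ℂ)).mono ?_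
    rintro _ ⟨j, -, k, rfl⟩
    exact mem_iUnion.mpr ⟨j, k, rfl⟩
  · refine (Set.countable_iUnion fun j : Fin q =>
      Set.countable_range fun k : ℕ => (P.b j + k) / (P.B j : ℂ)).mono ?_
    rintro _ ⟨j, -, k, rfl⟩
    exact mem_iUnion.mpr ⟨j, k, rfl⟩

lemma exists_im_bound : ∃ Y : ℝ, ∀ s ∈ P.leftPoles n ∪ P.rightPoles m, |s.im| ≤ Y := by
  refine ⟨(∑ j, |(P.a j).im / P.A j|) + ∑ j, |(P.b j).im / P.B j|, ?_⟩
  have h1 : 0 ≤ ∑ j, |(P.a j).im / P.A j| := Finset.sum_nonneg fun _ _ => abs_nonneg _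
  have h2 : 0 ≤ ∑ j, |(P.b j).im / P.B j| := Finset.sum_nonneg fun _ _ => abs_nonneg _
  rintro _ (⟨j, -, k, rfl⟩ | ⟨j, -, k, rfl⟩)
  · have := Finset.single_le_sum (f := fun j => |(P.a j).im / P.A j|)
      (fun _ _ => abs_nonneg _) (Finset.mem_univ j)
    simp only [Complex.div_ofReal_im, Complex.sub_im, Complex.one_im, Complex.natCast_im, sub_zero]
      at this ⊢
    linarith
  · have := Finset.single_le_sum (f := fun j => |(P.b j).im / P.B j|)
      (fun _ _ => abs_nonneg _) (Finset.mem_univ j)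
    simp only [Complex.div_ofReal_im, Complex.add_im, Complex.natCast_im, add_zero]
      at this ⊢
    linarith

/-- The left poles accumulate only at `-∞` and the right poles only at `+∞`, so that near any point
there are finitely many of both. -/
lemma isolated_poles (hA : ∀ j, 0 < P.A j) (hB : ∀ j, 0 < P.B j) (s : ℂ) :
    ∃ ρ > 0, ∀ u ∈ P.leftPoles n ∪ P.rightPoles m, u ∈ Metric.ball s ρ → u = s := by
  have hfin := (P.finite_leftPoles (n := n) hA (s.re - 1)).union
    (P.finite_rightPoles (m := m) hB (s.re + 1))
  have hcl : IsClosed (({u ∈ P.leftPoles n | s.re - 1 < u.re} ∪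
      {u ∈ P.rightPoles m | u.re < s.re + 1}) \ {s}) := (hfin.subset sdiff_subset).isClosed
  obtain ⟨ρ, hρ, hball⟩ := Metric.isOpen_iff.mp hcl.isOpen_compl s (by simp)
  refine ⟨min ρ 1, by positivity, fun u hu hus => ?_⟩
  by_contra hne
  refine hball (Metric.ball_subset_ball (min_le_left _ _) hus) ⟨?_, hne⟩
  have h1 : ‖u - s‖ < 1 := by
    have := Metric.mem_ball.mp hus
    rw [dist_eq_norm] at this
    exact this.trans_le (min_le_right _ _)
  have h2 := abs_lt.mp ((Complex.abs_re_le_norm (u - s)).trans_lt h1)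
  rw [Complex.sub_re] at h2
  rcases hu with h | h
  · exact Or.inl ⟨h, by linarith⟩
  · exact Or.inr ⟨h, by linarith⟩

lemma lt_re_of_mem_rightPoles (hB : ∀ j, 0 < P.B j) {c : ℝ}
    (hc : ∀ j : Fin q, (j : ℕ) < m → c < (P.b j).re / P.B j) {s : ℂ} (hs : s ∈ P.rightPoles m) :
    c < s.re := by
  obtain ⟨j, hj, k, rfl⟩ := hs
  rw [Complex.div_ofReal_re]
  refine (hc j hj).trans_le ?_
  refine div_le_div_of_nonneg_right ?_ (hB j).le
  simp

/-- There is a separating contour as far to the right as the poles of the `Γ(b_j - B_j ξ)` permit: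
a vertical line to the left of these poles, with excursions round those poles of the other family
that lie to the right of the line. -/
theorem exists_separates (hA : ∀ j, 0 < P.A j) (hB : ∀ j, 0 < P.B j)
    (hdisj : Disjoint (P.leftPoles n) (P.rightPoles m)) {c : ℝ}
    (hc : ∀ j : Fin q, (j : ℕ) < m → c < (P.b j).re / P.B j) :
    ∃ L : MBContour, P.Separates m n L ∧ ∀ z ∈ L.support, c ≤ z.re := by
  set Z := P.leftPoles n ∪ P.rightPoles m with hZ
  obtain ⟨c₁, hcc₁, hc₁⟩ : ∃ c₁ > c, ∀ j : Fin q, (j : ℕ) < m → c₁ < (P.b j).re / P.B j := by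
    have h : ∀ᶠ x in 𝓝[>] c, ∀ j : Fin q, (j : ℕ) < m → x < (P.b j).re / P.B j := by
      refine eventually_all.mpr fun j => ?_
      by_cases hj : (j : ℕ) < m
      · filter_upwards [nhdsWithin_le_nhds (gt_mem_nhds (hc j hj))] with x hx _ using hx
      · exact Eventually.of_forall fun x h => absurd h hj
    obtain ⟨x, h1, h2⟩ := (h.and self_mem_nhdsWithin).exists
    exact ⟨x, h2, h1⟩
  -- the abscissa of the line is chosen so as to miss all poles
  obtain ⟨x, ⟨hcx, hxc⟩, hxZ⟩ : ∃ x ∈ Ioo c c₁, x ∉ Complex.re '' Z := by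
    have hd := (P.countable_poles (m := m) (n := n)).image Complex.re |>.dense_compl ℝ
    obtain ⟨x, hx1, hx2⟩ := hd.exists_between hcc₁
    exact ⟨x, hx2, hx1⟩
  have hZx : ∀ u ∈ Z, u.re ≠ x := fun u hu h => hxZ ⟨u, hu, h⟩
  have hfin := P.finite_leftPoles (n := n) hA x
  obtain ⟨L, h0, hN, hp, hi⟩ := MBContour.exists_polygon_with_index
    (P.countable_poles (m := m) (n := n)) (v := (x : ℂ)) (fun h => hZx _ h (by simp))
    (fun s _ => P.isolated_poles hA hB s) hfin.toFinset (fun s hs => by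
      have := hfin.mem_toFinset.mp hs
      exact ⟨Or.inl this.1, by simpa using this.2⟩)
  have hsupp : ∀ z ∈ L.support, x ≤ z.re ∧ z ∉ Z := by
    rintro z ((⟨t, -, rfl⟩ | hz) | ⟨t, -, rfl⟩)
    · rw [h0]; exact ⟨by simp, fun h => hZx _ h (by simp)⟩
    · obtain ⟨k, hk, hz⟩ := mem_iUnion₂.mp hz
      exact hp k (by simpa using hk) hz
    · rw [hN]; exact ⟨by simp, fun h => hZx _ h (by simp)⟩
  -- the line contributes `± 1/2` to the index, and the loops `1` for the left poles beyond the line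
  have hlim : ∀ u ∈ Z, Tendsto (fun R : ℝ => (2 * Real.pi * Complex.I)⁻¹ *
      L.truncIntegral (fun ξ => (ξ - u)⁻¹) R) atTop (𝓝 ((2 * Real.pi * Complex.I)⁻¹ *
        ((if u.re < x then Real.pi * Complex.I else -(Real.pi * Complex.I)) +
          if u ∈ hfin.toFinset then 2 * Real.pi * Complex.I else 0))) := by
    intro u hu
    have h1 := (tendsto_vertical_index (v := x) (u := u) (by simpa using hZx u hu)).add_const
      (if u ∈ hfin.toFinset then 2 * Real.pi * Complex.I else 0 : ℂ)
    rw [Complex.ofReal_re] at h1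
    refine (h1.congr fun R => ?_).const_mul _
    rw [MBContour.truncIntegral_inv_sub h0 hN (by simpa using hZx u hu), hi u hu]
  have hpi : (Real.pi : ℂ) ≠ 0 := by exact_mod_cast Real.pi_ne_zero
  refine ⟨L, ⟨fun s hs => ⟨fun h => (hsupp s h).2 (Or.inl hs), ?_⟩,
    fun s hs => ⟨fun h => (hsupp s h).2 (Or.inr hs), ?_⟩⟩, fun z hz => hcx.le.trans (hsupp z hz).1⟩
  · have h := hlim s (Or.inl hs)
    rcases lt_or_gt_of_ne (hZx s (Or.inl hs)) with h1 | h1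
    · rw [if_pos h1, if_neg (by simp [hs, h1.le])] at h
      convert h using 2
      have := Complex.I_ne_zero
      field_simp
      ring
    · rw [if_neg (by linarith), if_pos (by simp [hs, h1])] at h
      convert h using 2
      have := Complex.I_ne_zero
      field_simp
      ring
  · have h := hlim s (Or.inr hs)
    have h1 : x < s.re := hxc.trans (P.lt_re_of_mem_rightPoles hB hc₁ hs)
    have h2 : s ∉ P.leftPoles n := fun h => Set.disjoint_left.mp hdisj h hs
    rw [if_neg (by linarith), if_neg (by simp [h2])] at h
    convert h using 2
    have := Complex.I_ne_zero
    field_simp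
    ring

end FoxParams

/-! ### Convolutions on an interval with weakly singular kernels -/

lemma intervalIntegrable_beta {s t : ℂ} (hs : 0 < s.re) (ht : 0 < t.re) {y : ℝ} (hy : 0 < y) :
    IntervalIntegrable (fun x : ℝ => (x : ℂ) ^ (s - 1) * ((y : ℂ) - x) ^ (t - 1)) volume 0 y := by
  -- the value of the integral is known and not zero
  by_contra h
  have h0 := intervalIntegral.integral_undef h
  rw [Complex.betaIntegral_scaled s t hy, Complex.betaIntegral_eq_Gamma_mul_div s t hs ht] at h0
  have hyc : (y : ℂ) ≠ 0 := by exact_mod_cast hy.ne'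
  refine mul_ne_zero ?_ (div_ne_zero (mul_ne_zero (Complex.Gamma_ne_zero_of_re_pos hs)
    (Complex.Gamma_ne_zero_of_re_pos ht)) (Complex.Gamma_ne_zero_of_re_pos ?_)) h0
  · simp [Complex.cpow_eq_zero_iff, hyc]
  · simpa using add_pos hs ht

lemma integrableOn_rpow_mul_rpow {σ τ : ℝ} (hσ : 0 < σ) (hτ : 0 < τ) {y : ℝ} (hy : 0 < y) :
    IntegrableOn (fun x : ℝ => x ^ (σ - 1) * (y - x) ^ (τ - 1)) (Ioo 0 y) := by
  have h := (intervalIntegrable_beta (s := σ) (t := τ) (by simpa) (by simpa) hy)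
  rw [intervalIntegrable_iff_integrableOn_Ioo_of_le hy.le] at h
  refine IntegrableOn.congr_fun (f := fun x : ℝ => ‖(x : ℂ) ^ ((σ : ℂ) - 1) *
    ((y : ℂ) - x) ^ ((τ : ℂ) - 1)‖) h.norm (fun x hx => ?_) measurableSet_Ioo
  have hxy : 0 < y - x := sub_pos.mpr hx.2
  simp only [norm_mul]
  rw [← Complex.ofReal_sub, Complex.norm_cpow_eq_rpow_re_of_pos hx.1,
    Complex.norm_cpow_eq_rpow_re_of_pos hxy]
  simp

lemma integral_rpow_mul_rpow {σ τ : ℝ} (hσ : 0 < σ) (hτ : 0 < τ) {y : ℝ} (hy : 0 < y) :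
    ∫ x in Ioo 0 y, x ^ (σ - 1) * (y - x) ^ (τ - 1) =
      y ^ (σ + τ - 1) * ProbabilityTheory.beta σ τ := by
  have h := Complex.betaIntegral_scaled (σ : ℂ) (τ : ℂ) hy
  rw [intervalIntegral.integral_of_le hy.le, integral_Ioc_eq_integral_Ioo,
    Complex.betaIntegral_eq_Gamma_mul_div _ _ (by simpa) (by simpa), ← Complex.ofReal_add,
    Complex.Gamma_ofReal, Complex.Gamma_ofReal, Complex.Gamma_ofReal] at h
  have e : ∫ x in Ioo 0 y, (x : ℂ) ^ ((σ : ℂ) - 1) * ((y : ℂ) - x) ^ ((τ : ℂ) - 1) =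
      ((∫ x in Ioo 0 y, x ^ (σ - 1) * (y - x) ^ (τ - 1) : ℝ) : ℂ) := by
    rw [← integral_complex_ofReal]
    refine setIntegral_congr_fun measurableSet_Ioo fun x hx => ?_
    rw [Complex.ofReal_mul, Complex.ofReal_cpow hx.1.le, Complex.ofReal_cpow (sub_pos.mpr hx.2).le]
    push_cast; rfl
  rw [e] at h
  have e2 : (y : ℂ) ^ (((σ + τ : ℝ) : ℂ) - 1) = ((y ^ (σ + τ - 1) : ℝ) : ℂ) := by
    rw [Complex.ofReal_cpow hy.le]; push_cast; rfl
  rw [e2] at h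
  exact_mod_cast h

section

variable {𝕜 : Type*} [RCLike 𝕜]

/-- The convolution `∫_a^x K(x - t) f(t) dt`. -/
def intervalConv (a : ℝ) (K f : ℝ → 𝕜) (x : ℝ) : 𝕜 := ∫ t in a..x, K (x - t) * f t

/-- A kernel on `(0, ∞)`, continuous and of size at most `y ^ (σ - 1)` up to a constant factor,
on each bounded interval `(0, T]`. -/
structure IsWeakKernel (σ : ℝ) (K : ℝ → 𝕜) : Prop where
  cont : ContinuousOn K (Ioi 0)
  bound : ∀ T : ℝ, ∃ C : ℝ, ∀ y, 0 < y → y ≤ T → ‖K y‖ ≤ C * y ^ (σ - 1)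

/-- The kernel `K`, cut off to `(0, T)`. -/
def cutKernel (T : ℝ) (K : ℝ → 𝕜) : ℝ → 𝕜 := indicator (Ioo 0 T) K

lemma norm_cutKernel (T : ℝ) (K : ℝ → 𝕜) :
    (fun y => ‖cutKernel T K y‖) = cutKernel T fun y => ‖K y‖ := by
  funext y; simp [cutKernel, norm_indicator_eq_indicator_norm]

lemma IsWeakKernel.norm {σ : ℝ} {K : ℝ → 𝕜} (h : IsWeakKernel σ K) :
    IsWeakKernel σ fun y => ‖K y‖ :=
  ⟨h.cont.norm, fun T => by simpa using h.bound T⟩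

lemma IsWeakKernel.integrable_cut {σ : ℝ} (hσ : 0 < σ) {K : ℝ → 𝕜} (h : IsWeakKernel σ K) (T : ℝ) :
    Integrable (cutKernel T K) := by
  obtain ⟨C, hC⟩ := h.bound T
  refine (integrable_indicator_iff measurableSet_Ioo).mpr ?_
  rcases le_or_gt T 0 with hT | hT
  · simp [Ioo_eq_empty (not_lt.mpr hT)]
  refine Integrable.mono' (g := fun y => C * y ^ (σ - 1)) ?_
    ((h.cont.mono fun y hy => hy.1).aestronglyMeasurable measurableSet_Ioo)
    ((ae_restrict_iff' measurableSet_Ioo).mpr (Eventually.of_forall fun y hy =>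
      hC y hy.1 hy.2.le))
  refine Integrable.const_mul ?_ C
  exact (intervalIntegrable_iff_integrableOn_Ioo_of_le hT.le).mp
    (intervalIntegral.intervalIntegrable_rpow' (by linarith))

variable {a b : ℝ} {f : ℝ → 𝕜} {K K₁ K₂ : ℝ → 𝕜} {σ σ₁ σ₂ : ℝ}

/-- On `(a, b)` the convolution on the interval is the convolution on the line of the cut-off kernel
and the cut-off function. -/
lemma cut_mul_indicator (K f : ℝ → 𝕜) {x : ℝ} (hx : x ≤ b) :
    (fun t => cutKernel (b - a) K (x - t) * indicator (Ioo a b) f t) =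
      indicator (Ioo a x) fun t => K (x - t) * f t := by
  funext t
  simp only [cutKernel, indicator, mem_Ioo]
  by_cases h : a < t ∧ t < x
  · rw [if_pos ⟨by linarith [h.2], by linarith [h.1]⟩, if_pos ⟨h.1, by linarith [h.2]⟩, if_pos h]
  · rw [if_neg h]
    by_cases h1 : a < t ∧ t < b
    · rw [if_neg fun h2 => h ⟨h1.1, by linarith [h2.1]⟩, zero_mul]
    · rw [if_neg h1, mul_zero]

lemma convolution_cut (K f : ℝ → 𝕜) {x : ℝ} (hax : a ≤ x) (hx : x ≤ b) :
    convolution (cutKernel (b - a) K) (indicator (Ioo a b) f) (ContinuousLinearMap.mul ℝ 𝕜) volume x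
      = intervalConv a K f x := by
  rw [convolution_eq_swap]
  simp only [ContinuousLinearMap.mul_apply']
  rw [cut_mul_indicator K f hx, integral_indicator measurableSet_Ioo, intervalConv,
    intervalIntegral.integral_of_le hax, integral_Ioc_eq_integral_Ioo]

lemma convolution_cut_of_le (K f : ℝ → 𝕜) {x : ℝ} (hax : x ≤ a) :
    convolution (cutKernel (b - a) K) (indicator (Ioo a b) f) (ContinuousLinearMap.mul ℝ 𝕜) volume x
      = 0 := by
  rw [convolution_eq_swap]
  simp only [ContinuousLinearMap.mul_apply']
  refine integral_eq_zero_of_ae (Eventually.of_forall fun t => ?_)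
  simp only [cutKernel, indicator, mem_Ioo, Pi.zero_apply]
  by_cases h : a < t ∧ t < b
  · rw [if_neg fun h2 => by linarith [h2.1, h.1], zero_mul]
  · rw [if_neg h, mul_zero]

lemma convolutionExistsAt_cut (K f : ℝ → 𝕜) {x : ℝ} (hax : a ≤ x) (hx : x ≤ b) :
    ConvolutionExistsAt (cutKernel (b - a) K) (indicator (Ioo a b) f) x
      (ContinuousLinearMap.mul ℝ 𝕜) volume ↔
    IntervalIntegrable (fun t => K (x - t) * f t) volume a x := by
  rw [convolutionExistsAt_iff_integrable_swap]
  simp only [ContinuousLinearMap.mul_apply']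
  rw [cut_mul_indicator K f hx, integrable_indicator_iff measurableSet_Ioo,
    intervalIntegrable_iff_integrableOn_Ioo_of_le hax]

lemma IsWeakKernel.ae_intervalIntegrable (hσ : 0 < σ) (hK : IsWeakKernel σ K)
    (hf : IntegrableOn f (Ioo a b)) :
    ∀ᵐ x ∂(volume.restrict (Ioo a b)),
      IntervalIntegrable (fun t => K (x - t) * f t) volume a x := by
  rw [ae_restrict_iff' measurableSet_Ioo]
  filter_upwards [(hK.integrable_cut hσ (b - a)).ae_convolution_exists
    (L := ContinuousLinearMap.mul ℝ 𝕜) ((integrable_indicator_iff measurableSet_Ioo).mpr hf)]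
    with x hx hxab
  exact (convolutionExistsAt_cut K f hxab.1.le hxab.2.le).mp hx

lemma IsWeakKernel.integrableOn_intervalConv (hσ : 0 < σ) (hK : IsWeakKernel σ K)
    (hf : IntegrableOn f (Ioo a b)) : IntegrableOn (intervalConv a K f) (Ioo a b) := by
  have h := (hK.integrable_cut hσ (b - a)).integrable_convolution
    (L := ContinuousLinearMap.mul ℝ 𝕜) ((integrable_indicator_iff measurableSet_Ioo).mpr hf)
  exact h.integrableOn.congr_fun (fun x hx => convolution_cut K f hx.1.le hx.2.le) measurableSet_Ioo

lemma cut_mul_convolution (K₁ K₂ f : ℝ → 𝕜) {x : ℝ} (hxb : x ≤ b) :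
    (fun t => cutKernel (b - a) K₁ (x - t) * convolution (cutKernel (b - a) K₂)
      (indicator (Ioo a b) f) (ContinuousLinearMap.mul ℝ 𝕜) volume t) =
      indicator (Ioo a x) fun t => K₁ (x - t) * intervalConv a K₂ f t := by
  funext t
  simp only [indicator, mem_Ioo]
  split_ifs with h
  · rw [convolution_cut K₂ f h.1.le (h.2.le.trans hxb), cutKernel, indicator_of_mem]
    exact ⟨by linarith [h.2], by linarith [h.1]⟩
  · rcases le_or_gt t a with h1 | h1
    · rw [convolution_cut_of_le K₂ f h1, mul_zero]
    · rw [cutKernel, indicator_of_notMem, zero_mul]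
      exact fun h2 => h ⟨h1, by linarith [h2.1]⟩

/-- Absolute convergence at `x` of the iterated convolution `K₁ * (K₂ * f)`. -/
def IteratedConvExists (a b : ℝ) (K₁ K₂ f : ℝ → 𝕜) (x : ℝ) : Prop :=
  ConvolutionExistsAt (fun t => ‖cutKernel (b - a) K₁ t‖)
    (convolution (fun t => ‖cutKernel (b - a) K₂ t‖) (fun t => ‖indicator (Ioo a b) f t‖)
      (ContinuousLinearMap.mul ℝ ℝ) volume) x (ContinuousLinearMap.mul ℝ ℝ) volume

/-- Convolutions of integrable functions converge almost everywhere. -/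
lemma IteratedConvExists.ae (hσ₁ : 0 < σ₁) (hσ₂ : 0 < σ₂) (hK₁ : IsWeakKernel σ₁ K₁)
    (hK₂ : IsWeakKernel σ₂ K₂) (hf : IntegrableOn f (Ioo a b)) :
    ∀ᵐ x, IteratedConvExists a b K₁ K₂ f x :=
  (hK₁.integrable_cut hσ₁ (b - a)).norm.ae_convolution_exists _
    ((hK₂.integrable_cut hσ₂ (b - a)).norm.integrable_convolution _
      ((integrable_indicator_iff measurableSet_Ioo).mpr hf).norm)

/-- Associativity of convolution, at each point of absolute convergence. -/
lemma IteratedConvExists.assoc (hσ₁ : 0 < σ₁) (hσ₂ : 0 < σ₂) (hK₁ : IsWeakKernel σ₁ K₁)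
    (hK₂ : IsWeakKernel σ₂ K₂) (hf : IntegrableOn f (Ioo a b)) {x : ℝ} (hax : a ≤ x) (hxb : x ≤ b)
    (hx : IteratedConvExists a b K₁ K₂ f x) :
    IntervalIntegrable (fun t => K₁ (x - t) * intervalConv a K₂ f t) volume a x ∧
      intervalConv a K₁ (intervalConv a K₂ f) x = intervalConv a (intervalConv 0 K₁ K₂) f x := by
  have i1 := hK₁.integrable_cut hσ₁ (b - a)
  have i2 := hK₂.integrable_cut hσ₂ (b - a)
  have i3 := (integrable_indicator_iff (measurableSet_Ioo (a := a) (b := b))).mpr hf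
  set L := ContinuousLinearMap.mul ℝ 𝕜
  set g := convolution (cutKernel (b - a) K₂) (indicator (Ioo a b) f) L volume with hg
  have ig : Integrable g := i2.integrable_convolution L i3
  have e1 := cut_mul_convolution (a := a) K₁ K₂ f hxb
  rw [← hg] at e1
  have hex : ConvolutionExistsAt (cutKernel (b - a) K₁) g x L volume := by
    refine Integrable.mono' hx (i1.aestronglyMeasurable.convolution_integrand_snd L
      ig.aestronglyMeasurable x) (Eventually.of_forall fun t => ?_)
    simp only [L, ContinuousLinearMap.mul_apply', norm_mul]
    refine mul_le_mul_of_nonneg_left ?_ (norm_nonneg _)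
    rw [hg, convolution, convolution]
    refine (norm_integral_le_integral_norm _).trans (le_of_eq ?_)
    simp [L]
  constructor
  · have h := hex.integrable_swap
    simp only [L, ContinuousLinearMap.mul_apply'] at h
    rw [e1, integrable_indicator_iff measurableSet_Ioo] at h
    exact (intervalIntegrable_iff_integrableOn_Ioo_of_le hax).mpr h
  · have h := convolution_assoc L L L L (fun x y z => by simp [L, mul_assoc])
      i1.aestronglyMeasurable i2.aestronglyMeasurable i3.aestronglyMeasurable
      (i1.ae_convolution_exists L i2) (i2.norm.ae_convolution_exists _ i3.norm) hx
    rw [← hg, convolution_eq_swap, convolution_eq_swap] at h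
    simp only [L, ContinuousLinearMap.mul_apply'] at h
    rw [e1, integral_indicator measurableSet_Ioo] at h
    rw [intervalConv, intervalIntegral.integral_of_le hax, integral_Ioc_eq_integral_Ioo, ← h,
      intervalConv, intervalIntegral.integral_of_le hax, integral_Ioc_eq_integral_Ioo,
      ← integral_indicator measurableSet_Ioo]
    refine integral_congr_ae (Eventually.of_forall fun t => ?_)
    have ecut : cutKernel (b - a) K₂ = indicator (Ioo 0 (b - a)) K₂ := rfl
    simp only [indicator, mem_Ioo]
    by_cases hta : a < t ∧ t < b
    · rw [if_pos hta]
      split_ifs with h1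
      · have := convolution_cut (a := 0) (b := b - a) K₁ K₂ (x := x - t) (by linarith [h1.2])
          (by linarith [h1.1])
        rw [sub_zero] at this
        rw [ecut, this]
      · have := convolution_cut_of_le (a := 0) (b := b - a) K₁ K₂ (x := x - t)
          (by by_contra h2; exact h1 ⟨hta.1, by linarith⟩)
        rw [sub_zero] at this
        rw [ecut, this, zero_mul]
    · rw [if_neg hta, mul_zero, if_neg fun h1 => hta ⟨h1.1, by linarith [h1.2]⟩]

/-- If `σ₁ + σ₂ ≥ 1`, the convolution of the absolute values of the two kernels is bounded, so that
the iterated convolution with an integrable function converges absolutely everywhere. -/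
lemma IteratedConvExists.of_one_le (hσ₁ : 0 < σ₁) (hσ₂ : 0 < σ₂) (hσ : 1 ≤ σ₁ + σ₂)
    (hK₁ : IsWeakKernel σ₁ K₁) (hK₂ : IsWeakKernel σ₂ K₂) (hf : IntegrableOn f (Ioo a b)) (x : ℝ) :
    IteratedConvExists a b K₁ K₂ f x := by
  set T := b - a
  have i1 := hK₁.integrable_cut hσ₁ T
  have i2 := hK₂.integrable_cut hσ₂ T
  have i3 := (integrable_indicator_iff (measurableSet_Ioo (a := a) (b := b))).mpr hf
  have ig := i2.norm.integrable_convolution (ContinuousLinearMap.mul ℝ ℝ) i3.norm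
  set A : ℝ → ENNReal := fun t => ‖cutKernel T K₁ t‖ₑ
  set B : ℝ → ENNReal := fun t => ‖cutKernel T K₂ t‖ₑ
  set F : ℝ → ENNReal := fun t => ‖indicator (Ioo a b) f t‖ₑ
  have hA : AEMeasurable A := i1.aestronglyMeasurable.enorm
  have hB : AEMeasurable B := i2.aestronglyMeasurable.enorm
  have hF : AEMeasurable F := i3.aestronglyMeasurable.enorm
  obtain ⟨C₁, hC₁⟩ := hK₁.bound T
  obtain ⟨C₂, hC₂⟩ := hK₂.bound T
  have hAB : ∀ y, lconvolution A B volume y ≤ ENNReal.ofReal (|C₁| * |C₂| *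
      ((2 * |T|) ^ (σ₁ + σ₂ - 1) * ProbabilityTheory.beta σ₁ σ₂)) := by
    intro y
    rw [lconvolution_def]
    rcases le_or_gt y 0 with hy | hy
    · refine le_of_eq_of_le (lintegral_eq_zero_of_ae_eq_zero (Eventually.of_forall fun s => ?_))
        zero_le
      simp only [A, B, cutKernel, Pi.zero_apply, mul_eq_zero, enorm_eq_zero]
      by_cases h : s ∈ Ioo 0 T
      · right; exact indicator_of_notMem (fun h2 => by linarith [h.1, h2.1]) _
      · left; exact indicator_of_notMem h _
    rcases le_or_gt (2 * T) y with hyT | hyT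
    · refine le_of_eq_of_le (lintegral_eq_zero_of_ae_eq_zero (Eventually.of_forall fun s => ?_))
        zero_le
      simp only [A, B, cutKernel, Pi.zero_apply, mul_eq_zero, enorm_eq_zero]
      by_cases h : s ∈ Ioo 0 T
      · right; exact indicator_of_notMem (fun h2 => by linarith [h.2, h2.2]) _
      · left; exact indicator_of_notMem h _
    have hpt : ∀ s, A s * B (-s + y) ≤ indicator (Ioo 0 y)
        (fun s => ENNReal.ofReal (|C₁| * |C₂| * (s ^ (σ₁ - 1) * (y - s) ^ (σ₂ - 1)))) s := by
      intro s
      by_cases h : s ∈ Ioo 0 T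
      · by_cases h2 : -s + y ∈ Ioo 0 T
        · rw [indicator_of_mem (show s ∈ Ioo 0 y from ⟨h.1, by linarith [h2.1]⟩)]
          simp only [A, B, cutKernel, indicator_of_mem h, indicator_of_mem h2]
          rw [← ofReal_norm, ← ofReal_norm,
            ← ENNReal.ofReal_mul (norm_nonneg _)]
          apply ENNReal.ofReal_le_ofReal
          have e : -s + y = y - s := by ring
          have p1 := Real.rpow_nonneg h.1.le (σ₁ - 1)
          have p2 := Real.rpow_nonneg h2.1.le (σ₂ - 1)
          have b1 : ‖K₁ s‖ ≤ |C₁| * s ^ (σ₁ - 1) := (hC₁ s h.1 h.2.le).trans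
            (mul_le_mul_of_nonneg_right (le_abs_self _) p1)
          have b2 : ‖K₂ (-s + y)‖ ≤ |C₂| * (-s + y) ^ (σ₂ - 1) := (hC₂ _ h2.1 h2.2.le).trans
            (mul_le_mul_of_nonneg_right (le_abs_self _) p2)
          refine (mul_le_mul b1 b2 (norm_nonneg _) ((norm_nonneg _).trans b1)).trans
            (le_of_eq ?_)
          rw [e]; ring
        · have : B (-s + y) = 0 := by simp [B, cutKernel, indicator_of_notMem h2]
          rw [this, mul_zero]; exact zero_le
      · have : A s = 0 := by simp [A, cutKernel, indicator_of_notMem h]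
        rw [this, zero_mul]; exact zero_le
    refine (lintegral_mono hpt).trans ?_
    rw [lintegral_indicator measurableSet_Ioo, ← ofReal_integral_eq_lintegral_ofReal
      ((integrableOn_rpow_mul_rpow hσ₁ hσ₂ hy).const_mul _)
      ((ae_restrict_iff' measurableSet_Ioo).mpr (Eventually.of_forall fun s hs => by
        have := Real.rpow_nonneg hs.1.le (σ₁ - 1)
        have := Real.rpow_nonneg (sub_pos.mpr hs.2).le (σ₂ - 1)
        positivity)), integral_const_mul, integral_rpow_mul_rpow hσ₁ hσ₂ hy]
    apply ENNReal.ofReal_le_ofReal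
    have := (ProbabilityTheory.beta_pos hσ₁ hσ₂).le
    gcongr
    linarith [le_abs_self T]
  refine ⟨i1.norm.aestronglyMeasurable.convolution_integrand_snd _ ig.aestronglyMeasurable x, ?_⟩
  have h1 : ∫⁻ t, ‖(ContinuousLinearMap.mul ℝ ℝ) ‖cutKernel T K₁ t‖
      (convolution (fun t => ‖cutKernel T K₂ t‖) (fun t => ‖indicator (Ioo a b) f t‖)
      (ContinuousLinearMap.mul ℝ ℝ) volume (x - t))‖ₑ ≤
      lconvolution A (lconvolution B F volume) volume x := by
    rw [lconvolution_def]
    refine lintegral_mono fun t => ?_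
    simp only [ContinuousLinearMap.mul_apply', enorm_mul, enorm_norm]
    refine mul_le_mul_of_nonneg_left ?_ zero_le
    rw [convolution, lconvolution_def]
    refine (enorm_integral_le_lintegral_enorm _).trans (le_of_eq ?_)
    refine lintegral_congr fun s => ?_
    simp only [ContinuousLinearMap.mul_apply', enorm_mul, enorm_norm, B, F]
    congr 3; ring
  refine lt_of_le_of_lt h1 ?_
  rw [lconvolution_assoc₀ hA hB hF, lconvolution_def]
  refine lt_of_le_of_lt (lintegral_mono fun y => mul_le_mul_of_nonneg_right (hAB y) zero_le) ?_
  rw [lintegral_const_mul' _ _ ENNReal.ofReal_ne_top]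
  refine ENNReal.mul_lt_top ENNReal.ofReal_lt_top ?_
  have e : ∫⁻ y, F (-y + x) = ∫⁻ y, F y := by
    simp_rw [neg_add_eq_sub]
    exact lintegral_sub_left_eq_self F x
  rw [e]
  exact i3.2

end

/-! ### Convolution with continuous functions -/

section

variable {𝕜 : Type*} [RCLike 𝕜] {a b : ℝ} {f : ℝ → 𝕜} {K K₁ K₂ : ℝ → 𝕜} {σ σ₁ σ₂ : ℝ}

/-- The part of a convolution in which the kernel lives on a short interval `(0, η)`: it involves only
values of `f` in a compact part of `(a, b)`, where `f` is bounded. -/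
lemma continuousAt_near_convolution {k : ℝ → 𝕜} (hk : Integrable k) {η x₀ : ℝ} (hη : 0 < η)
    (hsupp : ∀ u, u ∉ Ioo 0 η → k u = 0) (hf : IntegrableOn f (Ioo a b))
    (hfc : ContinuousOn f (Ioo a b)) (h1 : a < x₀ - 2 * η) (h2 : x₀ + η < b) :
    (∀ᶠ x in 𝓝 x₀, Integrable fun u => k u * indicator (Ioo a b) f (x - u)) ∧
      ContinuousAt (fun x => ∫ u, k u * indicator (Ioo a b) f (x - u)) x₀ := by
  obtain ⟨M, hM⟩ := isCompact_Icc.exists_bound_of_continuousOn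
    (hfc.mono (Icc_subset_Ioo h1 h2))
  have hfi := ((integrable_indicator_iff (measurableSet_Ioo (a := a) (b := b))).mpr hf)
  have hmeas : ∀ x, AEStronglyMeasurable (fun u => k u * indicator (Ioo a b) f (x - u)) volume :=
    fun x => hk.aestronglyMeasurable.mul (hfi.comp_sub_left x).aestronglyMeasurable
  have hbd : ∀ᶠ x in 𝓝 x₀, ∀ u, ‖k u * indicator (Ioo a b) f (x - u)‖ ≤ ‖k u‖ * M := by
    filter_upwards [Ioo_mem_nhds (show x₀ - η < x₀ by linarith) (show x₀ < x₀ + η by linarith)]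
      with x hx u
    rw [norm_mul]
    by_cases hu : u ∈ Ioo 0 η
    · have hxu : x - u ∈ Icc (x₀ - 2 * η) (x₀ + η) :=
        ⟨by linarith [hx.1, hu.2], by linarith [hx.2, hu.1]⟩
      rw [indicator_of_mem (Icc_subset_Ioo h1 h2 hxu)]
      exact mul_le_mul_of_nonneg_left (hM _ hxu) (norm_nonneg _)
    · rw [hsupp u hu]; simp
  refine ⟨hbd.mono fun x hx => (hk.norm.mul_const M).mono' (hmeas x) (Eventually.of_forall hx),
    continuousAt_of_dominated (Eventually.of_forall hmeas)
      (hbd.mono fun x hx => Eventually.of_forall hx) (hk.norm.mul_const M)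
      (Eventually.of_forall fun u => ?_)⟩
  by_cases hu : u ∈ Ioo 0 η
  · have hxu : x₀ - u ∈ Ioo a b := ⟨by linarith [hu.2], by linarith [hu.1]⟩
    have hc : ContinuousAt (indicator (Ioo a b) f) (x₀ - u) :=
      (hfc.continuousAt (isOpen_Ioo.mem_nhds hxu)).congr
        ((eventually_of_mem (isOpen_Ioo.mem_nhds hxu) fun y hy => (indicator_of_mem hy f).symm))
    exact continuousAt_const.mul (ContinuousAt.comp (f := fun x => x - u) hc (by fun_prop))
  · simp only [hsupp u hu, zero_mul]
    exact continuousAt_const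

/-- The part of a convolution in which the kernel is bounded and has countably many discontinuities,
so that integrability of `f` is enough. -/
lemma continuousAt_far_convolution {k : ℝ → 𝕜} (hk : AEStronglyMeasurable k volume) {C : ℝ}
    (hC : ∀ u, ‖k u‖ ≤ C) {S : Set ℝ} (hS : S.Countable) (hc : ∀ u ∉ S, ContinuousAt k u)
    (hf : IntegrableOn f (Ioo a b)) (x₀ : ℝ) :
    (∀ x, Integrable fun t => k (x - t) * indicator (Ioo a b) f t) ∧
      ContinuousAt (fun x => ∫ t, k (x - t) * indicator (Ioo a b) f t) x₀ := by
  have hfi := ((integrable_indicator_iff (measurableSet_Ioo (a := a) (b := b))).mpr hf)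
  have hmeas : ∀ x, AEStronglyMeasurable (fun t => k (x - t) * indicator (Ioo a b) f t) volume :=
    fun x => (hk.comp_quasiMeasurePreserving
      (Measure.measurePreserving_sub_left volume x).quasiMeasurePreserving).mul
        hfi.aestronglyMeasurable
  have hbd : ∀ x t, ‖k (x - t) * indicator (Ioo a b) f t‖ ≤ C * ‖indicator (Ioo a b) f t‖ :=
    fun x t => by
      rw [norm_mul]; exact mul_le_mul_of_nonneg_right (hC _) (norm_nonneg _)
  refine ⟨fun x => (hfi.norm.const_mul C).mono' (hmeas x) (Eventually.of_forall (hbd x)),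
    continuousAt_of_dominated (Eventually.of_forall hmeas)
      (Eventually.of_forall fun x => Eventually.of_forall (hbd x)) (hfi.norm.const_mul C) ?_⟩
  have hS' : ((fun s => x₀ - s) '' S).Countable := hS.image _
  filter_upwards [hS'.ae_notMem volume] with t ht
  have hxt : x₀ - t ∉ S := fun h => ht ⟨x₀ - t, h, by ring⟩
  exact (ContinuousAt.comp (f := fun x => x - t) (hc _ hxt) (by fun_prop)).mul continuousAt_const

/-- The convolution of a weakly singular kernel and a function that is integrable and continuous on
an open interval converges everywhere there and is continuous. The part of the kernel near its
singularity sees only values of `f` near the point in question. -/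
lemma IsWeakKernel.continuousAt_intervalConv (hσ : 0 < σ) (hK : IsWeakKernel σ K)
    (hf : IntegrableOn f (Ioo a b)) (hfc : ContinuousOn f (Ioo a b)) {x₀ : ℝ} (hx₀ : x₀ ∈ Ioo a b) :
    IntervalIntegrable (fun t => K (x₀ - t) * f t) volume a x₀ ∧
      ContinuousAt (intervalConv a K f) x₀ := by
  obtain ⟨η, hη, h1, h2, h3⟩ : ∃ η, 0 < η ∧ a < x₀ - 2 * η ∧ x₀ + η < b ∧ η < b - a := by
    have := hx₀.1
    have := hx₀.2
    refine ⟨min (x₀ - a) (b - x₀) / 3, by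
      have : 0 < min (x₀ - a) (b - x₀) := lt_min (by linarith) (by linarith)
      positivity, ?_, ?_, ?_⟩
    · have := min_le_left (x₀ - a) (b - x₀); linarith
    · have := min_le_right (x₀ - a) (b - x₀); linarith
    · have := min_le_right (x₀ - a) (b - x₀); linarith
  set far : ℝ → 𝕜 := indicator (Ico η (b - a)) K with hfar
  have hsplit : ∀ u, cutKernel (b - a) K u = cutKernel η K u + far u := by
    intro u
    simp only [cutKernel, hfar, indicator, mem_Ioo, mem_Ico]
    by_cases h : 0 < u ∧ u < η
    · rw [if_pos ⟨h.1, by linarith [h.2]⟩, if_pos h, if_neg fun h' => by linarith [h.2, h'.1],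
        add_zero]
    · rw [if_neg h, zero_add]
      by_cases h' : η ≤ u ∧ u < b - a
      · rw [if_pos ⟨by linarith [h'.1], h'.2⟩, if_pos h']
      · rw [if_neg h', if_neg fun h'' => h' ⟨by
          by_contra hc; exact h ⟨h''.1, not_le.mp hc⟩, h''.2⟩]
  have hcont : ContinuousOn K (Icc η (b - a)) := hK.cont.mono fun u hu => lt_of_lt_of_le hη hu.1
  obtain ⟨C, hC⟩ := isCompact_Icc.exists_bound_of_continuousOn hcont
  have hCpos : 0 ≤ C := (norm_nonneg _).trans (hC η ⟨le_rfl, h3.le⟩)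
  have near := continuousAt_near_convolution (hK.integrable_cut hσ η) hη
    (fun u hu => indicator_of_notMem hu K) hf hfc h1 h2
  have farc := continuousAt_far_convolution (k := far) (C := C) (S := {η, b - a})
    (by
      rw [hfar]
      exact (aestronglyMeasurable_indicator_iff measurableSet_Ico).mpr
        ((hcont.mono Ico_subset_Icc_self).aestronglyMeasurable measurableSet_Ico))
    (fun u => by
      by_cases hu : u ∈ Ico η (b - a)
      · rw [hfar, indicator_of_mem hu]; exact hC u ⟨hu.1, hu.2.le⟩
      · rw [hfar, indicator_of_notMem hu, norm_zero]; exact hCpos)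
    (by simp) (fun u hu => by
      simp only [mem_insert_iff, mem_singleton_iff, not_or] at hu
      by_cases hmem : u ∈ Ioo η (b - a)
      · refine (hK.cont.continuousAt (Ioi_mem_nhds (hη.trans hmem.1))).congr ?_
        filter_upwards [isOpen_Ioo.mem_nhds hmem] with y hy
        rw [hfar, indicator_of_mem (Ioo_subset_Ico_self hy)]
      · refine (continuousAt_const (y := (0 : 𝕜))).congr ?_
        have hu' : u ∈ (Icc η (b - a))ᶜ := fun h =>
          hmem ⟨lt_of_le_of_ne h.1 (Ne.symm hu.1), lt_of_le_of_ne h.2 hu.2⟩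
        filter_upwards [isClosed_Icc.isOpen_compl.mem_nhds hu'] with y hy
        rw [hfar, indicator_of_notMem fun h => hy (Ico_subset_Icc_self h)]) hf x₀
  have hfari : ∀ x, Integrable fun u => far u * indicator (Ioo a b) f (x - u) := fun x => by
    have := (farc.1 x).comp_sub_left x
    simpa using this
  have hfar_eq : ∀ x, ∫ u, far u * indicator (Ioo a b) f (x - u) =
      ∫ t, far (x - t) * indicator (Ioo a b) f t := fun x => by
    have := integral_sub_left_eq_self (fun t => far (x - t) * indicator (Ioo a b) f t) volume x
    simpa using this
  have hex : ∀ᶠ x in 𝓝 x₀, Integrable fun u =>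
      cutKernel (b - a) K u * indicator (Ioo a b) f (x - u) := by
    filter_upwards [near.1] with x hx
    refine (hx.add (hfari x)).congr (Eventually.of_forall fun u => ?_)
    simp only [Pi.add_apply, hsplit, add_mul]
  constructor
  · exact (convolutionExistsAt_cut K f hx₀.1.le hx₀.2.le).mp hex.self_of_nhds
  · refine (near.2.add farc.2).congr ?_
    filter_upwards [near.1, isOpen_Ioo.mem_nhds hx₀] with x hx hxab
    rw [← convolution_cut K f hxab.1.le hxab.2.le, convolution]
    simp only [ContinuousLinearMap.mul_apply', Pi.add_apply]
    rw [← hfar_eq, ← integral_add hx (hfari x)]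
    simp only [hsplit, add_mul]

/-- The iterated convolution with an integrable continuous function converges absolutely at each
point of the open interval. -/
lemma IteratedConvExists.of_continuousOn (hσ₁ : 0 < σ₁) (hσ₂ : 0 < σ₂) (hK₁ : IsWeakKernel σ₁ K₁)
    (hK₂ : IsWeakKernel σ₂ K₂) (hf : IntegrableOn f (Ioo a b)) (hfc : ContinuousOn f (Ioo a b))
    {x : ℝ} (hx : x ∈ Ioo a b) : IteratedConvExists a b K₁ K₂ f x := by
  have hfn : IntegrableOn (fun t => ‖f t‖) (Ioo a b) := hf.norm
  have h := (hK₁.norm.continuousAt_intervalConv (f := intervalConv a (fun y => ‖K₂ y‖)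
    fun t => ‖f t‖) hσ₁ (hK₂.norm.integrableOn_intervalConv hσ₂ hfn) (fun y hy =>
      (hK₂.norm.continuousAt_intervalConv hσ₂ hfn hfc.norm hy).2.continuousWithinAt) hx).1
  have e : ∀ (K : ℝ → 𝕜) y, ‖cutKernel (b - a) K y‖ = cutKernel (b - a) (fun y => ‖K y‖) y :=
    fun K y => congrFun (norm_cutKernel _ K) y
  rw [IteratedConvExists, convolutionExistsAt_iff_integrable_swap]
  simp only [e, norm_indicator_eq_indicator_norm, ContinuousLinearMap.mul_apply']
  have e2 := cut_mul_convolution (a := a) (fun y => ‖K₁ y‖) (fun y => ‖K₂ y‖) (fun t => ‖f t‖)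
    hx.2.le
  refine Eq.mpr (congrArg (Integrable · volume) e2) ?_
  rw [integrable_indicator_iff measurableSet_Ioo,
    ← intervalIntegrable_iff_integrableOn_Ioo_of_le hx.1.le]
  exact h

lemma intervalConv_congr {f' K' : ℝ → 𝕜} {x : ℝ} (hax : a ≤ x) (hK : ∀ y, 0 < y → K y = K' y)
    (hf : ∀ᵐ t ∂(volume.restrict (Ioo a x)), f t = f' t) :
    intervalConv a K f x = intervalConv a K' f' x := by
  rw [intervalConv, intervalConv, intervalIntegral.integral_of_le hax,
    intervalIntegral.integral_of_le hax, integral_Ioc_eq_integral_Ioo, integral_Ioc_eq_integral_Ioo]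
  refine integral_congr_ae ?_
  filter_upwards [hf, ae_restrict_mem measurableSet_Ioo] with t h1 h2
  rw [h1, hK _ (sub_pos.mpr h2.2)]

end

/-! ### Riemann-Liouville integrals as convolutions -/

/-- The kernel `y ^ (γ - 1) / Γ(γ)` of the Riemann-Liouville integral of order `γ > 0`. -/
def rlKernel (γ y : ℝ) : ℂ := ((Real.Gamma γ : ℝ) : ℂ)⁻¹ * ((y ^ (γ - 1) : ℝ) : ℂ)

lemma isWeakKernel_rlKernel (γ : ℝ) : IsWeakKernel γ (rlKernel γ) where
  cont := continuousOn_const.mul (Complex.continuous_ofReal.comp_continuousOn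
    (continuousOn_id.rpow_const fun y hy => Or.inl (ne_of_gt hy)))
  bound T := ⟨‖((Real.Gamma γ : ℝ) : ℂ)⁻¹‖, fun y hy _ => by
    rw [rlKernel, norm_mul, Complex.norm_real, Real.norm_of_nonneg (Real.rpow_nonneg hy.le _)]⟩

lemma rlKernel_one (y : ℝ) : rlKernel 1 y = 1 := by simp [rlKernel]

lemma rlIntegral_eq_intervalConv {γ : ℝ} (hγ : γ ≠ 0) (a : ℝ) (f : ℝ → ℂ) (x : ℝ) :
    rlIntegral γ a f x = intervalConv a (rlKernel γ) f x := by
  rw [rlIntegral, if_neg hγ, intervalConv, ← intervalIntegral.integral_const_mul]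
  simp only [rlKernel, mul_assoc]

lemma intervalConv_rlKernel_one (a : ℝ) (f : ℝ → ℂ) (x : ℝ) :
    intervalConv a (rlKernel 1) f x = ∫ t in a..x, f t := by
  simp [intervalConv, rlKernel_one]

lemma rlConverges_iff {γ : ℝ} (hγ : 0 < γ) (a : ℝ) (f : ℝ → ℂ) (x : ℝ) :
    RLConverges γ a f x ↔ IntervalIntegrable (fun t => rlKernel γ (x - t) * f t) volume a x := by
  have hG : ((Real.Gamma γ : ℝ) : ℂ) ≠ 0 := by exact_mod_cast (Real.Gamma_pos_of_pos hγ).ne'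
  constructor
  · intro h
    have := (h hγ.ne').const_mul ((Real.Gamma γ : ℝ) : ℂ)⁻¹
    simpa only [rlKernel, mul_assoc] using this
  · intro h _
    have := h.const_mul ((Real.Gamma γ : ℝ) : ℂ)
    simpa only [rlKernel, mul_assoc, mul_inv_cancel_left₀ hG] using this

/-! ### Superpositions of powers -/

section

variable {X : Type*} [MeasurableSpace X] {ν : Measure X} {g e : X → ℂ} {s₀ s₁ : ℝ}

/-- The superposition `∫ g(τ) y ^ (e(τ) - 1) dν(τ)` of powers of `y`. -/
def powerMix (ν : Measure X) (g e : X → ℂ) (y : ℝ) : ℂ := ∫ τ, g τ * (y : ℂ) ^ (e τ - 1) ∂ν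

/-- The weight `g` is integrable and the exponents `e` have real parts in `[s₀, s₁]`. -/
structure IsMixData (ν : Measure X) (g e : X → ℂ) (s₀ s₁ : ℝ) : Prop where
  integrable : Integrable g ν
  measurable : Measurable e
  re_mem : ∀ᵐ τ ∂ν, (e τ).re ∈ Icc s₀ s₁

lemma rpow_sub_one_le {y T r : ℝ} (hy : 0 < y) (hyT : y ≤ T) (hr : r ∈ Icc s₀ s₁) :
    y ^ (r - 1) ≤ max 1 T ^ (s₁ - s₀) * y ^ (s₀ - 1) := by
  have h1 : (1 : ℝ) ≤ max 1 T := le_max_left _ _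
  calc y ^ (r - 1) = y ^ (r - s₀) * y ^ (s₀ - 1) := by rw [← Real.rpow_add hy]; congr 1; ring
    _ ≤ max 1 T ^ (s₁ - s₀) * y ^ (s₀ - 1) := by
      refine mul_le_mul_of_nonneg_right ?_ (Real.rpow_nonneg hy.le _)
      refine (Real.rpow_le_rpow hy.le (hyT.trans (le_max_right 1 T)) (by linarith [hr.1])).trans ?_
      exact Real.rpow_le_rpow_of_exponent_le h1 (by linarith [hr.2])

namespace IsMixData

lemma norm_le (h : IsMixData ν g e s₀ s₁) {T : ℝ} :
    ∀ᵐ τ ∂ν, ∀ y : ℝ, 0 < y → y ≤ T → ‖g τ * (y : ℂ) ^ (e τ - 1)‖ ≤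
      ‖g τ‖ * (max 1 T ^ (s₁ - s₀) * y ^ (s₀ - 1)) := by
  filter_upwards [h.re_mem] with τ hτ y hy hyT
  rw [norm_mul, Complex.norm_cpow_eq_rpow_re_of_pos hy]
  refine mul_le_mul_of_nonneg_left ?_ (norm_nonneg _)
  simpa using rpow_sub_one_le hy hyT hτ

lemma aestronglyMeasurable (h : IsMixData ν g e s₀ s₁) (y : ℝ) :
    AEStronglyMeasurable (fun τ => g τ * (y : ℂ) ^ (e τ - 1)) ν :=
  h.integrable.aestronglyMeasurable.mul
    (measurable_const.pow (h.measurable.sub_const 1)).aestronglyMeasurable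

lemma isWeakKernel (h : IsMixData ν g e s₀ s₁) : IsWeakKernel s₀ (powerMix ν g e) where
  cont := by
    intro y hy
    have hy : 0 < y := hy
    refine ContinuousAt.continuousWithinAt ?_
    obtain ⟨M, hM⟩ : ∃ M, ∀ᶠ z in 𝓝 y, max 1 (2 * y) ^ (s₁ - s₀) * z ^ (s₀ - 1) ≤ M := by
      have hc : ContinuousAt (fun z : ℝ => max 1 (2 * y) ^ (s₁ - s₀) * z ^ (s₀ - 1)) y :=
        continuousAt_const.mul (ContinuousAt.rpow_const (by fun_prop) (Or.inl hy.ne'))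
      exact ⟨_, (hc.eventually_lt_const (lt_add_one _)).mono fun z hz => hz.le⟩
    refine continuousAt_of_dominated (bound := fun τ => ‖g τ‖ * M)
      (Eventually.of_forall h.aestronglyMeasurable) ?_ (h.integrable.norm.mul_const M) ?_
    · filter_upwards [hM, Ioo_mem_nhds hy (show y < 2 * y by linarith)] with z hz hz2
      filter_upwards [h.norm_le (T := 2 * y)] with τ hτ
      exact (hτ z hz2.1 hz2.2.le).trans (mul_le_mul_of_nonneg_left hz (norm_nonneg _))
    · refine Eventually.of_forall fun τ => continuousAt_const.mul ?_
      exact ContinuousAt.cpow (by fun_prop) continuousAt_const (Or.inl (by simpa using hy))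
  bound T := by
    refine ⟨(∫ τ, ‖g τ‖ ∂ν) * max 1 T ^ (s₁ - s₀), fun y hy hyT => ?_⟩
    refine (norm_integral_le_of_norm_le (h.integrable.norm.mul_const _)
      (h.norm_le.mono fun τ hτ => hτ y hy hyT)).trans (le_of_eq ?_)
    rw [integral_mul_const, mul_assoc]

/-- The Riemann-Liouville integral of a superposition of powers is computed under the integral
sign. -/
lemma intervalConv_rlKernel [SFinite ν] (h : IsMixData ν g e s₀ s₁) (hs₀ : 0 < s₀) {γ : ℝ}
    (hγ : 0 < γ) {y : ℝ} (hy : 0 < y) :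
    intervalConv 0 (rlKernel γ) (powerMix ν g e) y =
      powerMix ν (fun τ => g τ * (Complex.Gamma (e τ) / Complex.Gamma (e τ + γ)))
        (fun τ => e τ + γ) y := by
  have hG : ((Real.Gamma γ : ℝ) : ℂ) ≠ 0 := by exact_mod_cast (Real.Gamma_pos_of_pos hγ).ne'
  set F : ℝ → X → ℂ := fun t τ => rlKernel γ (y - t) * (g τ * (t : ℂ) ^ (e τ - 1))
  have hF : Integrable (Function.uncurry F) ((volume.restrict (Ioo 0 y)).prod ν) := by
    have hb : Integrable (fun z : ℝ × X => (max 1 y ^ (s₁ - s₀) * |(Real.Gamma γ)⁻¹| *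
        (z.1 ^ (s₀ - 1) * (y - z.1) ^ (γ - 1))) * ‖g z.2‖) ((volume.restrict (Ioo 0 y)).prod ν) :=
      ((integrableOn_rpow_mul_rpow hs₀ hγ hy).const_mul _).mul_prod h.integrable.norm
    refine hb.mono' ?_ ?_
    · refine AEStronglyMeasurable.mul ?_ (AEStronglyMeasurable.mul ?_ ?_)
      · refine Measurable.aestronglyMeasurable ?_
        unfold rlKernel
        fun_prop
      · exact h.integrable.aestronglyMeasurable.comp_snd
      · exact (Measurable.pow (Complex.measurable_ofReal.comp measurable_fst)
          ((h.measurable.comp measurable_snd).sub_const 1)).aestronglyMeasurable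
    · have a1 := (Measure.quasiMeasurePreserving_snd (μ := volume.restrict (Ioo 0 y)) (ν := ν)).ae
        (h.norm_le (T := y))
      have a2 := (Measure.quasiMeasurePreserving_fst (μ := volume.restrict (Ioo 0 y)) (ν := ν)).ae
        (ae_restrict_mem measurableSet_Ioo)
      filter_upwards [a1, a2] with z h1 h2
      have h3 := Real.rpow_nonneg (sub_pos.mpr h2.2).le (γ - 1)
      simp only [Function.uncurry, F, norm_mul (rlKernel _ _)]
      refine (mul_le_mul_of_nonneg_left (h1 z.1 h2.1 h2.2.le) (norm_nonneg _)).trans (le_of_eq ?_)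
      rw [rlKernel, norm_mul, norm_inv, Complex.norm_real, Complex.norm_real,
        Real.norm_of_nonneg h3, Real.norm_eq_abs, abs_inv]
      ring
  have step : intervalConv 0 (rlKernel γ) (powerMix ν g e) y =
      ∫ t in Ioo 0 y, ∫ τ, F t τ ∂ν := by
    rw [intervalConv, intervalIntegral.integral_of_le hy.le, integral_Ioc_eq_integral_Ioo]
    simp only [powerMix, F, integral_const_mul]
  rw [step, integral_integral_swap hF, powerMix]
  refine integral_congr_ae ?_
  filter_upwards [h.re_mem] with τ hτ
  have he : 0 < (e τ).re := hs₀.trans_le hτ.1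
  have hb := Complex.betaIntegral_scaled (e τ) γ hy
  rw [Complex.betaIntegral_eq_Gamma_mul_div _ _ he (by simpa), Complex.Gamma_ofReal,
    intervalIntegral.integral_of_le hy.le, integral_Ioc_eq_integral_Ioo] at hb
  have hFe : ∀ t ∈ Ioo 0 y, F t τ = ((Real.Gamma γ : ℝ) : ℂ)⁻¹ * g τ *
      ((t : ℂ) ^ (e τ - 1) * ((y : ℂ) - t) ^ ((γ : ℂ) - 1)) := by
    intro t ht
    simp only [F, rlKernel]
    rw [Complex.ofReal_cpow (sub_pos.mpr ht.2).le]
    push_cast; ring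
  rw [setIntegral_congr_fun measurableSet_Ioo hFe, integral_const_mul, hb]
  field_simp

end IsMixData

end

/-! ### Contour integrals as integrals over a measure -/

namespace MBContour

variable (L : MBContour)

lemma isClosed_support : IsClosed L.support := by
  have h1 : {z | ∃ t : ℝ, t ≤ 0 ∧ z = L.vert 0 + t * Complex.I} =
      {z | z.re = (L.vert 0).re} ∩ {z | z.im ≤ (L.vert 0).im} := by
    ext z
    constructor
    · rintro ⟨t, ht, rfl⟩; simpa
    · rintro ⟨h, h'⟩
      refine ⟨z.im - (L.vert 0).im, by simpa using h', Complex.ext (by simpa using h) (by simp)⟩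
  have h2 : {z | ∃ t : ℝ, 0 ≤ t ∧ z = L.vert L.N + t * Complex.I} =
      {z | z.re = (L.vert L.N).re} ∩ {z | (L.vert L.N).im ≤ z.im} := by
    ext z
    constructor
    · rintro ⟨t, ht, rfl⟩; simpa
    · rintro ⟨h, h'⟩
      refine ⟨z.im - (L.vert L.N).im, by simpa using h', Complex.ext (by simpa using h) (by simp)⟩
  rw [support, h1, h2]
  refine (((isClosed_eq Complex.continuous_re continuous_const).inter
    (isClosed_le Complex.continuous_im continuous_const)).union ?_).union
    ((isClosed_eq Complex.continuous_re continuous_const).inter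
    (isClosed_le continuous_const Complex.continuous_im))
  refine isClosed_biUnion_finset fun k _ => ?_
  rw [segment_eq_image]
  exact (isCompact_Icc.image (by fun_prop)).isClosed

lemma exists_re_le : ∃ c : ℝ, ∀ z ∈ L.support, z.re ≤ c := by
  have h : BddAbove (Complex.re '' L.truncSupport 0) :=
    ((L.isCompact_truncSupport 0).image Complex.continuous_re).bddAbove
  obtain ⟨c, hc⟩ := h
  refine ⟨c, ?_⟩
  rintro z ((⟨t, ht, rfl⟩ | hz) | ⟨t, ht, rfl⟩)
  · exact hc ⟨L.vert 0, Or.inl (Or.inl ⟨0, by simp, by simp⟩), by simp⟩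
  · exact hc ⟨z, Or.inl (Or.inr hz), rfl⟩
  · exact hc ⟨L.vert L.N, Or.inr ⟨0, by simp, by simp⟩, by simp⟩

/-- The parametrization measure of the contour, on pairs of a point and a velocity vector:
`∫_L f(ξ) dξ` is the integral of `f(p.1) * p.2` against it. -/
def pathMeasure : Measure (ℂ × ℂ) :=
  (volume.restrict (Iic (0 : ℝ))).map (fun t : ℝ => (L.vert 0 + t * Complex.I, Complex.I)) +
  ∑ k ∈ Finset.range L.N, (volume.restrict (Ioc (0 : ℝ) 1)).map (fun s : ℝ =>
    (L.vert k + s * (L.vert (k + 1) - L.vert k), L.vert (k + 1) - L.vert k)) +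
  (volume.restrict (Ioi (0 : ℝ))).map (fun t : ℝ => (L.vert L.N + t * Complex.I, Complex.I))

instance : SFinite L.pathMeasure := by
  have : SFinite (∑ k ∈ Finset.range L.N, (volume.restrict (Ioc (0 : ℝ) 1)).map (fun s : ℝ =>
      (L.vert k + s * (L.vert (k + 1) - L.vert k), L.vert (k + 1) - L.vert k))) :=
    Finset.sum_induction _ SFinite (fun _ _ _ _ => inferInstance) inferInstance
      fun _ _ => inferInstance
  unfold pathMeasure
  infer_instance

lemma measurable_affine (u v : ℂ) : Measurable fun t : ℝ => (u + t * v, v) := by fun_prop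

lemma mem_segment_of_Ioc (k : ℕ) {s : ℝ} (hs : s ∈ Ioc (0 : ℝ) 1) :
    L.vert k + s * (L.vert (k + 1) - L.vert k) ∈ segment ℝ (L.vert k) (L.vert (k + 1)) := by
  rw [segment_eq_image']
  exact ⟨s, ⟨hs.1.le, hs.2⟩, by simp⟩

lemma ae_mem_support : ∀ᵐ z ∂L.pathMeasure, z.1 ∈ L.support := by
  have hm : MeasurableSet {z : ℂ × ℂ | z.1 ∈ L.support} :=
    measurable_fst L.isClosed_support.measurableSet
  rw [pathMeasure, ae_add_measure_iff, ae_add_measure_iff]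
  refine ⟨⟨?_, ?_⟩, ?_⟩
  · rw [ae_map_iff (measurable_affine _ _).aemeasurable hm]
    filter_upwards [ae_restrict_mem measurableSet_Iic] with t ht using L.lowerRay_mem_support ht
  · refine ae_finsetSum_measure_iff.mpr fun k hk => ?_
    rw [ae_map_iff (measurable_affine _ _).aemeasurable hm]
    filter_upwards [ae_restrict_mem measurableSet_Ioc] with t ht using
      L.segment_subset_support (Finset.mem_range.mp hk) (L.mem_segment_of_Ioc k ht)
  · rw [ae_map_iff (measurable_affine _ _).aemeasurable hm]
    filter_upwards [ae_restrict_mem measurableSet_Ioi] with t ht using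
      L.upperRay_mem_support (le_of_lt ht)

variable {L} {f : ℂ → ℂ} {ω : ℝ}

/-- An exponentially decaying integrand is absolutely integrable over the contour, and the contour
integral is the integral against the parametrization measure. -/
lemma integrable_pathMeasure_and_integral_eq (hω : 0 < ω) (hf : HasDecay ω f)
    (hc : ContinuousOn f L.support) (hm : Measurable f) :
    Integrable (fun z => f z.1 * z.2) L.pathMeasure ∧
      L.integral f = ∫ z, f z.1 * z.2 ∂L.pathMeasure := by
  have hM : Measurable fun z : ℂ × ℂ => f z.1 * z.2 :=
    (hm.comp measurable_fst).mul measurable_snd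
  have i1 : Integrable (fun z => f z.1 * z.2) ((volume.restrict (Iic (0 : ℝ))).map
      (fun t : ℝ => (L.vert 0 + t * Complex.I, Complex.I))) :=
    (integrable_map_measure hM.aestronglyMeasurable (measurable_affine _ _).aemeasurable).mpr
      (L.integrableOn_lowerRay hω hf hc)
  have i3 : Integrable (fun z => f z.1 * z.2) ((volume.restrict (Ioi (0 : ℝ))).map
      (fun t : ℝ => (L.vert L.N + t * Complex.I, Complex.I))) :=
    (integrable_map_measure hM.aestronglyMeasurable (measurable_affine _ _).aemeasurable).mpr
      (L.integrableOn_upperRay hω hf hc)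
  have i2 : ∀ k ∈ Finset.range L.N, Integrable (fun z => f z.1 * z.2)
      ((volume.restrict (Ioc (0 : ℝ) 1)).map (fun s : ℝ =>
      (L.vert k + s * (L.vert (k + 1) - L.vert k), L.vert (k + 1) - L.vert k))) := by
    intro k hk
    refine (integrable_map_measure hM.aestronglyMeasurable
      (measurable_affine _ _).aemeasurable).mpr ?_
    have hcont : ContinuousOn (fun s : ℝ => f (L.vert k + s * (L.vert (k + 1) - L.vert k)) *
        (L.vert (k + 1) - L.vert k)) (Icc 0 1) := by
      refine ContinuousOn.mul (hc.comp (by fun_prop) fun s hs => ?_) continuousOn_const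
      refine L.segment_subset_support (Finset.mem_range.mp hk) ?_
      rw [segment_eq_image']
      exact ⟨s, hs, by simp⟩
    exact (hcont.integrableOn_Icc).mono_set Ioc_subset_Icc_self
  have i2' := integrable_finsetSum_measure.mpr i2
  refine ⟨(i1.add_measure i2').add_measure i3, ?_⟩
  rw [pathMeasure, integral_add_measure (i1.add_measure i2') i3, integral_add_measure i1 i2',
    integral_finsetSum_measure i2, integral_map (measurable_affine _ _).aemeasurable
      hM.aestronglyMeasurable, integral_map (measurable_affine _ _).aemeasurable
      hM.aestronglyMeasurable, integral, polyIntegral]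
  congr 2
  refine Finset.sum_congr rfl fun k _ => ?_
  rw [integral_map (measurable_affine _ _).aemeasurable hM.aestronglyMeasurable,
    intervalIntegral.integral_of_le zero_le_one]

end MBContour

/-- `Γ` is the inverse of the entire function `1 / Γ`, with the value `0` at the poles. -/
lemma measurable_Gamma : Measurable Complex.Gamma := by
  have h := Complex.differentiable_one_div_Gamma.continuous.measurable.inv
  have e : (fun s => (Complex.Gamma s)⁻¹)⁻¹ = Complex.Gamma := by funext s; simp
  rwa [e] at h

lemma FoxParams.measurable_kernel {p q m n : ℕ} (P : FoxParams p q) : Measurable (P.kernel m n) := by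
  unfold FoxParams.kernel
  refine Measurable.div (Measurable.mul ?_ ?_) (Measurable.mul ?_ ?_) <;>
  · refine Finset.measurable_fun_prod _ fun j _ => ?_
    split_ifs
    all_goals first
      | exact measurable_const
      | exact measurable_Gamma.comp (by fun_prop)

/-! ### The kernels of the operators as superpositions of powers -/

namespace FoxParams

variable {p q m n : ℕ} (P : FoxParams p q) {L : MBContour} {w β : ℂ} {α : ℝ}

lemma mul_ofReal_cpow {w ξ : ℂ} (hw : w ≠ 0) {r : ℝ} (hr : 0 < r) :
    (w * (r : ℂ)) ^ ξ = w ^ ξ * (r : ℂ) ^ ξ := by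
  have hrc : (r : ℂ) ≠ 0 := by exact_mod_cast hr.ne'
  rw [Complex.cpow_def_of_ne_zero (mul_ne_zero hw hrc), Complex.cpow_def_of_ne_zero hw,
    Complex.cpow_def_of_ne_zero hrc, Complex.log_mul_ofReal r hr w hw, Complex.ofReal_log hr.le,
    ← Complex.exp_add]
  ring_nf

lemma notMem_support (hL : P.Separates m n L) :
    ∀ s ∈ P.leftPoles n ∪ P.rightPoles m, s ∉ L.support := by
  rintro s (hs | hs)
  · exact (hL.1 s hs).1
  · exact (hL.2 s hs).1

lemma continuousOn_kernel (hA : ∀ j, 0 < P.A j) (hB : ∀ j, 0 < P.B j) (hL : P.Separates m n L) :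
    ContinuousOn (P.kernel m n) L.support := by
  refine continuousOn_of_locally_continuousOn fun x hx => ⟨Metric.ball 0 (‖x‖ + 1),
    Metric.isOpen_ball, by simp, ?_⟩
  exact (P.kernel_polarOn hA hB (‖x‖ + 1)).continuousOn inter_subset_right
    fun z hz hzZ => P.notMem_support hL z hzZ hz.1

/-- Fox's `H`-function is computed by any separating contour. -/
lemma foxH_eq (hA : ∀ j, 0 < P.A j) (hB : ∀ j, 0 < P.B j) (hL : P.Separates m n L) (hw : w ≠ 0)
    (harg : |w.arg| < Real.pi * P.omega m n / 2) :
    P.foxH m n w =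
      (2 * Real.pi * Complex.I)⁻¹ * L.integral (fun ξ => P.kernel m n ξ * w ^ ξ) := by
  have hex : ∃ L : MBContour, P.Separates m n L := ⟨L, hL⟩
  rw [foxH, dif_pos hex]
  congr 1
  obtain ⟨Y, hY⟩ := P.exists_im_bound (m := m) (n := n)
  refine MBContour.integral_eq_of_same_sides _ _ (Z := P.leftPoles n ∪ P.rightPoles m) (Y := Y)
    (fun r => (P.kernel_polarOn hA hB r).mul (PolarOn.of_differentiable ?_)) hY
    (ω := Real.pi / 2 * P.omega m n + -|w.arg|) (by linarith)
    ((P.kernel_hasDecay hA hB).mul (hasDecay_const_cpow w hw)) ?_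
  · exact differentiable_id.const_cpow (Or.inl hw)
  · rintro s (hs | hs)
    · exact Or.inl ⟨hex.choose_spec.1 s hs, hL.1 s hs⟩
    · exact Or.inr ⟨hex.choose_spec.2 s hs, hL.2 s hs⟩

/-- The kernel `y ^ (ρ - 1) H[w y ^ α]` is a superposition of powers, with a weight that only
matters on the contour. -/
lemma cpow_mul_foxH_eq_powerMix (hA : ∀ j, 0 < P.A j) (hB : ∀ j, 0 < P.B j)
    (hL : P.Separates m n L) (hw : w ≠ 0) (harg : |w.arg| < Real.pi * P.omega m n / 2) (ρ : ℂ)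
    {g : ℂ → ℂ} (hg : ∀ ξ ∈ L.support, g ξ = (2 * Real.pi * Complex.I)⁻¹ * (P.kernel m n ξ * w ^ ξ))
    {y : ℝ} (hy : 0 < y) :
    (y : ℂ) ^ (ρ - 1) * P.foxH m n (w * ((y ^ α : ℝ) : ℂ)) =
      powerMix L.pathMeasure (fun z => g z.1 * z.2) (fun z => ρ + α * z.1) y := by
  have hyα : 0 < y ^ α := Real.rpow_pos_of_pos hy _
  have hyc : (y : ℂ) ≠ 0 := by exact_mod_cast hy.ne'
  have hw' : w * ((y ^ α : ℝ) : ℂ) ≠ 0 := mul_ne_zero hw (by exact_mod_cast hyα.ne')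
  have harg' : (w * ((y ^ α : ℝ) : ℂ)).arg = w.arg := by
    rw [mul_comm]; exact Complex.arg_real_mul w hyα
  rw [P.foxH_eq hA hB hL hw' (by rwa [harg'])]
  have hd := (P.kernel_hasDecay (m := m) (n := n) hA hB).mul (hasDecay_const_cpow _ hw')
  rw [harg'] at hd
  have hint := (MBContour.integrable_pathMeasure_and_integral_eq (L := L) (by linarith) hd
    ((P.continuousOn_kernel hA hB hL).mul
      (differentiable_id.const_cpow (Or.inl hw')).continuous.continuousOn)
    (P.measurable_kernel.mul
      (differentiable_id.const_cpow (Or.inl hw')).continuous.measurable)).2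
  rw [hint, ← mul_assoc, ← integral_const_mul, powerMix]
  refine integral_congr_ae ?_
  filter_upwards [L.ae_mem_support] with z hz
  rw [hg _ hz, mul_ofReal_cpow hw hyα]
  have e1 : ((y ^ α : ℝ) : ℂ) ^ z.1 = (y : ℂ) ^ ((α : ℂ) * z.1) := by
    rw [Complex.cpow_mul_ofReal_nonneg hy.le]
  have e2 : (y : ℂ) ^ (ρ + α * z.1 - 1) = (y : ℂ) ^ (ρ - 1) * (y : ℂ) ^ ((α : ℂ) * z.1) := by
    rw [← Complex.cpow_add _ _ hyc]; congr 1; ring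
  rw [e1, e2]
  ring

/-- The weight `(2πi)⁻¹ kernel(ξ) w ^ ξ Γ(β + αξ) / Γ(β + σ + αξ)`. -/
def fracWeight (m n : ℕ) (w : ℂ) (α : ℝ) (β : ℂ) (σ : ℝ) (ξ : ℂ) : ℂ :=
  (2 * Real.pi * Complex.I)⁻¹ * (P.kernel m n ξ * w ^ ξ) * Complex.Gamma (β + α * ξ) *
    (Complex.Gamma (β + σ + α * ξ))⁻¹

/-- The kernel `(2πi)⁻¹ ∫_L kernel(ξ) w ^ ξ (Γ(β + αξ) / Γ(β + σ + αξ)) y ^ (β + σ + αξ - 1) dξ`.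
For `σ = 0` this is `y ^ (β - 1) H[w y ^ α]`; the other orders `σ` arise from it by fractional
integration and differentiation. -/
def fracKernel (m n : ℕ) (L : MBContour) (w : ℂ) (α : ℝ) (β : ℂ) (σ : ℝ) : ℝ → ℂ :=
  powerMix L.pathMeasure (fun z => P.fracWeight m n w α β σ z.1 * z.2)
    (fun z => β + σ + α * z.1)

/-- The Gamma factors `Γ(β + αξ) / Γ(β + σ + αξ)` leave the rate of decay unchanged, and
`Re (β + αξ) > 0` on the contour keeps it off the poles of the first. -/
lemma exists_isMixData (hA : ∀ j, 0 < P.A j) (hB : ∀ j, 0 < P.B j)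
    (hL : P.Separates m n L) (hw : w ≠ 0) (harg : |w.arg| < Real.pi * P.omega m n / 2)
    (hα : 0 < α) {c : ℝ} (hc : ∀ z ∈ L.support, c ≤ z.re) (hβ : 0 < β.re + α * c) (σ : ℝ) :
    ∃ s, IsMixData L.pathMeasure (fun z => P.fracWeight m n w α β σ z.1 * z.2)
      (fun z => β + σ + α * z.1) (β.re + α * c + σ) s := by
  obtain ⟨c', hc'⟩ := L.exists_re_le
  refine ⟨β.re + α * c' + σ, ?_, by fun_prop, ?_⟩
  · have hd := (((HasDecay.const (2 * Real.pi * Complex.I)⁻¹).mul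
      ((P.kernel_hasDecay (m := m) (n := n) hA hB).mul (hasDecay_const_cpow w hw))).mul
      (hasDecay_Gamma_affine β hα)).mul (hasDecay_inv_Gamma_affine (β + σ) hα)
    refine (MBContour.integrable_pathMeasure_and_integral_eq (L := L) ?_ hd ?_ ?_).1
    · linarith
    · refine ((continuousOn_const.mul ((P.continuousOn_kernel hA hB hL).mul
        (differentiable_id.const_cpow (Or.inl hw)).continuous.continuousOn)).mul ?_).mul
        (Complex.differentiable_one_div_Gamma.continuous.comp (by fun_prop)).continuousOn
      intro z hz
      have hre : 0 < (β + α * z).re := by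
        have := mul_le_mul_of_nonneg_left (hc z hz) hα.le
        simp only [Complex.add_re, Complex.re_ofReal_mul]
        linarith
      refine (ContinuousAt.comp (f := fun z : ℂ => β + α * z)
        (Complex.differentiableAt_Gamma _ fun k h => ?_).continuousAt
          (by fun_prop)).continuousWithinAt
      rw [h] at hre
      simp only [Complex.neg_re, Complex.natCast_re] at hre
      linarith [Nat.cast_nonneg (α := ℝ) k]
    · exact ((measurable_const.mul (P.measurable_kernel.mul
        (differentiable_id.const_cpow (Or.inl hw)).continuous.measurable)).mul
        (measurable_Gamma.comp (by fun_prop))).mul (measurable_Gamma.comp (by fun_prop)).inv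
  · filter_upwards [L.ae_mem_support] with z hz
    have h1 := mul_le_mul_of_nonneg_left (hc _ hz) hα.le
    have h2 := mul_le_mul_of_nonneg_left (hc' _ hz) hα.le
    simp only [Complex.add_re, Complex.re_ofReal_mul, Complex.ofReal_re]
    exact ⟨by linarith, by linarith⟩

lemma isWeakKernel_fracKernel (hA : ∀ j, 0 < P.A j) (hB : ∀ j, 0 < P.B j)
    (hL : P.Separates m n L) (hw : w ≠ 0) (harg : |w.arg| < Real.pi * P.omega m n / 2)
    (hα : 0 < α) {c : ℝ} (hc : ∀ z ∈ L.support, c ≤ z.re) (hβ : 0 < β.re + α * c) (σ : ℝ) :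
    IsWeakKernel (β.re + α * c + σ) (P.fracKernel m n L w α β σ) := by
  obtain ⟨s, h⟩ := P.exists_isMixData hA hB hL hw harg hα hc hβ σ
  exact h.isWeakKernel

/-- Fractional integration of order `γ` raises the order of the kernel by `γ`. -/
lemma intervalConv_fracKernel (hA : ∀ j, 0 < P.A j) (hB : ∀ j, 0 < P.B j)
    (hL : P.Separates m n L) (hw : w ≠ 0) (harg : |w.arg| < Real.pi * P.omega m n / 2)
    (hα : 0 < α) {c : ℝ} (hc : ∀ z ∈ L.support, c ≤ z.re) (hβ : 0 < β.re + α * c) {σ γ : ℝ}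
    (hσ : 0 < β.re + α * c + σ) (hγ : 0 < γ) {y : ℝ} (hy : 0 < y) :
    intervalConv 0 (rlKernel γ) (P.fracKernel m n L w α β σ) y =
      P.fracKernel m n L w α β (σ + γ) y := by
  obtain ⟨s, h⟩ := P.exists_isMixData hA hB hL hw harg hα hc hβ σ
  rw [fracKernel, h.intervalConv_rlKernel hσ hγ hy, fracKernel, powerMix, powerMix]
  refine integral_congr_ae ?_
  filter_upwards [h.re_mem] with z hz
  have h0 := Complex.Gamma_ne_zero_of_re_pos (hσ.trans_le hz.1)
  have e : β + ((σ + γ : ℝ) : ℂ) + α * z.1 = β + σ + α * z.1 + γ := by push_cast; ring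
  simp only [fracWeight, e]
  field_simp

/-- The kernel of the operator has order `σ = 0`. -/
lemma cpow_mul_foxH_eq_fracKernel (hA : ∀ j, 0 < P.A j) (hB : ∀ j, 0 < P.B j)
    (hL : P.Separates m n L) (hw : w ≠ 0) (harg : |w.arg| < Real.pi * P.omega m n / 2)
    (hα : 0 < α) {c : ℝ} (hc : ∀ z ∈ L.support, c ≤ z.re) (hβ : 0 < β.re + α * c)
    {y : ℝ} (hy : 0 < y) :
    (y : ℂ) ^ (β - 1) * P.foxH m n (w * ((y ^ α : ℝ) : ℂ)) = P.fracKernel m n L w α β 0 y := by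
  rw [P.cpow_mul_foxH_eq_powerMix (g := P.fracWeight m n w α β 0) hA hB hL hw harg β ?_ hy,
    fracKernel]
  · simp
  · intro ξ hξ
    have hre : 0 < (β + α * ξ).re := by
      have := mul_le_mul_of_nonneg_left (hc ξ hξ) hα.le
      simp only [Complex.add_re, Complex.re_ofReal_mul]
      linarith
    rw [fracWeight, Complex.ofReal_zero, add_zero, mul_assoc,
      mul_inv_cancel₀ (Complex.Gamma_ne_zero_of_re_pos hre), mul_one]

/-! ### The extended parameter lists -/

section Extension

variable (α : ℝ) (β : ℂ) (μ ν : ℝ)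

lemma hilferExt_A_pos (hA : ∀ j, 0 < P.A j) (hα : 0 < α) (j) :
    0 < (P.hilferExt α β μ ν).A j := by
  refine Fin.cases hα (fun j => Fin.cases hα (fun j => Fin.cases hα (fun j => hA j) j) j) j

lemma hilferExt_B_pos (hB : ∀ j, 0 < P.B j) (hα : 0 < α) (j) :
    0 < (P.hilferExt α β μ ν).B j := by
  refine Fin.addCases (fun j => ?_) (fun j => ?_) j
  · simpa [hilferExt] using hB j
  · fin_cases j <;> simpa [hilferExt] using hα

/-- The three `α` in the upper row and the three in the lower row cancel. -/
lemma hilferExt_omega (hm : m ≤ q) :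
    (P.hilferExt α β μ ν).omega m (n + 3) = P.omega m n := by
  have h : ∀ i : Fin 3, ¬ q + (i : ℕ) < m := fun i => by omega
  simp only [omega, hilferExt, Fin.sum_univ_succ (n := p + 2), Fin.sum_univ_succ (n := p + 1),
    Fin.sum_univ_succ (n := p), Fin.sum_univ_add, Fin.sum_univ_three, Matrix.cons_val_zero,
    Matrix.cons_val_succ, Fin.val_zero, Fin.val_succ, Fin.append_left, Fin.append_right,
    Fin.val_castAdd, Fin.val_natAdd, h, if_false]
  simp
  ring

lemma hilferExt_rightPoles (hm : m ≤ q) :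
    (P.hilferExt α β μ ν).rightPoles m = P.rightPoles m := by
  ext s
  constructor
  · rintro ⟨j, hj, k, rfl⟩
    obtain ⟨i, rfl⟩ : ∃ i, j = Fin.castAdd 3 i := ⟨⟨j, by omega⟩, rfl⟩
    exact ⟨i, hj, k, by simp [hilferExt]⟩
  · rintro ⟨j, hj, k, rfl⟩
    exact ⟨Fin.castAdd 3 j, hj, k, by simp [hilferExt]⟩

lemma leftPoles_subset_hilferExt :
    P.leftPoles n ⊆ (P.hilferExt α β μ ν).leftPoles (n + 3) := by
  rintro _ ⟨j, hj, k, rfl⟩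
  exact ⟨j.succ.succ.succ, by simpa using hj, k, by simp [hilferExt]⟩

/-- The rightmost of the additional left poles is `(1 - β - κ) / α`, where `κ = (1 - ν)(1 - μ)`. -/
lemma mem_leftPoles_of_hilferExt {s : ℂ} (hα : 0 < α)
    (hκ : (1 - ν) * (1 - μ) ≤ 1)
    (hs : s ∈ (P.hilferExt α β μ ν).leftPoles (n + 3)) :
    s ∈ P.leftPoles n ∨ α * s.re ≤ 1 - (1 - ν) * (1 - μ) - β.re := by
  obtain ⟨j, hj, k, rfl⟩ := hs
  have hk := Nat.cast_nonneg (α := ℝ) k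
  have key : ∀ u : ℂ, α * (u / (α : ℂ)).re = u.re := fun u => by
    rw [Complex.div_ofReal_re]; field_simp
  revert hj
  refine Fin.cases (fun _ => Or.inr ?_) (fun j => Fin.cases (fun _ => Or.inr ?_)
    (fun j => Fin.cases (fun _ => Or.inr ?_) (fun j hj => Or.inl ?_) j) j) j
  · change α * (((1 - β : ℂ) - 1 - k) / (α : ℂ)).re ≤ _
    rw [key]; simp; linarith
  · change α * (((1 - β - ((1 - ν) * (1 - μ) : ℝ) : ℂ) - 1 - k) / (α : ℂ)).re ≤ _
    rw [key]; simp; linarith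
  · change α * (((2 - β - ((1 - ν) * (1 - μ) : ℝ) : ℂ) - 1 - k) / (α : ℂ)).re ≤ _
    rw [key]; simp; linarith
  · exact ⟨j, by simpa using hj, k, rfl⟩

variable {α β μ ν}

/-- Off the additional poles, the factors of the extended kernel coming from the parameters
`1 - β - κ` and `2 - β - κ` cancel. -/
lemma kernel_hilferExt (hm : m ≤ q) (hα : 0 < α) {ξ : ℂ}
    (hξ : ξ ∉ (P.hilferExt α β μ ν).leftPoles (n + 3)) :
    (P.hilferExt α β μ ν).kernel m (n + 3) ξ = P.kernel m n ξ * Complex.Gamma (β + α * ξ) *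
      (Complex.Gamma (β - μ + α * ξ))⁻¹ := by
  have hαc : (α : ℂ) ≠ 0 := by exact_mod_cast hα.ne'
  have h1 : Complex.Gamma (1 - (1 - β - ((1 - ν) * (1 - μ) : ℝ)) + α * ξ) ≠ 0 := by
    intro h
    obtain ⟨k, hk⟩ := Complex.Gamma_eq_zero_iff _ |>.mp h
    refine hξ ⟨(0 : Fin (p + 2)).succ, by simp, k, ?_⟩
    change ξ = ((1 - β - ((1 - ν) * (1 - μ) : ℝ) : ℂ) - 1 - k) / (α : ℂ)
    rw [eq_div_iff hαc]
    linear_combination hk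
  have h2 : Complex.Gamma (1 - (2 - β - ((1 - ν) * (1 - μ) : ℝ)) + α * ξ) ≠ 0 := by
    intro h
    obtain ⟨k, hk⟩ := Complex.Gamma_eq_zero_iff _ |>.mp h
    refine hξ ⟨(0 : Fin (p + 1)).succ.succ, by simp only [Fin.val_succ, Fin.val_zero]; omega, k, ?_⟩
    change ξ = ((2 - β - ((1 - ν) * (1 - μ) : ℝ) : ℂ) - 1 - k) / (α : ℂ)
    rw [eq_div_iff hαc]
    linear_combination hk
  have h : ∀ i : Fin 3, ¬ q + (i : ℕ) < m := fun i => by omega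
  have e0 : (1 : ℂ) - (1 - β) + α * ξ = β + α * ξ := by ring
  have e3 : (1 : ℂ) - (1 - β + μ) + α * ξ = β - μ + α * ξ := by ring
  simp only [kernel, hilferExt, Fin.prod_univ_succ (n := p + 2), Fin.prod_univ_succ (n := p + 1),
    Fin.prod_univ_succ (n := p), Fin.prod_univ_add, Matrix.cons_val_zero,
    Matrix.cons_val_succ, Fin.val_zero, Fin.val_succ, Fin.append_left, Fin.append_right,
    Fin.val_castAdd, Fin.val_natAdd, h, if_false, Fin.prod_univ_three]
  simp only [Matrix.cons_val_zero, Matrix.cons_val_one, Matrix.cons_val, e0, e3,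
    add_lt_add_iff_right]
  generalize Complex.Gamma (1 - (1 - β - ((1 - ν) * (1 - μ) : ℝ)) + α * ξ) = G₁ at h1 ⊢
  generalize Complex.Gamma (1 - (2 - β - ((1 - ν) * (1 - μ) : ℝ)) + α * ξ) = G₂ at h2 ⊢
  simp
  field_simp
  simp only [mul_comm ξ]
  ring

end Extension

end FoxParams

/-! ### Complex-valued absolutely continuous functions -/

section

variable {F G : ℝ → ℂ} {f g : ℝ → ℂ} {a b : ℝ}

lemma IntervalIntegrable.complex_ofReal {f : ℝ → ℝ} (hf : IntervalIntegrable f volume a b) :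
    IntervalIntegrable (fun x => (f x : ℂ)) volume a b := ⟨hf.1.ofReal, hf.2.ofReal⟩

lemma AbsolutelyContinuousOnInterval.comp_of_dist_le {X Y : Type*} [PseudoMetricSpace X]
    [PseudoMetricSpace Y] {F : ℝ → X} {G : ℝ → Y} (hF : AbsolutelyContinuousOnInterval F a b)
    (h : ∀ x y, dist (G x) (G y) ≤ dist (F x) (F y)) : AbsolutelyContinuousOnInterval G a b :=
  squeeze_zero (fun _ => Finset.sum_nonneg fun _ _ => dist_nonneg)
    (fun _ => Finset.sum_le_sum fun _ _ => h _ _) hF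

lemma AbsolutelyContinuousOnInterval.congr_uIcc (hF : AbsolutelyContinuousOnInterval F a b)
    (h : ∀ x ∈ uIcc a b, G x = F x) : AbsolutelyContinuousOnInterval G a b := by
  refine Tendsto.congr' ?_ hF
  filter_upwards [mem_inf_of_right (mem_principal_self _)] with E hE
  refine Finset.sum_congr rfl fun i hi => ?_
  have := hE.1 i hi
  rw [h _ this.1, h _ this.2]

/-- The fundamental theorem of calculus for complex-valued absolutely continuous functions. -/
lemma AbsolutelyContinuousOnInterval.complex_ftc (hab : a ≤ b)
    (hF : AbsolutelyContinuousOnInterval F a b) :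
    (∀ᵐ x ∂(volume.restrict (Ioo a b)), DifferentiableAt ℝ F x) ∧
      IntegrableOn (deriv F) (Ioo a b) ∧
      ∀ x ∈ Icc a b, ∫ t in a..x, deriv F t = F x - F a := by
  have hre : AbsolutelyContinuousOnInterval (fun x => (F x).re) a b :=
    hF.comp_of_dist_le fun x y => by
      rw [Real.dist_eq, Complex.dist_eq, ← Complex.sub_re]; exact Complex.abs_re_le_norm _
  have him : AbsolutelyContinuousOnInterval (fun x => (F x).im) a b :=
    hF.comp_of_dist_le fun x y => by
      rw [Real.dist_eq, Complex.dist_eq, ← Complex.sub_im]; exact Complex.abs_im_le_norm _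
  have hd : ∀ᵐ x, x ∈ Icc a b → HasDerivAt F
      (((deriv (fun x => (F x).re) x : ℝ) : ℂ) + ((deriv (fun x => (F x).im) x : ℝ) : ℂ) * Complex.I) x := by
    filter_upwards [hre.ae_differentiableAt, him.ae_differentiableAt] with x h1 h2 hx
    rw [uIcc_of_le hab] at h1 h2
    have h3 := (h1 hx).hasDerivAt.ofReal_comp.add
      ((h2 hx).hasDerivAt.ofReal_comp.mul_const Complex.I)
    exact h3.congr_of_eventuallyEq (Eventually.of_forall fun y => (Complex.re_add_im (F y)).symm)
  have hd' : ∀ᵐ x, x ∈ Icc a b → deriv F x =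
      ((deriv (fun x => (F x).re) x : ℝ) : ℂ) + ((deriv (fun x => (F x).im) x : ℝ) : ℂ) * Complex.I :=
    hd.mono fun x h hx => (h hx).deriv
  have i1 : IntervalIntegrable (fun x => ((deriv (fun x => (F x).re) x : ℝ) : ℂ)) volume a b :=
    hre.intervalIntegrable_deriv.complex_ofReal
  have i2 : IntervalIntegrable (fun x => ((deriv (fun x => (F x).im) x : ℝ) : ℂ) * Complex.I)
      volume a b := him.intervalIntegrable_deriv.complex_ofReal.mul_const _
  refine ⟨?_, ?_, fun x hx => ?_⟩
  · rw [ae_restrict_iff' measurableSet_Ioo]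
    exact hd.mono fun x h hx => (h (Ioo_subset_Icc_self hx)).differentiableAt
  · have i3 := (intervalIntegrable_iff_integrableOn_Ioo_of_le hab).mp (i1.add i2)
    refine i3.congr_fun_ae ?_
    rw [EventuallyEq, ae_restrict_iff' measurableSet_Ioo]
    exact hd'.mono fun x h hx => (h (Ioo_subset_Icc_self hx)).symm
  · have hsub : uIcc a x ⊆ uIcc a b := by
      rw [uIcc_of_le hx.1, uIcc_of_le hab]; exact Icc_subset_Icc_right hx.2
    have e : ∫ t in a..x, deriv F t = ∫ t in a..x, (((deriv (fun x => (F x).re) t : ℝ) : ℂ) +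
        ((deriv (fun x => (F x).im) t : ℝ) : ℂ) * Complex.I) := by
      refine intervalIntegral.integral_congr_ae (hd'.mono fun t h ht => h ?_)
      rw [uIoc_of_le hx.1] at ht
      exact ⟨ht.1.le, ht.2.trans hx.2⟩
    rw [e, intervalIntegral.integral_add (i1.mono_set hsub) (i2.mono_set hsub),
      intervalIntegral.integral_mul_const, intervalIntegral.integral_ofReal,
      intervalIntegral.integral_ofReal, (hre.mono hsub).integral_deriv_eq_sub,
      (him.mono hsub).integral_deriv_eq_sub]
    apply Complex.ext <;> simp

lemma absolutelyContinuousOnInterval_integral (hf : IntervalIntegrable f volume a b) :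
    AbsolutelyContinuousOnInterval (fun x => ∫ t in a..x, f t) a b := by
  have hre : IntervalIntegrable (fun x => (f x).re) volume a b := ⟨hf.1.re, hf.2.re⟩
  have him : IntervalIntegrable (fun x => (f x).im) volume a b := ⟨hf.1.im, hf.2.im⟩
  have h1 : AbsolutelyContinuousOnInterval (fun x => ((∫ t in a..x, (f t).re : ℝ) : ℂ)) a b :=
    (hre.absolutelyContinuousOnInterval_intervalIntegral left_mem_uIcc).comp_of_dist_le
      fun x y => by rw [Complex.dist_eq, Real.dist_eq, ← Complex.ofReal_sub, Complex.norm_real,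
        Real.norm_eq_abs]
  have h2 : AbsolutelyContinuousOnInterval
      (fun x => Complex.I • ((∫ t in a..x, (f t).im : ℝ) : ℂ)) a b :=
    ((him.absolutelyContinuousOnInterval_intervalIntegral left_mem_uIcc).comp_of_dist_le
      (G := fun x => ((∫ t in a..x, (f t).im : ℝ) : ℂ))
      fun x y => by rw [Complex.dist_eq, Real.dist_eq, ← Complex.ofReal_sub, Complex.norm_real,
        Real.norm_eq_abs]).const_smul Complex.I
  refine (h1.add h2).congr_uIcc fun x hx => ?_
  have hsub : uIcc a x ⊆ uIcc a b := uIcc_subset_uIcc left_mem_uIcc hx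
  rw [Pi.add_apply, ← intervalIntegral.integral_ofReal, ← intervalIntegral.integral_ofReal,
    smul_eq_mul, ← intervalIntegral.integral_const_mul, ← intervalIntegral.integral_add]
  · refine intervalIntegral.integral_congr fun t _ => ?_
    rw [mul_comm]; exact (Complex.re_add_im (f t)).symm
  · exact (hre.mono_set hsub).complex_ofReal
  · exact (him.mono_set hsub).complex_ofReal.const_mul _

/-- Functions whose primitives agree almost everywhere agree almost everywhere. -/
lemma ae_eq_of_primitive_ae_eq (hab : a ≤ b) (hf : IntegrableOn f (Ioo a b))
    (hg : IntegrableOn g (Ioo a b))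
    (h : ∀ᵐ x ∂(volume.restrict (Ioo a b)), ∫ t in a..x, f t = ∫ t in a..x, g t) :
    ∀ᵐ x ∂(volume.restrict (Ioo a b)), f x = g x := by
  have hf' := (intervalIntegrable_iff_integrableOn_Ioo_of_le hab).mpr hf
  have hg' := (intervalIntegrable_iff_integrableOn_Ioo_of_le hab).mpr hg
  have cf : ContinuousOn (fun x => ∫ t in a..x, f t) (Ioo a b) :=
    (intervalIntegral.continuousOn_primitive_interval' hf' left_mem_uIcc).mono
      (by rw [uIcc_of_le hab]; exact Ioo_subset_Icc_self)
  have cg : ContinuousOn (fun x => ∫ t in a..x, g t) (Ioo a b) :=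
    (intervalIntegral.continuousOn_primitive_interval' hg' left_mem_uIcc).mono
      (by rw [uIcc_of_le hab]; exact Ioo_subset_Icc_self)
  have heq := Measure.eqOn_open_of_ae_eq h isOpen_Ioo cf cg
  rw [ae_restrict_iff' measurableSet_Ioo]
  filter_upwards [hf'.ae_hasDerivAt_integral, hg'.ae_hasDerivAt_integral] with x h1 h2 hx
  have hx' : x ∈ uIcc a b := by rw [uIcc_of_le hab]; exact Ioo_subset_Icc_self hx
  refine (h1 hx' a left_mem_uIcc).unique ((h2 hx' a left_mem_uIcc).congr_of_eventuallyEq ?_)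
  filter_upwards [isOpen_Ioo.mem_nhds hx] with y hy using heq hy

end

/-! ### The Hilfer derivative of a convolution -/

/-- A family of weakly singular kernels whose orders add up under Riemann-Liouville integration. -/
structure IsFracFamily (s : ℝ) (K : ℝ → ℝ → ℂ) : Prop where
  isWeakKernel : ∀ σ, IsWeakKernel (s + σ) (K σ)
  conv : ∀ σ γ, 0 < s + σ → 0 < γ → ∀ y, 0 < y → intervalConv 0 (rlKernel γ) (K σ) y = K (σ + γ) y

namespace IsFracFamily

variable {s : ℝ} {K : ℝ → ℝ → ℂ} {a b σ γ : ℝ} {f : ℝ → ℂ}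

lemma assoc (hK : IsFracFamily s K) (hσ : 0 < s + σ) (hγ : 0 < γ) (hf : IntegrableOn f (Ioo a b))
    {x : ℝ} (hax : a ≤ x) (hxb : x ≤ b) (hx : IteratedConvExists a b (rlKernel γ) (K σ) f x) :
    RLConverges γ a (intervalConv a (K σ) f) x ∧
      rlIntegral γ a (intervalConv a (K σ) f) x = intervalConv a (K (σ + γ)) f x := by
  have h := hx.assoc hγ hσ (isWeakKernel_rlKernel γ) (hK.isWeakKernel σ) hf hax hxb
  refine ⟨(rlConverges_iff hγ _ _ _).mpr h.1, ?_⟩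
  rw [rlIntegral_eq_intervalConv hγ.ne', h.2]
  exact intervalConv_congr hax (fun y hy => hK.conv σ γ hσ hγ y hy) (Eventually.of_forall fun _ => rfl)

lemma assoc_ae (hK : IsFracFamily s K) (hσ : 0 < s + σ) (hγ : 0 < γ)
    (hf : IntegrableOn f (Ioo a b)) :
    ∀ᵐ x ∂(volume.restrict (Ioo a b)), RLConverges γ a (intervalConv a (K σ) f) x ∧
      rlIntegral γ a (intervalConv a (K σ) f) x = intervalConv a (K (σ + γ)) f x := by
  rw [ae_restrict_iff' measurableSet_Ioo]
  filter_upwards [IteratedConvExists.ae hγ hσ (isWeakKernel_rlKernel γ) (hK.isWeakKernel σ) hf]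
    with x h hx
  exact hK.assoc hσ hγ hf hx.1.le hx.2.le h

/-- If the integrated kernel is bounded near `0`, the composition rule holds at every point. -/
lemma assoc_of_one_le (hK : IsFracFamily s K) (hσ : 0 < s + σ) (hγ : 0 < γ) (h1 : 1 ≤ γ + (s + σ))
    (hf : IntegrableOn f (Ioo a b)) {x : ℝ} (hax : a ≤ x) (hxb : x ≤ b) :
    RLConverges γ a (intervalConv a (K σ) f) x ∧
      rlIntegral γ a (intervalConv a (K σ) f) x = intervalConv a (K (σ + γ)) f x :=
  hK.assoc hσ hγ hf hax hxb
    (IteratedConvExists.of_one_le hγ hσ h1 (isWeakKernel_rlKernel γ) (hK.isWeakKernel σ) hf x)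

lemma integral_conv (hK : IsFracFamily s K) (hσ : 0 < s + σ) (hf : IntegrableOn f (Ioo a b))
    {x : ℝ} (hax : a ≤ x) (hxb : x ≤ b) :
    ∫ t in a..x, intervalConv a (K σ) f t = intervalConv a (K (σ + 1)) f x := by
  rw [← (hK.assoc_of_one_le hσ one_pos (by linarith) hf hax hxb).2,
    rlIntegral_eq_intervalConv one_ne_zero, intervalConv_rlKernel_one]

end IsFracFamily

/-- `I^1 I^δ = I^δ I^1`, at every point. -/
lemma integral_rlIntegral {a b δ : ℝ} {f : ℝ → ℂ} (hδ : 0 < δ) (hf : IntegrableOn f (Ioo a b))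
    {x : ℝ} (hax : a ≤ x) (hxb : x ≤ b) :
    ∫ t in a..x, rlIntegral δ a f t = rlIntegral δ a (fun t => ∫ r in a..t, f r) x := by
  have w1 := isWeakKernel_rlKernel 1
  have wδ := isWeakKernel_rlKernel δ
  have h1 := ((IteratedConvExists.of_one_le one_pos hδ (by linarith) w1 wδ hf x).assoc one_pos hδ
    w1 wδ hf hax hxb).2
  have h2 := ((IteratedConvExists.of_one_le hδ one_pos (by linarith) wδ w1 hf x).assoc hδ one_pos
    wδ w1 hf hax hxb).2
  have hcomm : ∀ y, intervalConv 0 (rlKernel 1) (rlKernel δ) y =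
      intervalConv 0 (rlKernel δ) (rlKernel 1) y := fun y => by
    have := intervalIntegral.integral_comp_sub_left (a := 0) (b := y) (rlKernel δ) y
    simp only [intervalConv, rlKernel_one, one_mul, mul_one]
    rw [this, sub_self, sub_zero]
  have e1 : rlIntegral δ a f = intervalConv a (rlKernel δ) f :=
    funext fun t => rlIntegral_eq_intervalConv hδ.ne' a f t
  have e2 : (fun t => ∫ r in a..t, f r) = intervalConv a (rlKernel 1) f :=
    funext fun t => (intervalConv_rlKernel_one a f t).symm
  rw [rlIntegral_eq_intervalConv hδ.ne', e2, h2, ← intervalConv_rlKernel_one, e1, h1]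
  exact intervalConv_congr hax (fun y _ => hcomm y) (Eventually.of_forall fun _ => rfl)

lemma rlIntegral_congr {γ a x : ℝ} {f g : ℝ → ℂ} (hax : a ≤ x)
    (h : ∀ᵐ t ∂(volume.restrict (Ioo a x)), f t = g t) (hx : γ = 0 → f x = g x) :
    rlIntegral γ a f x = rlIntegral γ a g x := by
  by_cases hγ : γ = 0
  · simp [rlIntegral, hγ, hx hγ]
  · rw [rlIntegral_eq_intervalConv hγ, rlIntegral_eq_intervalConv hγ]
    exact intervalConv_congr hax (fun _ _ => rfl) h

lemma RLConverges.congr {γ a x : ℝ} {f g : ℝ → ℂ} (hax : a ≤ x) (hf : RLConverges γ a f x)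
    (h : ∀ t ∈ Ioo a x, f t = g t) : RLConverges γ a g x := by
  intro hγ
  have := hf hγ
  rw [intervalIntegrable_iff_integrableOn_Ioo_of_le hax] at this ⊢
  exact this.congr_fun (fun t ht => by simp only [h t ht]) measurableSet_Ioo

section

variable {s : ℝ} {K : ℝ → ℝ → ℂ} {a b μ ν : ℝ} {φ u : ℝ → ℂ}

/-- The Hilfer derivative of `K 0 * φ` is `K (-μ) * φ` almost everywhere, if it exists: after one
more integration both sides become `K (1 - μ) * φ`. -/
theorem hilferDeriv_ae_eq (hab : a < b) (hμ : 0 < μ) (hμ' : μ < 1) (hν : 0 ≤ ν) (hν' : ν ≤ 1)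
    (hK : IsFracFamily s K) (hsμ : 0 < s - μ) (hφ : IntegrableOn φ (Ioo a b))
    (hu : ∀ x ∈ Icc a b, u x = intervalConv a (K 0) φ x)
    (hac : AbsolutelyContinuousOnInterval (rlIntegral ((1 - ν) * (1 - μ)) a u) a b) :
    ∀ᵐ x ∂(volume.restrict (Ioo a b)),
      HilferExists μ ν a u x ∧ hilferDeriv μ ν a u x = intervalConv a (K (-μ)) φ x := by
  set κ := (1 - ν) * (1 - μ) with hκ
  set δ := ν * (1 - μ) with hδ
  have hκ0 : 0 ≤ κ := mul_nonneg (by linarith) (by linarith)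
  have hδ0 : 0 ≤ δ := mul_nonneg hν (by linarith)
  have hκδ : κ + δ = 1 - μ := by rw [hκ, hδ]; ring
  set F := rlIntegral κ a u with hF
  set G := deriv F with hG
  obtain ⟨hdiff, hGi, hftc⟩ := hac.complex_ftc hab.le
  -- `F = K κ * φ` almost everywhere
  have hFκ : ∀ᵐ x ∂(volume.restrict (Ioo a b)), RLConverges κ a u x ∧
      F x = intervalConv a (K κ) φ x := by
    have hcongr : ∀ x ∈ Ioo a b, F x = rlIntegral κ a (intervalConv a (K 0) φ) x := fun x hx =>
      rlIntegral_congr hx.1.le ((ae_restrict_iff' measurableSet_Ioo).mpr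
        (Eventually.of_forall fun t ht => hu t ⟨ht.1.le, (ht.2.trans hx.2).le⟩))
        fun _ => hu x ⟨hx.1.le, hx.2.le⟩
    rcases hκ0.eq_or_lt with h0 | h0
    · filter_upwards [ae_restrict_mem measurableSet_Ioo] with x hx
      refine ⟨fun h => absurd h0.symm h, ?_⟩
      rw [hcongr x hx, ← h0, rlIntegral, if_pos rfl]
    · filter_upwards [ae_restrict_mem measurableSet_Ioo,
        hK.assoc_ae (σ := 0) (by linarith) h0 hφ] with x hx h
      exact ⟨h.1.congr hx.1.le fun t ht => (hu t ⟨ht.1.le, (ht.2.trans hx.2).le⟩).symm, by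
        rw [hcongr x hx, h.2, zero_add]⟩
  have hFa : F a = 0 := by
    have h0 : u a = 0 := by rw [hu a ⟨le_rfl, hab.le⟩]; simp [intervalConv]
    simp [hF, rlIntegral, h0]
  have hFint : ∀ x ∈ Icc a b, ∫ t in a..x, G t = F x := fun x hx => by
    rw [hftc x hx, hFa, sub_zero]
  have hGconv : ∀ᵐ x ∂(volume.restrict (Ioo a b)), RLConverges δ a G x := by
    rcases hδ0.eq_or_lt with h0 | h0
    · exact Eventually.of_forall fun x h => absurd h0.symm h
    · filter_upwards [(isWeakKernel_rlKernel δ).ae_intervalIntegrable h0 hGi] with x hx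
      exact (rlConverges_iff h0 _ _ _).mpr hx
  have hIi : IntegrableOn (rlIntegral δ a G) (Ioo a b) := by
    rcases hδ0.eq_or_lt with h0 | h0
    · exact hGi.congr_fun (fun x _ => by simp [rlIntegral, ← h0, hG]) measurableSet_Ioo
    · exact ((isWeakKernel_rlKernel δ).integrableOn_intervalConv h0 hGi).congr_fun
        (fun x _ => (rlIntegral_eq_intervalConv h0.ne' a G x).symm) measurableSet_Ioo
  -- both primitives are `K (1 - μ) * φ`
  have hprim : ∀ᵐ x ∂(volume.restrict (Ioo a b)), ∫ t in a..x, rlIntegral δ a G t =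
      ∫ t in a..x, intervalConv a (K (-μ)) φ t := by
    rcases hδ0.eq_or_lt with h0 | h0
    · filter_upwards [hFκ, ae_restrict_mem measurableSet_Ioo] with x h hx
      have hx' : x ∈ Icc a b := ⟨hx.1.le, hx.2.le⟩
      rw [hK.integral_conv (by linarith) hφ hx'.1 hx'.2]
      simp only [rlIntegral, ← h0, if_true]
      rw [hFint x hx', h.2]
      congr 2; linarith
    · filter_upwards [hK.assoc_ae (σ := κ) (by linarith) h0 hφ,
        ae_restrict_mem measurableSet_Ioo] with x h hx
      have hx' : x ∈ Icc a b := ⟨hx.1.le, hx.2.le⟩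
      rw [hK.integral_conv (by linarith) hφ hx'.1 hx'.2, integral_rlIntegral h0 hGi hx'.1 hx'.2]
      have hae : ∀ᵐ t ∂(volume.restrict (Ioo a x)),
          ∫ r in a..t, G r = intervalConv a (K κ) φ t := by
        have := ae_restrict_of_ae_restrict_of_subset (Ioo_subset_Ioo_right hx.2.le) hFκ
        filter_upwards [this, ae_restrict_mem measurableSet_Ioo] with t ht htx
        rw [hFint t ⟨htx.1.le, (htx.2.trans hx.2).le⟩, ht.2]
      rw [rlIntegral_congr hx.1.le hae fun h' => absurd h' h0.ne', h.2, hκδ]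
      congr 2; ring
  have hmain := ae_eq_of_primitive_ae_eq hab.le hIi
    ((hK.isWeakKernel (-μ)).integrableOn_intervalConv (by linarith) hφ) hprim
  have hdiff' := (ae_restrict_iff' measurableSet_Ioo).mp hdiff
  filter_upwards [hmain, hdiff, hGconv, ae_restrict_mem measurableSet_Ioo] with x h1 h2 h3 hx
  refine ⟨⟨?_, fun _ => h2, h3⟩, h1⟩
  filter_upwards [ae_restrict_of_ae_restrict_of_subset (Ioo_subset_Ioo_right hx.2.le) hFκ,
    ae_restrict_of_ae_restrict_of_subset (Ioo_subset_Ioo_right hx.2.le) hdiff] with t h4 h5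
  exact ⟨h4.1, h5⟩

/-- If even the kernel of order `κ - 1`, with `κ = (1 - ν)(1 - μ)`, is integrable, the inner
integral of the Hilfer derivative is a primitive. -/
lemma rlIntegral_eq_primitive (hμ' : μ < 1) (hν' : ν ≤ 1)
    (hK : IsFracFamily s K) (hs : 0 < s) (hsκ : 0 < s + ((1 - ν) * (1 - μ) - 1))
    (hφ : IntegrableOn φ (Ioo a b)) (hu : ∀ x ∈ Icc a b, u x = intervalConv a (K 0) φ x)
    {x : ℝ} (hx : x ∈ Icc a b) :
    RLConverges ((1 - ν) * (1 - μ)) a u x ∧ rlIntegral ((1 - ν) * (1 - μ)) a u x =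
      ∫ t in a..x, intervalConv a (K ((1 - ν) * (1 - μ) - 1)) φ t := by
  set κ := (1 - ν) * (1 - μ) with hκ
  have hκ0 : 0 ≤ κ := mul_nonneg (by linarith) (by linarith)
  rw [hK.integral_conv hsκ hφ hx.1 hx.2, sub_add_cancel]
  have hcongr : rlIntegral κ a u x = rlIntegral κ a (intervalConv a (K 0) φ) x :=
    rlIntegral_congr hx.1 ((ae_restrict_iff' measurableSet_Ioo).mpr
      (Eventually.of_forall fun t ht => hu t ⟨ht.1.le, ht.2.le.trans hx.2⟩)) fun _ => hu x hx
  rcases hκ0.eq_or_lt with h0 | h0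
  · refine ⟨fun h => absurd h0.symm h, ?_⟩
    rw [hcongr, ← h0, rlIntegral, if_pos rfl]
  · have h := hK.assoc_of_one_le (σ := 0) (by linarith) h0 (by linarith) hφ hx.1 hx.2
    exact ⟨h.1.congr hx.1 fun t ht => (hu t ⟨ht.1.le, ht.2.le.trans hx.2⟩).symm, by
      rw [hcongr, h.2, zero_add]⟩

/-- The inner integral is absolutely continuous for every integrable `φ`, as a primitive. -/
theorem absolutelyContinuousOnInterval_rlIntegral (hab : a < b) (hμ' : μ < 1)
    (hν' : ν ≤ 1) (hK : IsFracFamily s K) (hs : 0 < s)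
    (hsκ : 0 < s + ((1 - ν) * (1 - μ) - 1)) (hφ : IntegrableOn φ (Ioo a b))
    (hu : ∀ x ∈ Icc a b, u x = intervalConv a (K 0) φ x) :
    AbsolutelyContinuousOnInterval (rlIntegral ((1 - ν) * (1 - μ)) a u) a b := by
  have hg := (hK.isWeakKernel _).integrableOn_intervalConv hsκ hφ
  refine (absolutelyContinuousOnInterval_integral
    ((intervalIntegrable_iff_integrableOn_Ioo_of_le hab.le).mpr hg)).congr_uIcc fun x hx => ?_
  rw [uIcc_of_le hab.le] at hx
  exact (rlIntegral_eq_primitive hμ' hν' hK hs hsκ hφ hu hx).2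

/-- For continuous `φ` the formula for the Hilfer derivative holds at every point. -/
theorem hilferDeriv_eq (hμ' : μ < 1) (hν : 0 ≤ ν) (hν' : ν ≤ 1)
    (hK : IsFracFamily s K) (hs : 0 < s) (hsκ : 0 < s + ((1 - ν) * (1 - μ) - 1))
    (hφ : IntegrableOn φ (Ioo a b)) (hφc : ContinuousOn φ (Ioo a b))
    (hu : ∀ x ∈ Icc a b, u x = intervalConv a (K 0) φ x) {x : ℝ} (hx : x ∈ Ioo a b) :
    HilferExists μ ν a u x ∧ hilferDeriv μ ν a u x = intervalConv a (K (-μ)) φ x := by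
  have hprim : ∀ y ∈ Icc a b, _ := fun y hy =>
    rlIntegral_eq_primitive hμ' hν' hK hs hsκ hφ hu hy
  set κ := (1 - ν) * (1 - μ) with hκ
  set δ := ν * (1 - μ) with hδ
  have hδ0 : 0 ≤ δ := mul_nonneg hν (by linarith)
  have hκδ : κ + δ = 1 - μ := by rw [hκ, hδ]; ring
  set g := intervalConv a (K (κ - 1)) φ with hg
  have hgi : IntegrableOn g (Ioo a b) :=
    (hK.isWeakKernel (κ - 1)).integrableOn_intervalConv hsκ hφ
  have hgc : ∀ y ∈ Ioo a b, ContinuousAt g y := fun y hy =>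
    ((hK.isWeakKernel (κ - 1)).continuousAt_intervalConv hsκ hφ hφc hy).2
  have hderiv : ∀ y ∈ Ioo a b, HasDerivAt (rlIntegral κ a u) (g y) y := by
    intro y hy
    have hgy : IntervalIntegrable g volume a y :=
      (intervalIntegrable_iff_integrableOn_Ioo_of_le hy.1.le).mpr
        (hgi.mono_set (Ioo_subset_Ioo_right hy.2.le))
    refine (intervalIntegral.integral_hasDerivAt_right hgy
      (ContinuousAt.stronglyMeasurableAtFilter isOpen_Ioo hgc y hy)
      (hgc y hy)).congr_of_eventuallyEq ?_
    filter_upwards [isOpen_Ioo.mem_nhds hy] with z hz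
    exact (hprim z ⟨hz.1.le, hz.2.le⟩).2
  have hout : RLConverges δ a g x ∧ rlIntegral δ a g x = intervalConv a (K (-μ)) φ x := by
    rcases hδ0.eq_or_lt with h0 | h0
    · refine ⟨fun h => absurd h0.symm h, ?_⟩
      rw [rlIntegral, if_pos h0.symm, hg, show κ - 1 = -μ by linarith]
    · have h := hK.assoc hsκ h0 hφ hx.1.le hx.2.le
        (IteratedConvExists.of_continuousOn h0 hsκ (isWeakKernel_rlKernel δ)
          (hK.isWeakKernel _) hφ hφc hx)
      rwa [show κ - 1 + δ = -μ by linarith] at h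
  refine ⟨⟨?_, fun _ => (hderiv x hx).differentiableAt, ?_⟩, ?_⟩
  · filter_upwards [ae_restrict_mem measurableSet_Ioo] with t ht
    have ht' : t ∈ Ioo a b := ⟨ht.1, ht.2.trans hx.2⟩
    exact ⟨(hprim t ⟨ht'.1.le, ht'.2.le⟩).1, (hderiv t ht').differentiableAt⟩
  · exact hout.1.congr hx.1.le fun t ht => (hderiv t ⟨ht.1, ht.2.trans hx.2⟩).deriv.symm
  · rw [← hout.2, hilferDeriv]
    exact rlIntegral_congr hx.1.le ((ae_restrict_iff' measurableSet_Ioo).mpr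
      (Eventually.of_forall fun t ht => (hderiv t ⟨ht.1, ht.2.trans hx.2⟩).deriv))
      fun _ => (hderiv x hx).deriv

end

/-! ### Application to the integral operators with `H`-functions -/

namespace FoxParams

variable {p q m n : ℕ} (P : FoxParams p q) {w β : ℂ} {α : ℝ}

lemma isFracFamily_fracKernel {L : MBContour} (hA : ∀ j, 0 < P.A j) (hB : ∀ j, 0 < P.B j)
    (hL : P.Separates m n L) (hw : w ≠ 0) (harg : |w.arg| < Real.pi * P.omega m n / 2)
    (hα : 0 < α) {c : ℝ} (hc : ∀ z ∈ L.support, c ≤ z.re) (hβ : 0 < β.re + α * c) :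
    IsFracFamily (β.re + α * c) (P.fracKernel m n L w α β) where
  isWeakKernel := P.isWeakKernel_fracKernel hA hB hL hw harg hα hc hβ
  conv _ _ hσ hγ _ hy := P.intervalConv_fracKernel hA hB hL hw harg hα hc hβ hσ hγ hy

lemma opIntegrand_eq {K : ℝ → ℂ}
    (hK : ∀ y : ℝ, 0 < y → (y : ℂ) ^ (β - 1) * P.foxH m n (w * ((y ^ α : ℝ) : ℂ)) = K y)
    (φ : ℝ → ℂ) {x t : ℝ} (ht : t < x) : P.opIntegrand m n w α β φ x t = K (x - t) * φ t := by
  rw [opIntegrand, hK _ (sub_pos.mpr ht)]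

lemma op_eq_intervalConv {K : ℝ → ℂ}
    (hK : ∀ y : ℝ, 0 < y → (y : ℂ) ^ (β - 1) * P.foxH m n (w * ((y ^ α : ℝ) : ℂ)) = K y)
    (φ : ℝ → ℂ) {a x : ℝ} (hax : a ≤ x) : P.op m n w α β a φ x = intervalConv a K φ x := by
  rw [op, intervalConv, intervalIntegral.integral_of_le hax, intervalIntegral.integral_of_le hax,
    integral_Ioc_eq_integral_Ioo, integral_Ioc_eq_integral_Ioo]
  exact setIntegral_congr_fun measurableSet_Ioo fun t ht => P.opIntegrand_eq hK φ ht.2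

lemma opConverges_iff {K : ℝ → ℂ}
    (hK : ∀ y : ℝ, 0 < y → (y : ℂ) ^ (β - 1) * P.foxH m n (w * ((y ^ α : ℝ) : ℂ)) = K y)
    (φ : ℝ → ℂ) {a x : ℝ} (hax : a ≤ x) : P.OpConverges m n w α β a φ x ↔
      IntervalIntegrable (fun t => K (x - t) * φ t) volume a x := by
  rw [OpConverges, intervalIntegrable_iff_integrableOn_Ioo_of_le hax,
    intervalIntegrable_iff_integrableOn_Ioo_of_le hax]
  exact integrableOn_congr_fun (fun t ht => P.opIntegrand_eq hK φ ht.2) measurableSet_Ioo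

/-- The kernel with the extended parameters is the fractional derivative of order `μ` of the
original one. -/
lemma cpow_mul_foxH_hilferExt {L : MBContour} {μ ν : ℝ} (hA : ∀ j, 0 < P.A j)
    (hB : ∀ j, 0 < P.B j) (hm : m ≤ q) (hL : (P.hilferExt α β μ ν).Separates m (n + 3) L)
    (hw : w ≠ 0) (harg : |w.arg| < Real.pi * P.omega m n / 2) (hα : 0 < α) {y : ℝ} (hy : 0 < y) :
    (y : ℂ) ^ (β - μ - 1) *
      (P.hilferExt α β μ ν).foxH m (n + 3) (w * ((y ^ α : ℝ) : ℂ)) =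
      P.fracKernel m n L w α β (-μ) y := by
  rw [(P.hilferExt α β μ ν).cpow_mul_foxH_eq_powerMix (g := P.fracWeight m n w α β (-μ))
    (P.hilferExt_A_pos α β μ ν hA hα) (P.hilferExt_B_pos α β μ ν hB hα) hL hw
    (by rwa [P.hilferExt_omega α β μ ν hm]) (β - μ) ?_ hy, fracKernel]
  · simp [sub_eq_add_neg]
  · intro ξ hξ
    rw [P.kernel_hilferExt hm hα fun h => (hL.1 ξ h).1 hξ, fracWeight]
    push_cast
    rw [← sub_eq_add_neg]
    ring

lemma Separates.of_hilferExt {L : MBContour} {μ ν : ℝ} (hm : m ≤ q)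
    (hL : (P.hilferExt α β μ ν).Separates m (n + 3) L) : P.Separates m n L :=
  ⟨fun s hs => hL.1 s (P.leftPoles_subset_hilferExt α β μ ν hs), fun s hs =>
    hL.2 s (by rwa [P.hilferExt_rightPoles α β μ ν hm])⟩

/-- There is an abscissa `c` to the left of the right poles with `d + αc > 0`. -/
lemma exists_abscissa (hα : 0 < α) {d : ℝ}
    (h : ∀ j : Fin q, (j : ℕ) < m → 0 < d + (α * P.b j / P.B j).re) :
    ∃ c, 0 < d + α * c ∧ ∀ j : Fin q, (j : ℕ) < m → c < (P.b j).re / P.B j := by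
  have key : ∀ j : Fin q, (α * P.b j / P.B j).re = α * ((P.b j).re / P.B j) := fun j => by
    rw [Complex.div_ofReal_re, Complex.re_ofReal_mul, mul_div_assoc]
  have hev : ∀ᶠ c in 𝓝[>] (-d / α), ∀ j : Fin q, (j : ℕ) < m → c < (P.b j).re / P.B j := by
    refine eventually_all.mpr fun j => ?_
    by_cases hj : (j : ℕ) < m
    · have hlt : -d / α < (P.b j).re / P.B j := by
        rw [div_lt_iff₀ hα]
        have := h j hj
        rw [key] at this
        linarith
      filter_upwards [nhdsWithin_le_nhds (gt_mem_nhds hlt)] with c hc _ using hc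
    · exact Eventually.of_forall fun c h => absurd h hj
  obtain ⟨c, hc1, hc2⟩ := (hev.and self_mem_nhdsWithin).exists
  refine ⟨c, ?_, hc1⟩
  have := (div_lt_iff₀ hα).mp (mem_Ioi.mp hc2)
  linarith

lemma lt_of_hilferExt {μ ν c : ℝ} (hm : m ≤ q)
    (hc : ∀ j : Fin q, (j : ℕ) < m → c < (P.b j).re / P.B j) :
    ∀ j : Fin (q + 3), (j : ℕ) < m →
      c < ((P.hilferExt α β μ ν).b j).re / (P.hilferExt α β μ ν).B j := by
  intro j hj
  obtain ⟨i, rfl⟩ : ∃ i, j = Fin.castAdd 3 i := ⟨⟨j, by omega⟩, rfl⟩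
  simpa [FoxParams.hilferExt] using hc i hj

/-- The extended parameters are admissible if the right poles lie to the right of all the
additional left poles. -/
lemma IsAdmissible.hilferExt {P : FoxParams p q} (hP : P.IsAdmissible m n) {μ ν : ℝ} (hα : 0 < α)
    (hκ : (1 - ν) * (1 - μ) ≤ 1) {c : ℝ}
    (hc : ∀ j : Fin q, (j : ℕ) < m → c < (P.b j).re / P.B j)
    (hc' : 0 < β.re + α * c + ((1 - ν) * (1 - μ) - 1)) :
    (P.hilferExt α β μ ν).IsAdmissible m (n + 3) where
  one_le := hP.one_le
  m_le := hP.m_le.trans (Nat.le_add_right _ _)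
  n_le := Nat.add_le_add_right hP.n_le 3
  A_pos := P.hilferExt_A_pos α β μ ν hP.A_pos hα
  B_pos := P.hilferExt_B_pos α β μ ν hP.B_pos hα
  disjoint_poles := by
    rw [P.hilferExt_rightPoles α β μ ν hP.m_le, Set.disjoint_left]
    intro s hs hs'
    rcases P.mem_leftPoles_of_hilferExt α β μ ν hα hκ hs with h | h
    · exact Set.disjoint_left.mp hP.disjoint_poles h hs'
    · have h2 := P.lt_re_of_mem_rightPoles hP.B_pos hc hs'
      have := mul_lt_mul_of_pos_left h2 hα
      linarith

end FoxParams

end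

theorem theorem4 {m n p q : ℕ} (P : FoxParams p q) (hP : P.IsAdmissible m n)
    (w : ℂ) (hw : w ≠ 0)
    (hΩ : 0 < P.omega m n) (harg : |w.arg| < Real.pi * P.omega m n / 2)
    (α : ℝ) (hα : 0 < α)
    (μ ν : ℝ) (hμ : 0 < μ) (hμ' : μ < 1) (hν : 0 ≤ ν) (hν' : ν ≤ 1)
    (β : ℂ) (hβ : 0 < β.re)
    (hmin : ∀ j : Fin q, (j : ℕ) < m → 0 < (β - μ).re + (α * P.b j / P.B j).re)
    (a b : ℝ) (hab : a < b)
    (φ : ℝ → ℂ) (hφ : IntegrableOn φ (Ioo a b)) :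
    -- the function to which the Hilfer derivative is applied is well defined and integrable
    (∀ᵐ x ∂(volume.restrict (Ioo a b)), P.OpConverges m n w α β a φ x) ∧
    IntegrableOn (P.op m n w α β a φ) (Ioo a b) ∧
    -- the formula, whenever the Hilfer derivative exists
    ((P.hilferExt α β μ ν).IsAdmissible m (n + 3) →
      AbsolutelyContinuousOnInterval
        (rlIntegral ((1 - ν) * (1 - μ)) a (P.op m n w α β a φ)) a b →
      ∀ᵐ x ∂(volume.restrict (Ioo a b)),
        HilferExists μ ν a (P.op m n w α β a φ) x ∧
        (P.hilferExt α β μ ν).OpConverges m (n + 3) w α (β - μ) a φ x ∧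
        hilferDeriv μ ν a (P.op m n w α β a φ) x =
          (P.hilferExt α β μ ν).op m (n + 3) w α (β - μ) a φ x) ∧
    -- it exists, for every integrable `φ`, if the minimum condition holds with `μ + ν - μ * ν`
    ((∀ j : Fin q, (j : ℕ) < m →
        0 < (β - (μ + ν - μ * ν : ℝ)).re + (α * P.b j / P.B j).re) →
      (P.hilferExt α β μ ν).IsAdmissible m (n + 3) ∧
      AbsolutelyContinuousOnInterval
        (rlIntegral ((1 - ν) * (1 - μ)) a (P.op m n w α β a φ)) a b ∧
      (ContinuousOn φ (Ioo a b) → ∀ x ∈ Ioo a b,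
        HilferExists μ ν a (P.op m n w α β a φ) x ∧
        (P.hilferExt α β μ ν).OpConverges m (n + 3) w α (β - μ) a φ x ∧
        hilferDeriv μ ν a (P.op m n w α β a φ) x =
          (P.hilferExt α β μ ν).op m (n + 3) w α (β - μ) a φ x)) := by
  have hA := hP.A_pos
  have hB := hP.B_pos
  have hreμ : (β - μ).re = β.re - μ := by simp
  obtain ⟨c, hc0, hcb⟩ := P.exists_abscissa hα hmin
  rw [hreμ] at hc0
  have hs : 0 < β.re + α * c := by linarith
  obtain ⟨L, hL, hLc⟩ := P.exists_separates hA hB hP.disjoint_poles hcb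
  have hK := P.isFracFamily_fracKernel hA hB hL hw harg hα hLc hs
  have hK0 : ∀ y : ℝ, 0 < y → _ := fun y hy =>
    P.cpow_mul_foxH_eq_fracKernel hA hB hL hw harg hα hLc hs hy
  have hw0 : IsWeakKernel (β.re + α * c) (P.fracKernel m n L w α β 0) := by
    simpa using hK.isWeakKernel 0
  refine ⟨?_, ?_, fun hext hac => ?_, fun hmin' => ?_⟩
  · filter_upwards [hw0.ae_intervalIntegrable hs hφ, ae_restrict_mem measurableSet_Ioo] with x h hx
    exact (P.opConverges_iff hK0 φ hx.1.le).mpr h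
  · exact (hw0.integrableOn_intervalConv hs hφ).congr_fun
      (fun x hx => (P.op_eq_intervalConv hK0 φ hx.1.le).symm) measurableSet_Ioo
  · -- the contour now also separates the poles of the extended kernel
    obtain ⟨L, hLe, hLc⟩ := (P.hilferExt α β μ ν).exists_separates hext.A_pos hext.B_pos
      hext.disjoint_poles (P.lt_of_hilferExt hP.m_le hcb)
    have hL := FoxParams.Separates.of_hilferExt P hP.m_le hLe
    have hK := P.isFracFamily_fracKernel hA hB hL hw harg hα hLc hs
    have hK0 : ∀ y : ℝ, 0 < y → _ := fun y hy =>
      P.cpow_mul_foxH_eq_fracKernel hA hB hL hw harg hα hLc hs hy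
    have hKμ : ∀ y : ℝ, 0 < y → _ := fun y hy =>
      P.cpow_mul_foxH_hilferExt hA hB hP.m_le hLe hw harg hα hy
    filter_upwards [hilferDeriv_ae_eq hab hμ hμ' hν hν' hK (by linarith) hφ
      (fun x hx => P.op_eq_intervalConv hK0 φ hx.1) hac,
      (hK.isWeakKernel (-μ)).ae_intervalIntegrable (by linarith) hφ,
      ae_restrict_mem measurableSet_Ioo] with x h1 h2 hx
    refine ⟨h1.1, ((P.hilferExt α β μ ν).opConverges_iff hKμ φ hx.1.le).mpr h2, ?_⟩
    rw [(P.hilferExt α β μ ν).op_eq_intervalConv hKμ φ hx.1.le, h1.2]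
  · have hreμν : (β - (μ + ν - μ * ν : ℝ)).re = β.re - (μ + ν - μ * ν) := by simp
    have hκ : (1 - ν) * (1 - μ) ≤ 1 := by nlinarith
    have hμν : μ ≤ μ + ν - μ * ν := by nlinarith
    obtain ⟨c, hc0, hcb⟩ := P.exists_abscissa hα hmin'
    rw [hreμν] at hc0
    have hs : 0 < β.re + α * c := by linarith
    have hsκ : 0 < β.re + α * c + ((1 - ν) * (1 - μ) - 1) := by linarith
    have hext := hP.hilferExt (μ := μ) (ν := ν) hα hκ hcb hsκ
    obtain ⟨L, hLe, hLc⟩ := (P.hilferExt α β μ ν).exists_separates hext.A_pos hext.B_pos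
      hext.disjoint_poles (P.lt_of_hilferExt hP.m_le hcb)
    have hL := FoxParams.Separates.of_hilferExt P hP.m_le hLe
    have hK := P.isFracFamily_fracKernel hA hB hL hw harg hα hLc hs
    have hK0 : ∀ y : ℝ, 0 < y → _ := fun y hy =>
      P.cpow_mul_foxH_eq_fracKernel hA hB hL hw harg hα hLc hs hy
    have hKμ : ∀ y : ℝ, 0 < y → _ := fun y hy =>
      P.cpow_mul_foxH_hilferExt hA hB hP.m_le hLe hw harg hα hy
    have hu : ∀ x ∈ Icc a b, P.op m n w α β a φ x = _ := fun x hx =>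
      P.op_eq_intervalConv hK0 φ hx.1
    refine ⟨hext, absolutelyContinuousOnInterval_rlIntegral hab hμ' hν' hK hs hsκ hφ hu,
      fun hφc x hx => ?_⟩
    have h1 := hilferDeriv_eq hμ' hν hν' hK hs hsκ hφ hφc hu hx
    refine ⟨h1.1, ((P.hilferExt α β μ ν).opConverges_iff hKμ φ hx.1.le).mpr
      ((hK.isWeakKernel (-μ)).continuousAt_intervalConv (by linarith) hφ hφc hx).1, ?_⟩
    rw [(P.hilferExt α β μ ν).op_eq_intervalConv hKμ φ hx.1.le, h1.2]
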